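/- Fix a finite relational signature $\tau=\{R_1,\dots,R_\ell\}$ with arities $r_i\in\mathbb N$. For a finite $\tau$-structure $\mathfrak A$ with universe $A$ (its elements are called atoms), $\mathrm{HF}(A)$ denotes the hereditarily finite sets over $A$ (including the atoms; atoms have no elements), and $\mathrm{TC}(a)$ denotes the transitive closure of $a$, i.e. the least transitive set containing all elements of $a$. Permutations of $A$ act on $\mathrm{HF}(A)$ in the obvious way. **Syntax.** Terms are: variables; $\emptyset$; $\mathsf{Atoms}$; $\mathsf{Pair}(s,t)$; $\mathsf{Union}(s)$; $\mathsf{Unique}(s)$; $\mathsf{Card}(s)$; comprehension terms $\{s \mid y\in t,\Phi\}$ ($y$ is bound in $s$ and $\Phi$); iteration terms $s[y]^*$ ($y$ is bound). Formulas are: $R_i(t_1,\dots,t_{r_i})$; $s=t$; Boolean combinations with $\neg,\wedge,\vee$; and WSC-fixed-point operators $\mathrm{WSC}^*xy.(s_{\mathrm{step}},s_{\mathrm{choice}},s_{\mathrm{wit}},\Phi_{\mathrm{out}})$, in which $x,y$ are bound in $s_{\mathrm{step}},s_{\mathrm{wit}}$ and $x$ is bound in $s_{\mathrm{choice}},\Phi_{\mathrm{out}}$.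 A CPT+WSC-term (formula) is a pair $(s,p)$ (respectively $(\Phi,p)$) of a term (formula) and a polynomial $p$ with natural number coefficients. **Semantics.** Let $N=p(|A|)$. For values in $\mathrm{HF}(A)$ of the free variables, the denotation of a term is an element of $\mathrm{HF}(A)\cup\{\dagger\}$ and that of a formula an element of $\{\top,\bot,\dagger\}$; the error marker $\dagger$ is propagated whenever it occurs (in a comprehension term, $s$ is evaluated only for those $y\in t$ that satisfy $\Phi$). * $\mathsf{Atoms}$ denotes $A$, $\mathsf{Pair}(a,b)=\{a,b\}$, $\mathsf{Union}(a)=\bigcup_{c\in a}c$, $\mathsf{Unique}(\{b\})=b$ and $\mathsf{Unique}(a)=\emptyset$ if $a$ is not a singleton set, $\mathsf{Card}(a)$ is the number of elements of $a$ as a von Neumann ordinal. Relations hold of tuples of atoms only. Comprehension, equality and Boolean connectives are as usual. * For $s[y]^*$ let $a_0=\emptyset$ and let $a_{i+1}$ be the value of $s$ for $y=a_i$. If there is an $m\le N$ with $a_{m+1}=a_m$, then for the least such $m$ the value is $a_m$ provided $|\mathrm{TC}(a_i)|\le N$ for all $i\le m$. In all other cases it is $\emptyset$. Here $a_{i+1}$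 is computed, and can raise $\dagger$, only if $i\le N$, $|\mathrm{TC}(a_j)|\le N$ for all $j\le i$, and no fixed point was reached before. * For a WSC-fixed-point operator $\Psi$ let $G$ be the group of automorphisms of $\mathfrak A$ that fix the values of all free variables of $\Psi$. A run is a sequence $b_1,\dots,b_m$ with $b_1=\emptyset$, $b_{i-1}\ne b_i$ for $1<i<m$, and $b_{i+1}=s_{\mathrm{step}}(b_i,c)$ for some $c\in s_{\mathrm{choice}}(b_i)$, where $c=\emptyset$ if $s_{\mathrm{choice}}(b_i)$ has no elements. A path is a run with $m\ge2$ and $b_{m-1}=b_m$. A path $b_1,\dots,b_m$ is witnessed if for every $i<m$ all elements of $M=s_{\mathrm{wit}}(b_m,b_i)$ are automorphisms in $G$ that fix $b_1,\dots,b_i$ (each given as the set of Kuratowski pairs $(a,\varphi(a))$, $a\in A$), and for all $d,e\in s_{\mathrm{choice}}(b_i)$ some element of $M$ maps $d$ to $e$. The value of $\Psi$ is $\dagger$ if some run has length $m>N$, or contains a $b_i$ with $|\mathrm{TC}(b_i)|>N$, or if $\dagger$ occurs in the evaluation of $s_{\mathrm{choice}}$ or $s_{\mathrm{step}}$ for a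 run, or if some path is not witnessed (in particular if $s_{\mathrm{wit}}$ yields $\dagger$), or if $\Phi_{\mathrm{out}}(b)$ is $\dagger$ for the last entry $b$ of some path. Otherwise $\Psi$ is true if and only if $\Phi_{\mathrm{out}}(b)$ is true for the last entry $b$ of every path. **Lemma.** For every CPT+WSC-term $(s,p)$ and every CPT+WSC-formula $(\Phi,p)$ with free variables among $x_1,\dots,x_k$, there is a polynomial-time algorithm (a multi-stack Turing machine with a polynomial bound on the number of steps in terms of the input length) that, on input a finite $\tau$-structure $\mathfrak A$ and a tuple $\bar a\in \mathrm{HF}(A)^k$, computes the denotation of $(s,p)$ respectively $(\Phi,p)$ in $\mathfrak A$ for the values $\bar a$. Here the atoms are numbered $0,\dots,|A|-1$; a structure is given by $|A|$ and the lists of the tuples in its relations; hereditarily finite sets in the input and in the output are given by directed acyclic graphs, namely by a list of sets each of which is the list of its elements, these being atoms or sets that occur earlier in the list; and numbers are written in unary. -/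

import Mathlib

open Computability Turing

namespace CPTWSC

/-! ## Hereditarily finite sets over a set of atoms -/

/-- The map on (pre)lists induced by a map of the atoms. -/
def mapPre {A B : Type} (f : A → B) : {b : Bool} → Lists' A b → Lists' B b
  | _, .atom a => .atom (f a)
  | _, .nil => .nil
  | _, .cons' x l => .cons' (mapPre f x) (mapPre f l)

/-- The map on lists induced by a map of the atoms. -/
def mapLists {A B : Type} (f : A → B) (l : Lists A) : Lists B := ⟨l.1, mapPre f l.2⟩

theorem toList_mapPre {A B : Type} (f : A → B) {b : Bool} (l : Lists' A b) :
    (mapPre f l).toList = l.toList.map (mapLists f) := by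
  induction l with
  | atom a => rfl
  | nil => rfl
  | cons' x l _ ih => simp only [mapPre, Lists'.toList, ih]; rfl

mutual
theorem mapLists_equiv {A B : Type} (f : A → B) :
    {l l' : Lists A} → Lists.Equiv l l' → Lists.Equiv (mapLists f l) (mapLists f l')
  | _, _, .refl _ => .refl _
  | _, _, .antisymm h h' => .antisymm (mapPre_subset f h) (mapPre_subset f h')
theorem mapPre_subset {A B : Type} (f : A → B) :
    {l l' : Lists' A true} → Lists'.Subset l l' → Lists'.Subset (mapPre f l) (mapPre f l')
  | _, _, .nil => .nil
  | _, _, .cons (a' := a') (l' := l') e m s =>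
      .cons (a' := mapLists f a') (mapLists_equiv f e)
        (by rw [toList_mapPre]; exact List.mem_map_of_mem m) (mapPre_subset f s)
end

/-- `HF A`: the hereditarily finite sets over the set `A` of atoms (the atoms are elements). -/
def HF (A : Type) : Type := Finsets A

namespace HF

variable {A : Type}

noncomputable instance : DecidableEq (HF A) := Classical.decEq _

instance : EmptyCollection (HF A) := inferInstanceAs (EmptyCollection (Finsets A))

/-- The hereditarily finite set given by a hereditarily finite list. -/
def mk (l : Lists A) : HF A := Quotient.mk Lists.instSetoidLists l

/-- A hereditarily finite list for a hereditarily finite set. -/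
noncomputable def out (x : HF A) : Lists A := Quotient.out (s := Lists.instSetoidLists) x

theorem mk_eq {l l' : Lists A} : mk l = mk l' ↔ Lists.Equiv l l' :=
  Quotient.eq (r := Lists.instSetoidLists)

theorem mk_out (x : HF A) : mk (out x) = x := Quotient.out_eq (s := Lists.instSetoidLists) x

/-- An atom, as an element of `HF A`. -/
def atom (a : A) : HF A := mk (Lists.atom a)

theorem elems_aux {l l' : Lists A} (h : Lists.Equiv l l') :
    (l.toList.map mk).toFinset ⊆ (l'.toList.map mk).toFinset := by
  intro x hx
  cases h with
  | refl => exact hx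
  | antisymm h _ =>
    obtain ⟨a, ha, rfl⟩ := List.mem_map.1 (List.mem_toFinset.1 hx)
    obtain ⟨a', ha', e⟩ := Lists'.mem_of_subset' h ha
    exact List.mem_toFinset.2 (List.mem_map.2 ⟨a', ha', mk_eq.2 e.symm⟩)

/-- The finite set of all elements of a hereditarily finite set; atoms have no elements. -/
noncomputable def elems (x : HF A) : Finset (HF A) :=
  Quotient.lift (s := Lists.instSetoidLists) (fun l : Lists A => (l.toList.map mk).toFinset)
    (fun _ _ h => Finset.Subset.antisymm (elems_aux h) (elems_aux (Lists.Equiv.symm h))) x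

theorem mem_elems_mk {x : HF A} {l : Lists A} : x ∈ elems (mk l) ↔ ∃ a ∈ l.toList, mk a = x :=
  List.mem_toFinset.trans List.mem_map

/-- The hereditarily finite set with the given elements. -/
noncomputable def ofFinset (s : Finset (HF A)) : HF A := mk (Lists.ofList (s.toList.map out))

theorem elems_atom (a : A) : elems (atom a) = ∅ := rfl

theorem elems_ofFinset (s : Finset (HF A)) : elems (ofFinset s) = s := by
  ext x
  rw [ofFinset, mem_elems_mk, Lists.to_ofList]
  constructor
  · rintro ⟨_, h, rfl⟩
    obtain ⟨y, hy, rfl⟩ := List.mem_map.1 h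
    rw [mk_out]
    exact Finset.mem_toList.1 hy
  · exact fun hx => ⟨out x, List.mem_map.2 ⟨x, Finset.mem_toList.2 hx, rfl⟩, mk_out x⟩

theorem ofFinset_empty : ofFinset (∅ : Finset (HF A)) = ∅ := by
  rw [ofFinset, Finset.toList_empty]; rfl

theorem atom_injective : Function.Injective (atom : A → HF A) := by
  intro a b h
  have h2 := Lists.equiv_atom.1 (mk_eq.1 h)
  cases h2
  rfl

theorem atom_ne_ofFinset (a : A) (s : Finset (HF A)) : atom a ≠ ofFinset s := by
  intro h
  have h' := Lists.equiv_atom.1 (mk_eq.1 h)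
  cases h'

/-- Everything in `HF A` is an atom or the set of its elements. -/
theorem atom_or_ofFinset (x : HF A) : (∃ a, x = atom a) ∨ x = ofFinset (elems x) := by
  obtain ⟨l, rfl⟩ : ∃ l, mk l = x := ⟨_, mk_out x⟩
  obtain ⟨b, l⟩ := l
  cases b with
  | false => cases l with
    | atom a => exact .inl ⟨a, rfl⟩
  | true =>
    refine .inr (mk_eq.2 (Lists.Equiv.antisymm_iff.2
      ⟨Lists'.subset_def.2 fun a ha => ?_, Lists'.subset_def.2 fun a ha => ?_⟩))
    · refine ⟨out (mk a), ?_, mk_eq.1 (mk_out (mk a)).symm⟩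
      rw [Lists'.to_ofList]
      exact List.mem_map.2 ⟨mk a, Finset.mem_toList.2 (mem_elems_mk.2 ⟨a, ha, rfl⟩), rfl⟩
    · rw [Lists'.to_ofList] at ha
      obtain ⟨y, hy, rfl⟩ := List.mem_map.1 ha
      obtain ⟨a', ha', rfl⟩ := mem_elems_mk.1 (Finset.mem_toList.1 hy)
      exact ⟨a', ha', mk_eq.1 (mk_out (mk a'))⟩

/-- The action of a map of the atoms on hereditarily finite sets. -/
def map {B : Type} (f : A → B) (x : HF A) : HF B :=
  Quotient.lift (s := Lists.instSetoidLists) (fun l : Lists A => mk (mapLists f l))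
    (fun _ _ h => mk_eq.2 (mapLists_equiv f h)) x

theorem map_atom {B : Type} (f : A → B) (a : A) : map f (atom a) = atom (f a) := rfl

theorem elems_map {B : Type} (f : A → B) (x : HF A) :
    elems (map f x) = (elems x).image (map f) := by
  obtain ⟨l, rfl⟩ : ∃ l, mk l = x := ⟨_, mk_out x⟩
  ext y
  have h : map f (mk l) = mk (mapLists f l) := rfl
  have h' : (mapLists f l).toList = l.toList.map (mapLists f) := toList_mapPre f l.2
  rw [h, mem_elems_mk, h', Finset.mem_image]
  constructor
  · rintro ⟨_, hw, rfl⟩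
    obtain ⟨z, hz, rfl⟩ := List.mem_map.1 hw
    exact ⟨mk z, mem_elems_mk.2 ⟨z, hz, rfl⟩, rfl⟩
  · rintro ⟨_, hw, rfl⟩
    obtain ⟨z, hz, rfl⟩ := mem_elems_mk.1 hw
    exact ⟨_, List.mem_map.2 ⟨z, hz, rfl⟩, rfl⟩

theorem map_ofFinset {B : Type} (f : A → B) (s : Finset (HF A)) :
    map f (ofFinset s) = ofFinset (s.image (map f)) := by
  rcases atom_or_ofFinset (map f (ofFinset s)) with ⟨a, h⟩ | h
  · have h' := (Lists.equiv_atom.1 (mk_eq.1 h.symm) : Lists.atom a = _)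
    cases h'
  · rw [h, elems_map, elems_ofFinset]

/-- The transitive closure: all sets and atoms occurring as elements of elements of ... of `a`. -/
def TC (a : HF A) : Set (HF A) := {b | Relation.TransGen (fun x y : HF A => x ∈ elems y) b a}

/-- The set of all atoms. -/
noncomputable def atoms [Fintype A] : HF A := ofFinset (Finset.univ.image atom)

/-- The set `{a, b}`. -/
noncomputable def pair (a b : HF A) : HF A := ofFinset {a, b}

/-- The union of all elements of `a`. -/
noncomputable def union (a : HF A) : HF A := ofFinset ((elems a).biUnion elems)

open Classical in
/-- The unique element of `a`, and `∅` if `a` is not a singleton set. -/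
noncomputable def unique (a : HF A) : HF A :=
  if h : ∃ b, elems a = {b} then h.choose else ∅

/-- Von Neumann ordinals. -/
noncomputable def ofNat : ℕ → HF A
  | 0 => ∅
  | n + 1 => ofFinset (insert (ofNat n) (elems (ofNat n)))

/-- The cardinality as a von Neumann ordinal (which is `∅` for an atom). -/
noncomputable def card (a : HF A) : HF A := ofNat (elems a).card

/-- Kuratowski pairs. -/
noncomputable def kpair (a b : HF A) : HF A := pair (pair a a) (pair a b)

/-- A permutation of the atoms as a hereditarily finite set: the set of all pairs `(a, φ a)`. -/
noncomputable def graph [Fintype A] (φ : Equiv.Perm A) : HF A :=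
  ofFinset (Finset.univ.image fun a => kpair (atom a) (atom (φ a)))

end HF

/-! ## Structures and automorphisms -/

/-- A structure with universe `A` for the relational signature with `ℓ` relation symbols of
arities `ar 0, ..., ar (ℓ - 1)`. -/
abbrev Struct {ℓ : ℕ} (ar : Fin ℓ → ℕ) (A : Type) : Type := (i : Fin ℓ) → Set (Fin (ar i) → A)

/-- The automorphisms of a structure. -/
def Struct.aut {ℓ : ℕ} {ar : Fin ℓ → ℕ} {A : Type} (S : Struct ar A) : Set (Equiv.Perm A) :=
  {φ | ∀ (i : Fin ℓ) (t : Fin (ar i) → A), (fun j => φ (t j)) ∈ S i ↔ t ∈ S i}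

/-! ## Syntax of BGS+WSC -/

mutual

/-- BGS+WSC-terms; variables are natural numbers.
`compr s y t Φ` is `{ s | y ∈ t, Φ }` and `iter s y` is the iteration term `s[y]^*`. -/
inductive Term {ℓ : ℕ} (ar : Fin ℓ → ℕ) : Type
  | var (v : ℕ) : Term ar
  | empty : Term ar
  | atoms : Term ar
  | pair (s t : Term ar) : Term ar
  | union (s : Term ar) : Term ar
  | unique (s : Term ar) : Term ar
  | card (s : Term ar) : Term ar
  | compr (s : Term ar) (y : ℕ) (t : Term ar) (Φ : Formula ar) : Term ar
  | iter (s : Term ar) (y : ℕ) : Term ar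

/-- BGS+WSC-formulas; `wsc x y step choice wit out` is the fixed-point operator with witnessed
symmetric choice. -/
inductive Formula {ℓ : ℕ} (ar : Fin ℓ → ℕ) : Type
  | rel (i : Fin ℓ) (t : Fin (ar i) → Term ar) : Formula ar
  | eq (s t : Term ar) : Formula ar
  | not (Φ : Formula ar) : Formula ar
  | and (Φ Ψ : Formula ar) : Formula ar
  | or (Φ Ψ : Formula ar) : Formula ar
  | wsc (x y : ℕ) (step choice wit : Term ar) (out : Formula ar) : Formula ar

end

mutual

/-- The free variables of a term. -/
def Term.freeVars {ℓ : ℕ} {ar : Fin ℓ → ℕ} : Term ar → Finset ℕ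
  | .var v => {v}
  | .empty => ∅
  | .atoms => ∅
  | .pair s t => s.freeVars ∪ t.freeVars
  | .union s => s.freeVars
  | .unique s => s.freeVars
  | .card s => s.freeVars
  | .compr s y t Φ => t.freeVars ∪ (s.freeVars ∪ Φ.freeVars) \ {y}
  | .iter s y => s.freeVars \ {y}

/-- The free variables of a formula. -/
def Formula.freeVars {ℓ : ℕ} {ar : Fin ℓ → ℕ} : Formula ar → Finset ℕ
  | .rel _ t => Finset.univ.biUnion fun j => (t j).freeVars
  | .eq s t => s.freeVars ∪ t.freeVars
  | .not Φ => Φ.freeVars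
  | .and Φ Ψ => Φ.freeVars ∪ Ψ.freeVars
  | .or Φ Ψ => Φ.freeVars ∪ Ψ.freeVars
  | .wsc x y step choice wit out =>
      (step.freeVars ∪ wit.freeVars) \ {x, y} ∪ (choice.freeVars ∪ out.freeVars) \ {x}

end

/-! ## The semantic operators

Values of terms are `Option (HF A)` and values of formulas are `Option Bool`, where `none` is the
error marker `†`. -/

section Operators

variable {A : Type}

open Classical in
/-- Relations hold of tuples of atoms only. -/
noncomputable def relOp {r : ℕ} (R : Set (Fin r → A)) (v : Fin r → Option (HF A)) : Option Bool :=
  if ∃ j, v j = none then none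
  else some (decide (∃ c ∈ R, ∀ j, v j = some (HF.atom (c j))))

open Classical in
/-- The set of all `s b` for `b ∈ m` with `Φ b`. The result is `†` if some `Φ b` is `†`, or if `Φ b`
holds and `s b` is `†`. -/
noncomputable def comprOp (m : HF A) (s : HF A → Option (HF A)) (Φ : HF A → Option Bool) :
    Option (HF A) :=
  if ∃ b ∈ m.elems, Φ b = none ∨ (Φ b = some true ∧ s b = none) then none
  else some (HF.ofFinset ((m.elems.filter fun b => Φ b = some true).image s).eraseNone)

open Classical in
/-- Iteration of `F` from `a` until a fixed point is reached, where `fuel` further changes of the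
value are allowed. The result is `∅` if these do not suffice or if a set whose transitive closure
has more than `N` elements is reached before. -/
noncomputable def iterFrom (N : ℕ) (F : HF A → Option (HF A)) : ℕ → HF A → Option (HF A)
  | fuel, a =>
    if (N : ℕ∞) < a.TC.encard then some ∅
    else match F a with
      | none => none
      | some a' =>
        if a' = a then some a
        else match fuel with
          | 0 => some ∅
          | fuel + 1 => iterFrom N F fuel a'

/-- The iteration starts with `∅` and reaches its fixed point after at most `N` changes. -/
noncomputable def iterOp (N : ℕ) (F : HF A → Option (HF A)) : Option (HF A) := iterFrom N F N ∅

/-- `c` may be chosen at `b`: it is an element of the choice set, and it is `∅` if the choice set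
has no elements (so nothing is chosen). -/
def Chosen (choice : HF A → Option (HF A)) (b c : HF A) : Prop :=
  ∃ m, choice b = some m ∧ (c ∈ m.elems ∨ m.elems = ∅ ∧ c = ∅)

/-- `IsRun step choice [bᵢ, ..., b₁]` holds if `b₁, ..., bᵢ` is a sequence of labels on an initial
part of a computation (latest label first): it starts with `∅`, continues with `step b c` for a
choice `c`, and does not continue after two equal consecutive labels. -/
inductive IsRun (step : HF A → HF A → Option (HF A)) (choice : HF A → Option (HF A)) :
    List (HF A) → Prop
  | start : IsRun step choice [∅]
  | next {b c b' : HF A} {l : List (HF A)} : IsRun step choice (b :: l) → l.head? ≠ some b →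
      Chosen choice b c → step b c = some b' → IsRun step choice (b' :: b :: l)

/-- A run that has reached a fixed point. -/
def IsPath (step : HF A → HF A → Option (HF A)) (choice : HF A → Option (HF A))
    (l : List (HF A)) : Prop :=
  IsRun step choice l ∧ ∃ b l', l = b :: b :: l'

/-- The set of all fixed points reached. -/
def wscSet (step : HF A → HF A → Option (HF A)) (choice : HF A → Option (HF A)) : Set (HF A) :=
  {b | ∃ l, IsPath step choice (b :: l)}

/-- `M` is a set of (graphs of) permutations in `G`, and for all elements `b`, `c` of `N` it
contains one that maps `b` to `c`. -/
def Witnesses [Fintype A] (G : Set (Equiv.Perm A)) (M N : HF A) : Prop :=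
  (∀ m ∈ M.elems, ∃ φ ∈ G, m = HF.graph φ) ∧
    ∀ b ∈ N.elems, ∀ c ∈ N.elems, ∃ φ ∈ G, HF.graph φ ∈ M.elems ∧ HF.map φ b = c

/-- `wit` witnesses the path `[bₙ, ..., b₁]`: for every `i < n` the value `wit bₙ bᵢ` witnesses
`choice bᵢ` as an orbit of the group `G` with `b₁, ..., bᵢ` fixed. -/
def WitnessesPath [Fintype A] (G : Set (Equiv.Perm A)) (choice : HF A → Option (HF A))
    (wit : HF A → HF A → Option (HF A)) (l : List (HF A)) : Prop :=
  ∀ bn l₀, l = bn :: l₀ → ∀ b l', (b :: l') <:+ l₀ →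
    ∃ M N, wit bn b = some M ∧ choice b = some N ∧
      Witnesses {φ | φ ∈ G ∧ ∀ e ∈ b :: l', HF.map φ e = e} M N

/-- The evaluation of a fixed-point operator with witnessed symmetric choice fails: a run is longer
than `N` or contains a set of size more than `N`, or the error marker occurs in a run, or a path
is not witnessed. -/
def Fails [Fintype A] (N : ℕ) (G : Set (Equiv.Perm A)) (step : HF A → HF A → Option (HF A))
    (choice : HF A → Option (HF A)) (wit : HF A → HF A → Option (HF A)) : Prop :=
  (∃ l, IsRun step choice l ∧ (N < l.length ∨ ∃ b ∈ l, (N : ℕ∞) < b.TC.encard)) ∨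
  (∃ b l, IsRun step choice (b :: l) ∧ l.head? ≠ some b ∧
    (choice b = none ∨ ∃ c, Chosen choice b c ∧ step b c = none)) ∨
  (∃ l, IsPath step choice l ∧ ¬ WitnessesPath G choice wit l)

open Classical in
/-- The truth value of a fixed-point operator with witnessed symmetric choice: the output holds for
all fixed points. -/
noncomputable def wscOp [Fintype A] (N : ℕ) (G : Set (Equiv.Perm A))
    (step : HF A → HF A → Option (HF A)) (choice : HF A → Option (HF A))
    (wit : HF A → HF A → Option (HF A)) (out : HF A → Option Bool) : Option Bool :=
  if Fails N G step choice wit ∨ ∃ b ∈ wscSet step choice, out b = none then none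
  else some (decide (∀ b ∈ wscSet step choice, out b = some true))

end Operators

/-! ## Semantics of CPT+WSC -/

section Semantics

variable {ℓ : ℕ} {ar : Fin ℓ → ℕ} {A : Type} [Fintype A]

open Classical in
mutual

/-- The value of a term in the structure `S` under the assignment `ρ` with bound `N`. -/
noncomputable def Term.eval (N : ℕ) (S : Struct ar A) : Term ar → (ℕ → HF A) → Option (HF A)
  | .var v, ρ => some (ρ v)
  | .empty, _ => some ∅
  | .atoms, _ => some HF.atoms
  | .pair s t, ρ => (s.eval N S ρ).bind fun a => (t.eval N S ρ).map fun b => HF.pair a b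
  | .union s, ρ => (s.eval N S ρ).map HF.union
  | .unique s, ρ => (s.eval N S ρ).map HF.unique
  | .card s, ρ => (s.eval N S ρ).map HF.card
  | .compr s y t Φ, ρ => (t.eval N S ρ).bind fun m =>
      comprOp m (fun b => s.eval N S (Function.update ρ y b))
        (fun b => Φ.eval N S (Function.update ρ y b))
  | .iter s y, ρ => iterOp N fun a => s.eval N S (Function.update ρ y a)

/-- The truth value of a formula in the structure `S` under the assignment `ρ` with bound `N`.
The choice sets of a `wsc`-operator have to be orbits of the group of automorphisms which stabilize
the values of the free variables of the operator. -/
noncomputable def Formula.eval (N : ℕ) (S : Struct ar A) : Formula ar → (ℕ → HF A) → Option Bool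
  | .rel i t, ρ => relOp (S i) fun j => (t j).eval N S ρ
  | .eq s t, ρ => (s.eval N S ρ).bind fun a => (t.eval N S ρ).map fun b => decide (a = b)
  | .not Φ, ρ => (Φ.eval N S ρ).map fun a => !a
  | .and Φ Ψ, ρ => (Φ.eval N S ρ).bind fun a => (Ψ.eval N S ρ).map fun b => a && b
  | .or Φ Ψ, ρ => (Φ.eval N S ρ).bind fun a => (Ψ.eval N S ρ).map fun b => a || b
  | .wsc x y step choice wit out, ρ =>
      wscOp N
        {φ | φ ∈ S.aut ∧
          ∀ v ∈ (Formula.wsc x y step choice wit out).freeVars, HF.map φ (ρ v) = ρ v}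
        (fun b c => step.eval N S (Function.update (Function.update ρ x b) y c))
        (fun b => choice.eval N S (Function.update ρ x b))
        (fun b c => wit.eval N S (Function.update (Function.update ρ x b) y c))
        (fun b => out.eval N S (Function.update ρ x b))

end

/-- The assignment of the tuple `a` to the variables `0, ..., k - 1`. -/
def assign {k : ℕ} (a : Fin k → HF A) (v : ℕ) : HF A := if h : v < k then a ⟨v, h⟩ else ∅

/-- The denotation of the CPT+WSC-term `(s, p)` with variables `0, ..., k - 1`. -/
noncomputable def Term.denotation {k : ℕ} (s : Term ar) (p : Polynomial ℕ) (S : Struct ar A)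
    (a : Fin k → HF A) : Option (HF A) :=
  s.eval (p.eval (Fintype.card A)) S (assign a)

/-- The denotation of the CPT+WSC-formula `(Φ, p)` with variables `0, ..., k - 1`. -/
noncomputable def Formula.denotation {k : ℕ} (Φ : Formula ar) (p : Polynomial ℕ)
    (S : Struct ar A) (a : Fin k → HF A) : Option Bool :=
  Φ.eval (p.eval (Fintype.card A)) S (assign a)

end Semantics

/-! ## Inputs and outputs of algorithms -/

/-- The symbols of the strings that machines read and write. -/
inductive Sym
  | tick | num | row | block
  deriving DecidableEq

instance : Fintype Sym :=
  ⟨{.tick, .num, .row, .block}, fun x => by cases x <;> simp⟩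

/-- Numbers are written in unary, and every number, every list of numbers, and every list of lists
of numbers is followed by an end mark of its own. -/
def encodeNum (m : ℕ) : List Sym := List.replicate m .tick ++ [.num]

/-- See `encodeNum`. -/
def encodeRow (r : List ℕ) : List Sym := r.flatMap encodeNum ++ [.row]

/-- See `encodeNum`. -/
def encodeBlock (b : List (List ℕ)) : List Sym := b.flatMap encodeRow ++ [.block]

/-- See `encodeNum`. -/
def encodeData (d : List (List (List ℕ))) : List Sym := d.flatMap encodeBlock

/-- Reading one symbol, from right to left. -/
def decodeSym : Sym → List (List (List ℕ)) → List (List (List ℕ))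
  | .tick => List.modifyHead (List.modifyHead (List.modifyHead Nat.succ))
  | .num => List.modifyHead (List.modifyHead (List.cons 0))
  | .row => List.modifyHead (List.cons [])
  | .block => List.cons []

/-- The inverse of `encodeData`. -/
def decodeData (w : List Sym) : List (List (List ℕ)) := w.foldr decodeSym []

theorem decode_encodeNum (m : ℕ) (r : List ℕ) (b : List (List ℕ)) (d : List (List (List ℕ))) :
    (encodeNum m).foldr decodeSym ((r :: b) :: d) = ((m :: r) :: b) :: d := by
  have h : ∀ m : ℕ, (List.replicate m Sym.tick).foldr decodeSym (((0 :: r) :: b) :: d) =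
      ((m :: r) :: b) :: d := by
    intro m
    induction m with
    | zero => rfl
    | succ m ih => rw [List.replicate_succ, List.foldr_cons, ih]; rfl
  rw [encodeNum, List.foldr_append]
  exact h m

theorem decode_encodeRow (r : List ℕ) (b : List (List ℕ)) (d : List (List (List ℕ))) :
    (encodeRow r).foldr decodeSym (b :: d) = (r :: b) :: d := by
  have h : ∀ r : List ℕ, (r.flatMap encodeNum).foldr decodeSym (([] :: b) :: d) =
      (r :: b) :: d := by
    intro r
    induction r with
    | nil => rfl
    | cons m r ih => rw [List.flatMap_cons, List.foldr_append, ih, decode_encodeNum]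
  rw [encodeRow, List.foldr_append]
  exact h r

theorem decode_encodeBlock (b : List (List ℕ)) (d : List (List (List ℕ))) :
    (encodeBlock b).foldr decodeSym d = b :: d := by
  have h : ∀ b : List (List ℕ), (b.flatMap encodeRow).foldr decodeSym ([] :: d) = b :: d := by
    intro b
    induction b with
    | nil => rfl
    | cons r b ih => rw [List.flatMap_cons, List.foldr_append, ih, decode_encodeRow]
  rw [encodeBlock, List.foldr_append]
  exact h b

theorem decode_encodeData (d : List (List (List ℕ))) : decodeData (encodeData d) = d := by
  induction d with
  | nil => rfl
  | cons b d ih =>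
    rw [encodeData, decodeData, List.flatMap_cons, List.foldr_append]
    rw [encodeData, decodeData] at ih
    rw [ih, decode_encodeBlock]

/-- The hereditarily finite sets given by a list of sets over the atoms `e 0, ..., e (n - 1)`: each
set is the list of the positions of its elements in the list that has the atoms first, followed by
the preceding sets (positions that do not exist there are ignored). The result is the list of the
atoms followed by all these sets. -/
noncomputable def hfValues {A : Type} {n : ℕ} (e : Fin n ≃ A) (sets : List (List ℕ)) :
    List (HF A) :=
  sets.foldl (fun vs r => vs ++ [HF.ofFinset (r.filterMap fun j => vs[j]?).toFinset])
    (List.ofFn fun i => HF.atom (e i))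

/-- An input: the number of atoms, for each relation the list of its tuples, a list of
hereditarily finite sets (see `hfValues`), and the positions of the parameters in that list. -/
structure InputCode where
  size : ℕ
  rels : List (List (List ℕ))
  sets : List (List ℕ)
  params : List ℕ

/-- The string for an input. -/
def InputCode.encode (c : InputCode) : List Sym :=
  encodeData ([[c.size], c.params] :: c.sets :: c.rels)

/-- The encoding of inputs as strings. -/
def inputEncoding : Encoding InputCode Sym where
  encode := InputCode.encode
  decode w := match decodeData w with
    | [[n], ps] :: ss :: rs => some ⟨n, rs, ss, ps⟩
    | _ => none
  decode_encode c := by simp [InputCode.encode, decode_encodeData]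

/-- The input `c` stands for the structure `S` and the tuple `a`, where `e` tells which atom has
which number. -/
def InputCode.Represents {ℓ : ℕ} {ar : Fin ℓ → ℕ} {A : Type} {k : ℕ} (c : InputCode)
    (e : Fin c.size ≃ A) (S : Struct ar A) (a : Fin k → HF A) : Prop :=
  (∀ (i : Fin ℓ) (t : Fin (ar i) → Fin c.size),
    (fun j => e (t j)) ∈ S i ↔ (List.ofFn fun j => (t j : ℕ)) ∈ c.rels.getD i []) ∧
  (c.params.map fun r => (hfValues e c.sets)[r]?) = List.ofFn fun i => some (a i)

/-- An output in `HF A ∪ {†}`: a list of hereditarily finite sets (see `hfValues`) and the position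
of the result in that list, or `none` for `†`. -/
abbrev SetCode : Type := Option (List (List ℕ) × ℕ)

/-- The encoding of outputs in `HF A ∪ {†}` as strings. -/
def setEncoding : Encoding SetCode Sym where
  encode
    | none => encodeData []
    | some (ss, r) => encodeData [ss, [[r]]]
  decode w := match decodeData w with
    | [] => some none
    | [ss, [[r]]] => some (some (ss, r))
    | _ => none
  decode_encode o := by
    rcases o with _ | ⟨ss, r⟩ <;> simp [decode_encodeData]

/-- The output `o` stands for the value `v`. -/
def SetCode.Represents {A : Type} {n : ℕ} (o : SetCode) (e : Fin n ≃ A) (v : Option (HF A)) :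
    Prop :=
  (o.map fun q => (hfValues e q.1)[q.2]?) = v.map some

/-- The encoding of truth values in `{⊤, ⊥, †}` as strings. -/
def truthEncoding : Encoding (Option Bool) Bool where
  encode := Option.toList
  decode w := some w.head?
  decode_encode o := by cases o <;> rfl

end CPTWSC

namespace CPTWSC

/-! ## Structured programs on stacks of bits -/

/-- The work stacks. -/
inductive Reg
  | m | x | y | c
  deriving DecidableEq

/-- The contents of the work stacks. -/
def regs (m x y c : List Bool) : Reg → List Bool
  | .m => m
  | .x => x
  | .y => y
  | .c => c

section regs

variable (m x y c l : List Bool)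

@[simp] theorem regs_m : regs m x y c .m = m := rfl
@[simp] theorem regs_x : regs m x y c .x = x := rfl
@[simp] theorem regs_y : regs m x y c .y = y := rfl
@[simp] theorem regs_c : regs m x y c .c = c := rfl

@[simp] theorem update_regs_m : Function.update (regs m x y c) .m l = regs l x y c := by
  funext r; cases r <;> simp [Function.update, regs]
@[simp] theorem update_regs_x : Function.update (regs m x y c) .x l = regs m l y c := by
  funext r; cases r <;> simp [Function.update, regs]
@[simp] theorem update_regs_y : Function.update (regs m x y c) .y l = regs m x l c := by
  funext r; cases r <;> simp [Function.update, regs]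
@[simp] theorem update_regs_c : Function.update (regs m x y c) .c l = regs m x y l := by
  funext r; cases r <;> simp [Function.update, regs]

end regs

/-- Structured programs. -/
inductive Cmd
  | push (r : Reg) (b : Bool)
  | pop (r : Reg)
  | move (r r' : Reg)
  | seq (c d : Cmd)
  | ite (r : Reg) (p : Option Bool → Bool) (c d : Cmd)
  | loop (r : Reg) (p : Option Bool → Bool) (c : Cmd)

/-- `Exec c R R' t`: the program `c` transforms `R` into `R'` in `t` steps. -/
inductive Exec : Cmd → (Reg → List Bool) → (Reg → List Bool) → ℕ → Prop
  | push {r : Reg} {b : Bool} {R R' : Reg → List Bool} (h : R' = Function.update R r (b :: R r)) : Exec (.push r b) R R' 1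
  | pop {r : Reg} {R R' : Reg → List Bool} (h : R' = Function.update R r (R r).tail) : Exec (.pop r) R R' 1
  | move {r r' : Reg} {b : Bool} {l : List Bool} {R R' : Reg → List Bool} (h : R r = b :: l)
      (h' : R' = Function.update (Function.update R r l) r' (b :: Function.update R r l r')) :
      Exec (.move r r') R R' 1
  | seq {c d R R₁ R₂ t₁ t₂} (h₁ : Exec c R R₁ t₁) (h₂ : Exec d R₁ R₂ t₂) :
      Exec (.seq c d) R R₂ (t₁ + t₂)
  | ite_true {r p c d R R₁ t} (hp : p (R r).head? = true) (h : Exec c R R₁ t) :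
      Exec (.ite r p c d) R R₁ (1 + t)
  | ite_false {r p c d R R₁ t} (hp : p (R r).head? = false) (h : Exec d R R₁ t) :
      Exec (.ite r p c d) R R₁ (1 + t)
  | loop_done {r p c R} (hp : p (R r).head? = false) : Exec (.loop r p c) R R 1
  | loop_step {r p c R R₁ R₂ t₁ t₂} (hp : p (R r).head? = true) (h₁ : Exec c R R₁ t₁)
      (h₂ : Exec (.loop r p c) R₁ R₂ t₂) : Exec (.loop r p c) R R₂ (1 + t₁ + t₂)

/-! ## Compilation to multi-stack Turing machines -/

/-- The stacks of the machine. -/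
inductive Stk
  | reg (r : Reg) | inp | out
  deriving DecidableEq

instance : Fintype Stk :=
  ⟨{.reg .m, .reg .x, .reg .y, .reg .c, .inp, .out}, fun k => by
    rcases k with r | _ | _ <;> [cases r; skip; skip] <;> simp⟩

/-- The alphabets of the stacks. -/
abbrev Alph (Ω : Type) : Stk → Type
  | .reg _ => Bool
  | .inp => Sym
  | .out => Ω

/-- The contents of all stacks. -/
def stks {Ω : Type} (R : Reg → List Bool) (i : List Sym) (o : List Ω) : ∀ k, List (Alph Ω k)
  | .reg r => R r
  | .inp => i
  | .out => o

section stks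

variable {Ω : Type} (R : Reg → List Bool) (i : List Sym) (o : List Ω)

@[simp] theorem stks_reg (r : Reg) : stks R i o (.reg r) = R r := rfl
@[simp] theorem stks_inp : stks R i o .inp = i := rfl
@[simp] theorem stks_out : stks R i o .out = o := rfl

@[simp] theorem update_stks_reg (r : Reg) (l : List Bool) :
    Function.update (stks R i o) (.reg r) l =
      stks (Function.update R r l) i o := by
  funext k
  rcases k with r' | _ | _
  · by_cases h : r' = r
    · subst h; simp
    · simp [h]
  all_goals simp
@[simp] theorem update_stks_inp (l : List Sym) :
    Function.update (stks R i o) .inp l = stks R l o := by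
  funext k; cases k <;> simp
@[simp] theorem update_stks_out (l : List Ω) :
    Function.update (stks R i o) .out l = stks R i l := by
  funext k; cases k <;> simp

end stks

/-- The internal state: the last bit and the last input symbol read. -/
abbrev Mem : Type := Option Bool × Option Sym

/-- The labels in the machine code for a program. -/
def Lab : Cmd → Type
  | .push _ _ => Unit
  | .pop _ => Unit
  | .move _ _ => Unit
  | .seq c d => Lab c ⊕ Lab d
  | .ite _ _ c d => Option (Lab c ⊕ Lab d)
  | .loop _ _ c => Option (Lab c)

instance Lab.fintype : ∀ c : Cmd, Fintype (Lab c)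
  | .push _ _ => inferInstanceAs (Fintype Unit)
  | .pop _ => inferInstanceAs (Fintype Unit)
  | .move _ _ => inferInstanceAs (Fintype Unit)
  | .seq c d =>
    haveI := Lab.fintype c; haveI := Lab.fintype d; inferInstanceAs (Fintype (Lab c ⊕ Lab d))
  | .ite _ _ c d =>
    haveI := Lab.fintype c; haveI := Lab.fintype d
    inferInstanceAs (Fintype (Option (Lab c ⊕ Lab d)))
  | .loop _ _ c => haveI := Lab.fintype c; inferInstanceAs (Fintype (Option (Lab c)))

/-- The label where a program starts. -/
def Lab.entry : ∀ c : Cmd, Lab c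
  | .push _ _ => ()
  | .pop _ => ()
  | .move _ _ => ()
  | .seq c _ => .inl (Lab.entry c)
  | .ite _ _ _ _ => none
  | .loop _ _ _ => none

open TM2.Stmt in
/-- The machine code for a program, whose labels are embedded by `e`, and which leads to the label
`exit` in the end. -/
def code {Ω Λ : Type} : ∀ c : Cmd, (Lab c → Λ) → Λ → Lab c → TM2.Stmt (Alph Ω) Λ Mem
  | .push r b, _, exit, _ => push (.reg r) (fun _ => b) (goto fun _ => exit)
  | .pop r, _, exit, _ => pop (.reg r) (fun v _ => v) (goto fun _ => exit)
  | .move r r', _, exit, _ => pop (.reg r) (fun v o => (o, v.2))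
      (push (.reg r') (fun v => v.1.getD false) (goto fun _ => exit))
  | .seq c d, e, _, .inl l => code c (e ∘ .inl) (e (.inr (Lab.entry d))) l
  | .seq _ d, e, exit, .inr l => code d (e ∘ .inr) exit l
  | .ite r p c d, e, _, none => peek (.reg r) (fun v o => (o, v.2)) (branch (fun v => p v.1)
      (goto fun _ => e (some (.inl (Lab.entry c)))) (goto fun _ => e (some (.inr (Lab.entry d)))))
  | .ite _ _ c _, e, exit, some (.inl l) => code c (e ∘ some ∘ .inl) exit l
  | .ite _ _ _ d, e, exit, some (.inr l) => code d (e ∘ some ∘ .inr) exit l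
  | .loop r p c, e, exit, none => peek (.reg r) (fun v o => (o, v.2)) (branch (fun v => p v.1)
      (goto fun _ => e (some (Lab.entry c))) (goto fun _ => exit))
  | .loop _ _ c, e, _, some l => code c (e ∘ some) (e none) l

/-- From `a`, repeated application of `f` leads to `b` in exactly `t` steps. -/
def StepsTo {C : Type*} (f : C → Option C) (a b : C) (t : ℕ) : Prop :=
  (flip bind f)^[t] (some a) = some b

theorem StepsTo.trans {C : Type*} {f : C → Option C} {a b c : C} {s t : ℕ}
    (h₁ : StepsTo f a b s) (h₂ : StepsTo f b c t) : StepsTo f a c (s + t) := by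
  unfold StepsTo at *
  rw [add_comm, Function.iterate_add_apply, h₁, h₂]

theorem StepsTo.one {C : Type*} {f : C → Option C} {a b : C} (h : f a = some b) :
    StepsTo f a b 1 := h

theorem Exec.stepsTo {Ω Λ : Type} {c : Cmd} {R R' : Reg → List Bool} {t : ℕ}
    (h : Exec c R R' t) : ∀ {M : Λ → TM2.Stmt (Alph Ω) Λ Mem} {e : Lab c → Λ} {exit : Λ}
    (_ : ∀ l, M (e l) = code c e exit l) (v : Mem) (i : List Sym) (o : List Ω),
    ∃ v', StepsTo (TM2.step M) ⟨some (e (Lab.entry c)), v, stks R i o⟩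
      ⟨some exit, v', stks R' i o⟩ t := by
  induction h with
  | push h =>
    intro M e exit hM v i o
    refine ⟨v, .one ?_⟩
    simp [hM, code, h]
  | pop h =>
    intro M e exit hM v i o
    refine ⟨v, .one ?_⟩
    simp [hM, code, h]
  | @move r r' b l R R' h h' =>
    intro M e exit hM v i o
    refine ⟨(some b, v.2), .one ?_⟩
    simp [hM, code, h, h']
  | @seq c d _ _ _ _ _ _ _ ih₁ ih₂ =>
    intro M e exit hM v i o
    obtain ⟨v₁, h₁⟩ := ih₁ (M := M) (e := e ∘ .inl) (exit := e (.inr (Lab.entry d)))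
      (fun l => hM (.inl l)) v i o
    obtain ⟨v₂, h₂⟩ := ih₂ (M := M) (e := e ∘ .inr) (exit := exit) (fun l => hM (.inr l)) v₁ i o
    exact ⟨v₂, h₁.trans h₂⟩
  | @ite_true r p c d R R₁ t hp _ ih =>
    intro M e exit hM v i o
    obtain ⟨v₁, h₁⟩ := ih (M := M) (e := e ∘ some ∘ .inl) (exit := exit)
      (fun l => hM (some (.inl l))) ((R r).head?, v.2) i o
    refine ⟨v₁, .trans (.one ?_) h₁⟩
    have := hM none
    simp [Lab.entry, this, code, hp]
    rfl
  | @ite_false r p c d R R₁ t hp _ ih =>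
    intro M e exit hM v i o
    obtain ⟨v₁, h₁⟩ := ih (M := M) (e := e ∘ some ∘ .inr) (exit := exit)
      (fun l => hM (some (.inr l))) ((R r).head?, v.2) i o
    refine ⟨v₁, .trans (.one ?_) h₁⟩
    have := hM none
    simp [Lab.entry, this, code, hp]
    rfl
  | @loop_done r p c R hp =>
    intro M e exit hM v i o
    refine ⟨((R r).head?, v.2), .one ?_⟩
    have := hM none
    simp [Lab.entry, this, code, hp]
  | @loop_step r p c R R₁ R₂ t₁ t₂ hp _ _ ih₁ ih₂ =>
    intro M e exit hM v i o
    obtain ⟨v₁, h₁⟩ := ih₁ (M := M) (e := e ∘ some) (exit := e none)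
      (fun l => hM (some l)) ((R r).head?, v.2) i o
    obtain ⟨v₂, h₂⟩ := ih₂ hM v₁ i o
    refine ⟨v₂, .trans (.trans (.one ?_) h₁) h₂⟩
    have := hM none
    simp [Lab.entry, this, code, hp]
    rfl

end CPTWSC

namespace CPTWSC

/-! ## Binary trees on the main stack -/

/-- Binary trees. -/
inductive SExp
  | nil
  | cons (a b : SExp)

namespace SExp

/-- Trees in Polish notation. -/
def ser : SExp → List Bool
  | nil => [false]
  | cons a b => true :: (a.ser ++ b.ser)

/-- The length of the Polish notation. -/
def size (t : SExp) : ℕ := t.ser.length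

@[simp] theorem size_nil : size nil = 1 := rfl
@[simp] theorem size_cons (a b : SExp) : size (cons a b) = a.size + b.size + 1 := by
  simp [size, ser]

theorem size_pos (t : SExp) : 0 < t.size := by cases t <;> simp

/-- The length of a tree regarded as a list. -/
def spine : SExp → ℕ
  | nil => 0
  | cons _ b => b.spine + 1

end SExp

open SExp

/-- The test for the bit `true`. -/
def isT (o : Option Bool) : Bool := o == some true

/-- Moves everything from a stack to another. -/
def backCmd (r r' : Reg) : Cmd := .loop r Option.isSome (.move r r')

/-- Moves a tree from the main stack to another stack, in reverse. -/
def moveCmd (r : Reg) : Cmd :=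
  .seq (.push .c true)
    (.loop .c isT (.seq (.ite .m isT (.push .c true) (.pop .c)) (.move .m r)))

/-- Drops a tree from the main stack. -/
def dropCmd : Cmd :=
  .seq (.push .c true)
    (.loop .c isT (.seq (.ite .m isT (.push .c true) (.pop .c)) (.pop .m)))

/-- Exchanges the two topmost trees of the main stack. -/
def swapCmd : Cmd :=
  .seq (.seq (moveCmd .x) (moveCmd .y)) (.seq (backCmd .x .m) (backCmd .y .m))

/-- Duplicates the topmost tree of the main stack. -/
def dupCmd : Cmd :=
  .seq (.seq (moveCmd .x)
    (.loop .x Option.isSome (.seq (.ite .x isT (.push .y true) (.push .y false)) (.move .x .m))))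
    (.seq (backCmd .y .x) (backCmd .x .m))

theorem Exec.cast {c : Cmd} {R R' : Reg → List Bool} {t t' : ℕ} (h : Exec c R R' t)
    (e : t = t') : Exec c R R' t' := e ▸ h

theorem exec_back_x_m (l m y c : List Bool) :
    Exec (backCmd .x .m) (regs m l y c) (regs (l.reverse ++ m) [] y c) (2 * l.length + 1) := by
  induction l generalizing m with
  | nil => exact .loop_done rfl
  | cons b l ih =>
    exact Exec.cast (.loop_step (R₁ := regs (b :: m) l y c) rfl (.move (b := b) (l := l) rfl (by simp))
      (by simpa [backCmd] using ih (b :: m))) (by simp; ring)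

theorem exec_back_y_m (l m x c : List Bool) :
    Exec (backCmd .y .m) (regs m x l c) (regs (l.reverse ++ m) x [] c) (2 * l.length + 1) := by
  induction l generalizing m with
  | nil => exact .loop_done rfl
  | cons b l ih =>
    exact Exec.cast (.loop_step (R₁ := regs (b :: m) x l c) rfl (.move (b := b) (l := l) rfl (by simp))
      (by simpa [backCmd] using ih (b :: m))) (by simp; ring)

theorem exec_back_y_x (l m x c : List Bool) :
    Exec (backCmd .y .x) (regs m x l c) (regs m (l.reverse ++ x) [] c) (2 * l.length + 1) := by
  induction l generalizing x with
  | nil => exact .loop_done rfl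
  | cons b l ih =>
    exact Exec.cast (.loop_step (R₁ := regs m (b :: x) l c) rfl (.move (b := b) (l := l) rfl (by simp))
      (by simpa [backCmd] using ih (b :: x))) (by simp; ring)

theorem exec_scan_x (t : SExp) {m x y c : List Bool} {R : Reg → List Bool} {n : ℕ}
    (h : Exec (.loop .c isT (.seq (.ite .m isT (.push .c true) (.pop .c)) (.move .m .x)))
      (regs m (t.ser.reverse ++ x) y c) R n) :
    Exec (.loop .c isT (.seq (.ite .m isT (.push .c true) (.pop .c)) (.move .m .x)))
      (regs (t.ser ++ m) x y (true :: c)) R (4 * t.size + n) := by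
  induction t generalizing m x c n with
  | nil =>
    exact Exec.cast (.loop_step rfl (.seq (.ite_false rfl (.pop rfl)) (.move rfl rfl))
      (by simpa [ser] using h)) (by simp)
  | cons a b iha ihb =>
    have h1 := iha (m := b.ser ++ m) (x := true :: x) (c := true :: c)
      (ihb (m := m) (x := a.ser.reverse ++ true :: x) (c := c) (by simpa [ser] using h))
    exact Exec.cast (.loop_step rfl (.seq (.ite_true rfl (.push rfl)) (.move rfl rfl))
      (by simpa [ser] using h1)) (by simp; ring)

theorem exec_scan_y (t : SExp) {m x y c : List Bool} {R : Reg → List Bool} {n : ℕ}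
    (h : Exec (.loop .c isT (.seq (.ite .m isT (.push .c true) (.pop .c)) (.move .m .y)))
      (regs m x (t.ser.reverse ++ y) c) R n) :
    Exec (.loop .c isT (.seq (.ite .m isT (.push .c true) (.pop .c)) (.move .m .y)))
      (regs (t.ser ++ m) x y (true :: c)) R (4 * t.size + n) := by
  induction t generalizing m y c n with
  | nil =>
    exact Exec.cast (.loop_step rfl (.seq (.ite_false rfl (.pop rfl)) (.move rfl rfl))
      (by simpa [ser] using h)) (by simp)
  | cons a b iha ihb =>
    have h1 := iha (m := b.ser ++ m) (y := true :: y) (c := true :: c)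
      (ihb (m := m) (y := a.ser.reverse ++ true :: y) (c := c) (by simpa [ser] using h))
    exact Exec.cast (.loop_step rfl (.seq (.ite_true rfl (.push rfl)) (.move rfl rfl))
      (by simpa [ser] using h1)) (by simp; ring)

theorem exec_scan_drop (t : SExp) {m x y c : List Bool} {R : Reg → List Bool} {n : ℕ}
    (h : Exec (.loop .c isT (.seq (.ite .m isT (.push .c true) (.pop .c)) (.pop .m)))
      (regs m x y c) R n) :
    Exec (.loop .c isT (.seq (.ite .m isT (.push .c true) (.pop .c)) (.pop .m)))
      (regs (t.ser ++ m) x y (true :: c)) R (4 * t.size + n) := by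
  induction t generalizing m c n with
  | nil =>
    exact Exec.cast (.loop_step rfl (.seq (.ite_false rfl (.pop rfl)) (.pop rfl))
      (by simpa [ser] using h)) (by simp)
  | cons a b iha ihb =>
    have h1 := iha (m := b.ser ++ m) (c := true :: c) (ihb (m := m) (c := c) h)
    exact Exec.cast (.loop_step rfl (.seq (.ite_true rfl (.push rfl)) (.pop rfl))
      (by simpa [ser] using h1)) (by simp; ring)

theorem exec_move_x (t : SExp) (m x y : List Bool) :
    Exec (moveCmd .x) (regs (t.ser ++ m) x y []) (regs m (t.ser.reverse ++ x) y [])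
      (4 * t.size + 2) :=
  Exec.cast (.seq (.push rfl) (by simpa using exec_scan_x t (.loop_done rfl))) (by ring)

theorem exec_move_y (t : SExp) (m x y : List Bool) :
    Exec (moveCmd .y) (regs (t.ser ++ m) x y []) (regs m x (t.ser.reverse ++ y) [])
      (4 * t.size + 2) :=
  Exec.cast (.seq (.push rfl) (by simpa using exec_scan_y t (.loop_done rfl))) (by ring)

/-- `Eff c l l' T`: the program `c` replaces `l` by `l'` on the main stack in at most `T` steps. -/
def Eff (c : Cmd) (l l' : List Bool) (T : ℕ) : Prop :=
  ∃ t ≤ T, Exec c (regs l [] [] []) (regs l' [] [] []) t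

theorem Eff.mono {c : Cmd} {l l' : List Bool} {T T' : ℕ} (h : Eff c l l' T) (hT : T ≤ T') :
    Eff c l l' T' :=
  let ⟨t, ht, e⟩ := h
  ⟨t, ht.trans hT, e⟩

theorem Eff.seq {c d : Cmd} {l₁ l₂ l₃ : List Bool} {T₁ T₂ : ℕ} (h₁ : Eff c l₁ l₂ T₁)
    (h₂ : Eff d l₂ l₃ T₂) : Eff (.seq c d) l₁ l₃ (T₁ + T₂) :=
  let ⟨_, h₁, e₁⟩ := h₁
  let ⟨_, h₂, e₂⟩ := h₂
  ⟨_, add_le_add h₁ h₂, .seq e₁ e₂⟩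

theorem Eff.push (b : Bool) (l : List Bool) : Eff (.push .m b) l (b :: l) 1 :=
  ⟨1, le_rfl, .push (by simp)⟩

theorem Eff.pop (b : Bool) (l : List Bool) : Eff (.pop .m) (b :: l) l 1 :=
  ⟨1, le_rfl, .pop (by simp)⟩

theorem Eff.ite_true {c d : Cmd} {l l' : List Bool} {T : ℕ} (h : Eff c (true :: l) l' T) :
    Eff (.ite .m isT c d) (true :: l) l' (1 + T) :=
  let ⟨_, ht, e⟩ := h
  ⟨_, Nat.add_le_add_left ht 1, .ite_true rfl e⟩

theorem Eff.ite_false {c d : Cmd} {l l' : List Bool} {T : ℕ} (h : Eff d (false :: l) l' T) :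
    Eff (.ite .m isT c d) (false :: l) l' (1 + T) :=
  let ⟨_, ht, e⟩ := h
  ⟨_, Nat.add_le_add_left ht 1, .ite_false rfl e⟩

theorem Eff.loop_done {c : Cmd} {l : List Bool} :
    Eff (.loop .m isT c) (false :: l) (false :: l) 1 :=
  ⟨_, le_rfl, .loop_done rfl⟩

theorem Eff.loop_step {c : Cmd} {l l' l'' : List Bool} {T T' : ℕ} (h : Eff c (true :: l) l' T)
    (h' : Eff (.loop .m isT c) l' l'' T') : Eff (.loop .m isT c) (true :: l) l'' (1 + T + T') :=
  let ⟨_, ht, e⟩ := h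
  let ⟨_, ht', e'⟩ := h'
  ⟨_, add_le_add (Nat.add_le_add_left ht 1) ht', .loop_step rfl e e'⟩

theorem Eff.drop (t : SExp) (l : List Bool) : Eff dropCmd (t.ser ++ l) l (4 * t.size + 2) :=
  ⟨_, le_rfl, Exec.cast (.seq (.push rfl) (by simpa using exec_scan_drop t (.loop_done rfl)))
    (by ring)⟩

theorem Eff.swap (s t : SExp) (l : List Bool) :
    Eff swapCmd (s.ser ++ (t.ser ++ l)) (t.ser ++ (s.ser ++ l)) (6 * s.size + 6 * t.size + 6) := by
  have h := exec_back_x_m s.ser.reverse l t.ser.reverse []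
  have h' := exec_back_y_m t.ser.reverse (s.ser ++ l) [] []
  have h₁ := exec_move_x s (t.ser ++ l) [] []
  have h₂ := exec_move_y t l s.ser.reverse []
  simp only [List.append_nil, List.reverse_reverse] at h h' h₁ h₂
  exact ⟨_, le_rfl, Exec.cast (.seq (.seq h₁ h₂) (.seq h h')) (by simp [size]; ring)⟩

theorem exec_copy (l m y : List Bool) :
    Exec (.loop .x Option.isSome (.seq (.ite .x isT (.push .y true) (.push .y false))
      (.move .x .m))) (regs m l y []) (regs (l.reverse ++ m) [] (l.reverse ++ y) [])
      (4 * l.length + 1) := by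
  induction l generalizing m y with
  | nil => exact .loop_done rfl
  | cons b l ih =>
    cases b with
    | true =>
      refine Exec.cast (.loop_step rfl (.seq (.ite_true rfl (.push rfl)) (.move rfl rfl))
        (t₂ := 4 * l.length + 1) ?_) (by simp; ring)
      simpa using ih (true :: m) (true :: y)
    | false =>
      refine Exec.cast (.loop_step rfl (.seq (.ite_false rfl (.push rfl)) (.move rfl rfl))
        (t₂ := 4 * l.length + 1) ?_) (by simp; ring)
      simpa using ih (false :: m) (false :: y)

theorem Eff.dup (t : SExp) (l : List Bool) :
    Eff dupCmd (t.ser ++ l) (t.ser ++ (t.ser ++ l)) (12 * t.size + 5) := by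
  have h := exec_back_y_x t.ser (t.ser ++ l) [] []
  have h' := exec_back_x_m t.ser.reverse (t.ser ++ l) [] []
  have h₁ := exec_move_x t l [] []
  have h₂ := exec_copy t.ser.reverse l []
  simp only [List.append_nil, List.reverse_reverse] at h h' h₁ h₂
  exact ⟨_, le_rfl, Exec.cast (.seq (.seq h₁ h₂) (.seq h h')) (by simp [size]; ring)⟩

end CPTWSC

namespace CPTWSC

open SExp

/-! ## Functions computable in polynomial time -/

/-- Data types whose elements are represented by trees. -/
class Enc (α : Type) where
  enc : α → SExp

open Enc (enc)

/-- The size of the representation. -/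
def esize {α : Type} [Enc α] (a : α) : ℕ := (enc a).size

instance : Enc SExp := ⟨id⟩

instance {α β : Type} [Enc α] [Enc β] : Enc (α × β) := ⟨fun p => .cons (enc p.1) (enc p.2)⟩

theorem eval_mono (p : Polynomial ℕ) {m n : ℕ} (h : m ≤ n) : p.eval m ≤ p.eval n := by
  simp only [Polynomial.eval_eq_sum, Polynomial.sum]
  gcongr

/-- A function is computable in polynomial time if some program replaces (the representation of) an
argument on top of the main stack by the value of the function, in polynomial time. -/
@[fun_prop]
def PT {α β : Type} [Enc α] [Enc β] (f : α → β) : Prop :=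
  ∃ (c : Cmd) (p : Polynomial ℕ), ∀ a, esize (f a) ≤ p.eval (esize a) ∧
    ∀ l, Eff c ((enc a).ser ++ l) ((enc (f a)).ser ++ l) (p.eval (esize a))

/-- Polynomially bounded functions. -/
def PB {α : Type} [Enc α] (f : α → ℕ) : Prop :=
  ∃ p : Polynomial ℕ, ∀ a, f a ≤ p.eval (esize a)

section

variable {α β γ δ : Type} [Enc α] [Enc β] [Enc γ] [Enc δ]

theorem PT.mk' {f : α → β} (c : Cmd) (p q : Polynomial ℕ) (h : ∀ a, esize (f a) ≤ p.eval (esize a))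
    (h' : ∀ a l, Eff c ((enc a).ser ++ l) ((enc (f a)).ser ++ l) (q.eval (esize a))) : PT f :=
  ⟨c, p + q, fun a => ⟨(h a).trans (by simp), fun l => (h' a l).mono (by simp)⟩⟩

theorem PT.of_enc {f : SExp → SExp} (hf : PT f) {g : α → β} (h : ∀ a, enc (g a) = f (enc a)) :
    PT g := by
  obtain ⟨c, p, hp⟩ := hf
  refine ⟨c, p, fun a => ?_⟩
  have := hp (enc a)
  simp only [esize, h]
  exact this

theorem PT.recode {f : α → β} (hf : PT f) {g : α → γ} (h : ∀ a, enc (g a) = enc (f a)) : PT g := by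
  obtain ⟨c, p, hp⟩ := hf
  refine ⟨c, p, fun a => ?_⟩
  have := hp a
  simp only [esize, h] at *
  exact this

theorem PT.of_eq {f g : α → β} (hf : PT f) (h : ∀ a, f a = g a) : PT g := funext h ▸ hf

theorem PB.of_le {f g : α → ℕ} (hg : PB g) (h : ∀ a, f a ≤ g a) : PB f :=
  let ⟨p, hp⟩ := hg
  ⟨p, fun a => (h a).trans (hp a)⟩

theorem PB.const (n : ℕ) : PB fun _ : α => n := ⟨.C n, by simp⟩

theorem PB.add {f g : α → ℕ} (hf : PB f) (hg : PB g) : PB fun a => f a + g a :=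
  let ⟨p, hp⟩ := hf
  let ⟨q, hq⟩ := hg
  ⟨p + q, fun a => by simpa using add_le_add (hp a) (hq a)⟩

theorem PB.mul {f g : α → ℕ} (hf : PB f) (hg : PB g) : PB fun a => f a * g a :=
  let ⟨p, hp⟩ := hf
  let ⟨q, hq⟩ := hg
  ⟨p * q, fun a => by simpa using Nat.mul_le_mul (hp a) (hq a)⟩

theorem PB.eval {f : α → ℕ} (hf : PB f) (q : Polynomial ℕ) : PB fun a => q.eval (f a) :=
  let ⟨p, hp⟩ := hf
  ⟨q.comp p, fun a => by simpa using eval_mono q (hp a)⟩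

theorem PT.pb {f : α → β} (hf : PT f) : PB fun a => esize (f a) :=
  let ⟨_, p, hp⟩ := hf
  ⟨p, fun a => (hp a).1⟩

@[fun_prop]
theorem PT.id : PT fun a : α => a :=
  .mk' (.seq (.push .m true) (.pop .m)) .X (.C 2) (by simp) fun a l => by
    simpa using (Eff.push _ _).seq (Eff.pop _ _)

@[fun_prop]
theorem PT.comp {f : β → γ} {g : α → β} (hf : PT f) (hg : PT g) : PT fun a => f (g a) := by
  obtain ⟨c, p, hp⟩ := hf
  obtain ⟨d, q, hq⟩ := hg
  refine .mk' (.seq d c) (p.comp q) (q + p.comp q) (fun a => ?_) fun a l => ?_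
  · simpa using (hp (g a)).1.trans (eval_mono p (hq a).1)
  · simpa using ((hq a).2 l).seq (((hp (g a)).2 l).mono (eval_mono p (hq a).1))

/-- A program that pushes a tree onto the main stack. -/
def constCmd : SExp → Cmd
  | .nil => .push .m false
  | .cons a b => .seq (constCmd b) (.seq (constCmd a) (.push .m true))

theorem Eff.const (t : SExp) (l : List Bool) : Eff (constCmd t) l (t.ser ++ l) t.size := by
  induction t generalizing l with
  | nil => exact .push _ _
  | cons a b iha ihb =>
    have h := (ihb l).seq ((iha _).seq (Eff.push true (a.ser ++ (b.ser ++ l))))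
    simpa [ser, constCmd] using h.mono (T' := (cons a b).size) (by simp; omega)

@[fun_prop]
theorem PT.const (b : β) : PT fun _ : α => b := by
  refine .mk' (.seq dropCmd (constCmd (enc b))) (.C (esize b)) (.C 4 * .X + .C (2 + esize b))
    (by simp) fun a l => ?_
  exact ((Eff.drop _ _).seq (Eff.const _ _)).mono (by simp [esize]; omega)

@[fun_prop]
theorem PT.pair {f : α → β} {g : α → γ} (hf : PT f) (hg : PT g) : PT fun a => (f a, g a) := by
  obtain ⟨c, p, hp⟩ := hf
  obtain ⟨d, q, hq⟩ := hg
  refine .mk' (.seq (.seq (.seq dupCmd d) swapCmd) (.seq c (.push .m true)))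
    (p + q + 1) (.C 18 * .X + .C 12 + .C 7 * q + p) (fun a => ?_) fun a l => ?_
  · have := (hp a).1
    have := (hq a).1
    simp [esize, enc] at *
    omega
  · have := (hq a).1
    have h := ((((Eff.dup _ _).seq ((hq a).2 _)).seq (Eff.swap (enc (g a)) (enc a) l)).seq
      (((hp a).2 _).seq (Eff.push true _))).mono
      (T' := 18 * esize a + 12 + 7 * q.eval (esize a) + p.eval (esize a))
      (by simp [esize] at *; omega)
    simpa [enc, ser] using h

/-- The first component of a tree. -/
def SExp.car : SExp → SExp
  | .nil => .nil
  | .cons a _ => a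

/-- The second component of a tree. -/
def SExp.cdr : SExp → SExp
  | .nil => .nil
  | .cons _ b => b

theorem PT.car : PT SExp.car := by
  refine .mk' (.ite .m isT (.seq (.pop .m) (.seq swapCmd dropCmd)) (.seq (.pop .m) (.push .m false)))
    (.X + 1) (.C 10 * .X + .C 10) (fun a => ?_) fun a l => ?_
  · cases a <;> simp [esize, enc, SExp.car]; omega
  · cases a with
    | nil =>
      exact (Eff.ite_false ((Eff.pop _ _).seq (Eff.push _ _))).mono (by simp)
    | cons a b =>
      simp only [enc, SExp.car, ser, esize, _root_.id, List.cons_append, List.append_assoc]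
      exact (Eff.ite_true ((Eff.pop _ _).seq ((Eff.swap _ _ _).seq (Eff.drop _ _)))).mono
        (by simp; omega)

theorem PT.cdr : PT SExp.cdr := by
  refine .mk' (.ite .m isT (.seq (.pop .m) dropCmd) (.seq (.pop .m) (.push .m false)))
    (.X + 1) (.C 10 * .X + .C 10) (fun a => ?_) fun a l => ?_
  · cases a <;> simp [esize, enc, SExp.cdr]; omega
  · cases a with
    | nil =>
      exact (Eff.ite_false ((Eff.pop _ _).seq (Eff.push _ _))).mono (by simp)
    | cons a b =>
      simp only [enc, SExp.cdr, ser, esize, _root_.id, List.cons_append, List.append_assoc]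
      exact (Eff.ite_true ((Eff.pop _ _).seq (Eff.drop _ _))).mono (by simp; omega)

instance : Enc Bool := ⟨fun b => if b then .cons .nil .nil else .nil⟩

/-- The test for a nonempty tree. -/
def SExp.isCons : SExp → Bool
  | .nil => false
  | .cons _ _ => true

theorem PT.isCons : PT SExp.isCons := by
  refine .mk' (.ite .m isT (.seq dropCmd (constCmd (enc true))) (.seq (.pop .m) (.push .m false)))
    (.C 3) (.C 4 * .X + .C 10) (fun a => ?_) fun a l => ?_
  · cases a <;> simp [esize, enc, SExp.isCons]
  · cases a with
    | nil =>
      exact (Eff.ite_false ((Eff.pop _ _).seq (Eff.push _ _))).mono (by simp)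
    | cons a b =>
      refine (Eff.ite_true ((Eff.drop (.cons a b) _).seq (Eff.const (enc true) _))).mono ?_
      simp [esize, enc]; omega

instance (p : α → Prop) : Enc {a // p a} := ⟨fun a => enc a.1⟩

/-- Definition by cases, where each case has to be defined on its own domain only. -/
theorem PT.dcond {b : α → Bool} {f : {a // b a = true} → β} {g : {a // b a = false} → β}
    (hb : PT b) (hf : PT f) (hg : PT g) {h : α → β} (h₁ : ∀ a hba, h a = f ⟨a, hba⟩)
    (h₂ : ∀ a hba, h a = g ⟨a, hba⟩) : PT h := by
  obtain ⟨e, r, hr⟩ := hb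
  obtain ⟨c, p, hp⟩ := hf
  obtain ⟨d, q, hq⟩ := hg
  refine .mk' (.seq (.seq dupCmd e) (.ite .m isT (.seq dropCmd c) (.seq (.pop .m) d)))
    (p + q) (.C 12 * .X + .C 20 + r + p + q) (fun a => ?_) fun a l => ?_
  · cases hba : b a with
    | true => exact (h₁ a hba ▸ (hp ⟨a, hba⟩).1).trans (by simp [esize, enc])
    | false => exact (h₂ a hba ▸ (hq ⟨a, hba⟩).1).trans (by simp [esize, enc])
  · cases hba : b a with
    | true =>
      have h1 := (hr a).2 ((enc a).ser ++ l)
      rw [hba] at h1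
      rw [h₁ a hba]
      refine (((Eff.dup _ _).seq h1).seq
        (Eff.ite_true ((Eff.drop (.cons .nil .nil) _).seq ((hp ⟨a, hba⟩).2 l)))).mono ?_
      simp [esize, enc]; omega
    | false =>
      have h1 := (hr a).2 ((enc a).ser ++ l)
      rw [hba] at h1
      rw [h₂ a hba]
      refine (((Eff.dup _ _).seq h1).seq
        (Eff.ite_false ((Eff.pop _ _).seq ((hq ⟨a, hba⟩).2 l)))).mono ?_
      simp [esize, enc]; omega

theorem PT.val {p : α → Prop} : PT fun a : {a // p a} => a.1 := PT.of_enc .id fun _ => rfl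

@[fun_prop]
theorem PT.cond {b : α → Bool} {f g : α → β} (hb : PT b) (hf : PT f) (hg : PT g) :
    PT fun a => cond (b a) (f a) (g a) :=
  .dcond hb (hf.comp .val) (hg.comp .val) (fun a h => by simp [h]) (fun a h => by simp [h])

theorem PT.iter_spine {f : β → β} (hf : PT f) {n : α → SExp} {s : α → β} (hn : PT n) (hs : PT s)
    {B : α → ℕ} (hB : PB B) (h : ∀ a, ∀ i ≤ (n a).spine, esize (f^[i] (s a)) ≤ B a) :
    PT fun a => f^[(n a).spine] (s a) := by
  obtain ⟨c, p, hp⟩ := hf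
  have key : ∀ (t : SExp) (b : β) (B : ℕ), (∀ i ≤ t.spine, esize (f^[i] b) ≤ B) → ∀ l,
      Eff (.loop .m isT (.seq (.seq (.seq (.pop .m) dropCmd) swapCmd) (.seq c swapCmd)))
        (t.ser ++ ((enc b).ser ++ l)) (false :: ((enc (f^[t.spine] b)).ser ++ l))
        (t.size * (20 * (B + t.size) + p.eval B + 20)) := by
    intro t
    induction t with
    | nil => exact fun b B h l => Eff.loop_done.mono (by simp)
    | cons a t _ ih =>
      intro b B h l
      have h0 := h 0 (by simp)
      have h1 := h 1 (by simp [spine])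
      simp only [Function.iterate_zero, Function.iterate_one, _root_.id] at h0 h1
      refine .mono (.loop_step (T := (1 + (4 * a.size + 2) + (6 * t.size + 6 * B + 6)) +
          (p.eval B + (6 * B + 6 * t.size + 6))) ?_ (ih (f b) B (fun i hi => ?_) l)) ?_
      · simp only [List.append_eq, List.append_assoc]
        refine .seq (.seq (.seq (.pop _ _) (.drop _ _)) (.mono (.swap _ _ _) ?_))
          (.seq (((hp b).2 _).mono (eval_mono p h0)) (.mono (.swap _ _ _) ?_))
        · change 6 * t.size + 6 * esize b + 6 ≤ _
          omega
        · change 6 * esize (f b) + 6 * t.size + 6 ≤ _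
          omega
      · rw [← Function.iterate_succ_apply]
        exact h (i + 1) (by simp [spine, hi])
      · have := a.size_pos
        simp only [size_cons]
        nlinarith [Nat.zero_le (p.eval B * a.size), Nat.zero_le (B * a.size),
          Nat.zero_le (t.size * a.size), Nat.zero_le (t.size * t.size)]
  have hns : PT fun a => (n a, s a) := hn.pair hs
  obtain ⟨d, q, hq⟩ := hns
  obtain ⟨r, hr⟩ := hB
  have hsz : ∀ a, (n a).size ≤ q.eval (esize a) := fun a =>
    le_trans (by simp [esize, enc]; omega) (hq a).1
  refine .mk' (.seq (.seq d (.pop .m)) (.seq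
    (.loop .m isT (.seq (.seq (.seq (.pop .m) dropCmd) swapCmd) (.seq c swapCmd))) (.pop .m)))
    r (q + 2 + q * (20 * (r + q) + p.comp r + 20)) (fun a => ?_) fun a l => ?_
  · exact (h a _ le_rfl).trans (hr a)
  · have h1 := (hq a).2 l
    simp only [enc, ser, _root_.id, List.cons_append, List.append_assoc] at h1
    refine ((h1.seq (.pop _ _)).seq
      ((key (n a) (s a) (B a) (h a) l).seq (.pop _ _))).mono ?_
    have h2 := Nat.mul_le_mul (hsz a) (show 20 * (B a + (n a).size) + p.eval (B a) + 20 ≤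
      20 * (r.eval (esize a) + q.eval (esize a)) +
        p.eval (r.eval (esize a)) + 20 by
      have := eval_mono p (hr a)
      have := hr a
      have := hsz a
      omega)
    simp
    omega

end

end CPTWSC

namespace CPTWSC

open SExp

open Enc (enc)

/-- Unary numbers as trees. -/
def encNat : ℕ → SExp
  | 0 => .nil
  | n + 1 => .cons .nil (encNat n)

instance : Enc ℕ := ⟨encNat⟩

/-- Lists as trees. -/
def encList {α : Type} [Enc α] : List α → SExp
  | [] => .nil
  | a :: l => .cons (enc a) (encList l)

instance {α : Type} [Enc α] : Enc (List α) := ⟨encList⟩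

/-- A number for a symbol. -/
def Sym.toNat : Sym → ℕ
  | .tick => 0
  | .num => 1
  | .row => 2
  | .block => 3

instance : Enc Sym := ⟨fun s => enc s.toNat⟩

/-! ## From programs to machines with input and output -/

section Machine

variable {Ω : Type}

open TM2.Stmt

/-- Pushes a number onto the main stack. -/
def pushNat {Λ : Type} : ℕ → TM2.Stmt (Alph Ω) Λ Mem → TM2.Stmt (Alph Ω) Λ Mem
  | 0, q => push (.reg .m) (fun _ => false) q
  | j + 1, q => pushNat j (push (.reg .m) (fun _ => false) (push (.reg .m) (fun _ => true) q))

theorem stepAux_pushNat {Λ : Type} (j : ℕ) (q : TM2.Stmt (Alph Ω) Λ Mem) (v : Mem)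
    (m x y c : List Bool) (i : List Sym) (o : List Ω) :
    TM2.stepAux (pushNat j q) v (stks (regs m x y c) i o) =
      TM2.stepAux q v (stks (regs ((enc j).ser ++ m) x y c) i o) := by
  induction j generalizing q with
  | zero => simp [pushNat, enc, encNat, ser]
  | succ j ih => rw [pushNat, ih]; simp [enc, encNat, ser]

/-- Reads a symbol. -/
def readStmt {Λ : Type} (loop done : Λ) : TM2.Stmt (Alph Ω) Λ Mem :=
  pop .inp (fun v s => (v.1, s))
    (branch (fun v => v.2.isNone) (goto fun _ => done)
      (branch (fun v => v.2 == some .tick) (pushNat 0 (push (.reg .m) (fun _ => true) (goto fun _ => loop)))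
        (branch (fun v => v.2 == some .num) (pushNat 1 (push (.reg .m) (fun _ => true) (goto fun _ => loop)))
          (branch (fun v => v.2 == some .row) (pushNat 2 (push (.reg .m) (fun _ => true) (goto fun _ => loop)))
            (pushNat 3 (push (.reg .m) (fun _ => true) (goto fun _ => loop)))))))

/-- Moves a number from the main stack to the output. -/
def writeNat {Λ : Type} (dec : ℕ → Ω) (loop : Λ) : ℕ → ℕ → TM2.Stmt (Alph Ω) Λ Mem
  | 0, j => pop (.reg .m) (fun v _ => v) (push .out (fun _ => dec j) (goto fun _ => loop))
  | d + 1, j => pop (.reg .m) (fun v o => (o, v.2)) (branch (fun v => isT v.1)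
      (pop (.reg .m) (fun v _ => v) (writeNat dec loop d (j + 1)))
      (push .out (fun _ => dec j) (goto fun _ => loop)))

theorem stepAux_writeNat {Λ : Type} (dec : ℕ → Ω) (loop : Λ) (d j k : ℕ) (h : k ≤ d) (v : Mem)
    (m x y c : List Bool) (i : List Sym) (o : List Ω) :
    ∃ v', TM2.stepAux (writeNat dec loop d j) v (stks (regs ((enc k).ser ++ m) x y c) i o) =
      ⟨some loop, v', stks (regs m x y c) i (dec (j + k) :: o)⟩ := by
  induction d generalizing j k v with
  | zero =>
    obtain rfl : k = 0 := by omega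
    exact ⟨v, by simp [writeNat, enc, encNat, ser]⟩
  | succ d ih =>
    cases k with
    | zero => exact ⟨(some false, v.2), by simp [writeNat, enc, encNat, ser, isT]⟩
    | succ k =>
      obtain ⟨v', h'⟩ := ih (j + 1) k (by omega) (some true, v.2)
      refine ⟨v', ?_⟩
      rw [show j + (k + 1) = j + 1 + k by ring, ← h']
      simp [writeNat, enc, encNat, ser, isT]

/-- Writes a symbol. -/
def writeStmt {Λ : Type} (dec : ℕ → Ω) (loop : Λ) : TM2.Stmt (Alph Ω) Λ Mem :=
  pop (.reg .m) (fun v o => (o, v.2)) (branch (fun v => isT v.1)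
    (writeNat dec loop 3 0) (load (fun _ => (none, none)) halt))

/-- The code of the machine for a program. -/
def machineCode (dec : ℕ → Ω) (c : Cmd) : Lab c ⊕ Fin 3 → TM2.Stmt (Alph Ω) (Lab c ⊕ Fin 3) Mem
  | .inl l => code c .inl (.inr 2) l
  | .inr 0 => push (.reg .m) (fun _ => false) (goto fun _ => .inr 1)
  | .inr 1 => readStmt (.inr 1) (.inl (Lab.entry c))
  | .inr 2 => writeStmt dec (.inr 2)

/-- The machine for a program. -/
def machine (dec : ℕ → Ω) (c : Cmd) : FinTM2 where
  K := Stk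
  k₀ := .inp
  k₁ := .out
  Γ := Alph Ω
  Λ := Lab c ⊕ Fin 3
  main := .inr 0
  σ := Mem
  initialState := (none, none)
  Γk₀Fin := inferInstanceAs (Fintype Sym)
  m := machineCode dec c

variable (dec : ℕ → Ω) (c : Cmd)

theorem machine_read (w w' : List Sym) (v : Mem) :
    ∃ v', StepsTo (TM2.step (machineCode dec c))
      ⟨some (.inr 1), v, stks (regs (enc w').ser [] [] []) w []⟩
      ⟨some (.inl (Lab.entry c)), v', stks (regs (enc (w.reverse ++ w')).ser [] [] []) [] []⟩
      (w.length + 1) := by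
  induction w generalizing w' v with
  | nil =>
    refine ⟨(v.1, none), .one ?_⟩
    simp [machineCode, readStmt]
  | cons s w ih =>
    obtain ⟨v', h⟩ := ih (s :: w') (v.1, some s)
    refine ⟨v', ?_⟩
    have h1 : StepsTo (TM2.step (machineCode dec c))
      ⟨some (.inr 1), v, stks (regs (enc w').ser [] [] []) (s :: w) []⟩
      ⟨some (.inr 1), (v.1, some s), stks (regs (enc (s :: w')).ser [] [] []) w []⟩ 1 := by
      refine .one ?_
      cases s <;> simp [machineCode, readStmt, stepAux_pushNat] <;> rfl
    have := h1.trans h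
    simpa [add_comm, add_assoc] using this

theorem machine_write [Enc Ω] (hdec : ∀ w : Ω, ∃ j ≤ 3, dec j = w ∧ enc w = enc j)
    (w o : List Ω) (v : Mem) :
    StepsTo (TM2.step (machineCode dec c))
      ⟨some (.inr 2), v, stks (regs (enc w).ser [] [] []) [] o⟩
      ⟨none, (none, none), stks (regs [] [] [] []) [] (w.reverse ++ o)⟩
      (w.length + 1) := by
  induction w generalizing o v with
  | nil => exact .one (by simp [machineCode, writeStmt, isT, enc, encList, ser])
  | cons s w ih =>
    obtain ⟨j, hj, rfl, e⟩ := hdec s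
    obtain ⟨v', h⟩ := stepAux_writeNat (Λ := Lab c ⊕ Fin 3) dec (.inr 2) 3 0 j hj (some true, v.2)
      (enc w).ser [] [] [] [] o
    have h1 : StepsTo (TM2.step (machineCode dec c))
      ⟨some (.inr 2), v, stks (regs (enc (dec j :: w)).ser [] [] []) [] o⟩
      ⟨some (.inr 2), v', stks (regs (enc w).ser [] [] []) [] (dec j :: o)⟩ 1 := by
      refine .one ?_
      have e' : (enc (dec j :: w)).ser = true :: ((enc j).ser ++ (enc w).ser) := by
        rw [← e]; rfl
      rw [e']
      simp only [zero_add] at h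
      simpa [machineCode, writeStmt, isT] using h
    have := h1.trans (ih (dec j :: o) v')
    simpa [add_comm, add_assoc] using this

end Machine

theorem esize_sym_list_le (w : List Sym) : esize w ≤ 8 * w.length + 1 := by
  induction w with
  | nil => simp [esize, enc, encList]
  | cons s w ih =>
    have : esize s ≤ 7 := by cases s <;> simp [esize, enc, Sym.toNat, encNat]
    simp only [esize, enc, encList, List.length_cons, size_cons] at *
    omega

theorem length_le_esize {α : Type} [Enc α] (l : List α) : l.length ≤ esize l := by
  induction l with
  | nil => simp
  | cons a l ih => simp only [esize, enc, encList, List.length_cons, size_cons] at *; omega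

theorem PT.tm2 {Ω : Type} [Enc Ω] {dec : ℕ → Ω}
    (hdec : ∀ w : Ω, ∃ j ≤ 3, dec j = w ∧ enc w = enc j) {F : List Sym → List Ω} (hF : PT F)
    {α β : Type} {ea : α → List Sym} {eb : β → List Ω} {f : α → β}
    (h : ∀ a, F (ea a).reverse = (eb (f a)).reverse) :
    Nonempty (TM2ComputableInPolyTime ea eb f) := by
  obtain ⟨c, p, hp⟩ := hF
  refine ⟨⟨⟨machine dec c, Equiv.refl _, Equiv.refl _⟩,
    .X + .C 3 + .C 2 * p.comp (.C 8 * .X + .C 1), fun a => Classical.choice ?_⟩⟩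
  have h₀ : StepsTo (TM2.step (machineCode dec c))
      ⟨some (.inr 0), (none, none), stks (regs [] [] [] []) (ea a) []⟩
      ⟨some (.inr 1), (none, none), stks (regs (enc ([] : List Sym)).ser [] [] []) (ea a) []⟩ 1 :=
    .one (by simp [machineCode]; rfl)
  obtain ⟨v₁, h₁⟩ := machine_read dec c (ea a) [] (none, none)
  obtain ⟨hs, hx⟩ := hp (ea a).reverse
  obtain ⟨t, ht, hx⟩ := hx []
  obtain ⟨v₂, h₂⟩ := hx.stepsTo (M := machineCode dec c) (e := .inl) (exit := .inr 2)
    (fun _ => rfl) v₁ [] []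
  have h₃ := machine_write dec c hdec (F (ea a).reverse) [] v₂
  rw [List.append_nil] at h₁
  simp only [List.append_nil] at h₂
  have H := ((h₀.trans h₁).trans h₂).trans h₃
  rw [h, List.reverse_reverse, List.append_nil] at H
  have hi : initList (machine dec c) (List.map (Equiv.refl Sym).invFun (ea a)) =
      ⟨some (.inr 0), (none, none), stks (regs [] [] [] []) (ea a) []⟩ := by
    simp only [initList]
    congr 1
    funext k
    rcases k with r | _ | _
    · cases r <;> rfl
    · exact List.map_id _
    · rfl
  have ho : haltList (machine dec c) (List.map (Equiv.refl Ω).invFun (eb (f a))) =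
      ⟨none, (none, none), stks (regs [] [] [] []) [] (eb (f a))⟩ := by
    simp only [haltList]
    congr 1
    funext k
    rcases k with r | _ | _
    · cases r <;> rfl
    · rfl
    · exact List.map_id _
  refine ⟨⟨⟨1 + ((ea a).length + 1) + t + ((eb (f a)).reverse.length + 1), ?_⟩, ?_⟩⟩
  · refine (congrArg (fun x => (flip bind (TM2.step (machineCode dec c)))^[_] (some x)) hi).trans
      (Eq.trans (show _ = _ from H) (congrArg some ho.symm))
  · have h4 := length_le_esize (F (ea a).reverse)
    have h5 := eval_mono p (esize_sym_list_le (ea a).reverse)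
    rw [h] at h4 hs
    simp at *
    omega

theorem sym_dec (w : Sym) : ∃ j ≤ 3, (fun j => if j = 0 then Sym.tick else if j = 1 then .num else
    if j = 2 then .row else .block) j = w ∧ enc w = enc j :=
  ⟨w.toNat, by cases w <;> simp [Sym.toNat], by cases w <;> simp [Sym.toNat], rfl⟩

theorem bool_dec (w : Bool) : ∃ j ≤ 3, (fun j : ℕ => j == 1) j = w ∧ enc w = enc j :=
  ⟨w.toNat, by cases w <;> simp, by cases w <;> simp, by cases w <;> rfl⟩

end CPTWSC

namespace CPTWSC

open SExp

open Enc (enc)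

/-! ## Basic functions computable in polynomial time -/

section

variable {α β γ ε σ : Type} [Enc α] [Enc β] [Enc γ] [Enc ε] [Enc σ]

theorem PT.enc {f : ε → α} (hf : PT f) : PT fun e => enc (f e) :=
  .comp (f := Enc.enc) (.of_enc (f := fun x => x) .id fun _ => rfl) hf

theorem PT.sexp_cons {f g : ε → SExp} (hf : PT f) (hg : PT g) : PT fun e => SExp.cons (f e) (g e) :=
  .recode (hf.pair hg) fun _ => rfl

@[fun_prop]
theorem PT.fst {f : ε → α × β} (hf : PT f) : PT fun e => (f e).1 :=
  .comp (f := Prod.fst) (.of_enc .car fun _ => rfl) hf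

@[fun_prop]
theorem PT.snd {f : ε → α × β} (hf : PT f) : PT fun e => (f e).2 :=
  .comp (f := Prod.snd) (.of_enc .cdr fun _ => rfl) hf

@[fun_prop]
theorem PT.list_cons {f : ε → α} {g : ε → List α} (hf : PT f) (hg : PT g) :
    PT fun e => f e :: g e :=
  .comp (f := fun p : α × List α => p.1 :: p.2) (.of_enc (f := fun x => x) .id fun _ => rfl)
    (hf.pair hg)

@[fun_prop]
theorem PT.list_tail {f : ε → List α} (hf : PT f) : PT fun e => (f e).tail :=
  .comp (f := List.tail) (.of_enc .cdr fun l => by cases l <;> rfl) hf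

instance : Enc (Option α) := ⟨fun o => o.elim .nil fun a => .cons .nil (Enc.enc a)⟩

@[fun_prop]
theorem PT.some {f : ε → α} (hf : PT f) : PT fun e => some (f e) :=
  .recode (.pair (.const SExp.nil) hf) fun _ => rfl

@[fun_prop]
theorem PT.isSome {f : ε → Option α} (hf : PT f) : PT fun e => (f e).isSome :=
  .comp (.of_eq (PT.isCons.comp (PT.enc .id)) fun l => by cases l <;> rfl) hf

@[fun_prop]
theorem PT.elim {o : ε → Option α} {f : ε → β} {g : ε → α → β} (ho : PT o) (hf : PT f)
    (hg : PT fun p : ε × α => g p.1 p.2) : PT fun e => (o e).elim (f e) (g e) := by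
  have h1 : PT fun e : {e // (o e).isSome = true} => (o e.1).get e.2 := by
    refine .recode (PT.cdr.comp (PT.enc (ho.comp .val))) fun ⟨e, he⟩ => ?_
    obtain ⟨a, ha⟩ := Option.isSome_iff_exists.1 he
    simp [ha, Enc.enc, SExp.cdr]
  refine .dcond ho.isSome (hg.comp (PT.val.pair h1)) (hf.comp .val) (fun e h => ?_) fun e h => ?_
  · obtain ⟨a, ha⟩ := Option.isSome_iff_exists.1 h
    simp [ha]
  · simp at h; simp [h]

@[fun_prop]
theorem PT.list_head? {f : ε → List α} (hf : PT f) : PT fun e => (f e).head? :=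
  .comp (f := List.head?) (.of_enc (f := fun t => bif t.isCons then SExp.cons SExp.nil t.car
    else SExp.nil) (.cond .isCons (.sexp_cons (.const _) .car) (.const _))
    fun l => by cases l <;> rfl) hf

@[fun_prop]
theorem PT.headD {f : ε → List α} {g : ε → α} (hf : PT f) (hg : PT g) :
    PT fun e => (f e).headD (g e) := by
  have : PT fun e => (f e).head?.elim (g e) (fun a => a) := by fun_prop
  exact this.of_eq fun e => by cases f e <;> rfl

@[fun_prop]
theorem PT.getD {f : ε → Option α} {g : ε → α} (hf : PT f) (hg : PT g) :
    PT fun e => (f e).getD (g e) := by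
  have : PT fun e => (f e).elim (g e) (fun a => a) := by fun_prop
  exact this.of_eq fun e => by cases f e <;> rfl

@[fun_prop]
theorem PT.option_map {o : ε → Option α} {g : ε → α → β} (ho : PT o)
    (hg : PT fun p : ε × α => g p.1 p.2) : PT fun e => (o e).map (g e) := by
  have : PT fun e => (o e).elim none (fun a => Option.some (g e a)) := by fun_prop
  exact this.of_eq fun e => by cases o e <;> rfl

@[fun_prop]
theorem PT.option_bind {o : ε → Option α} {g : ε → α → Option β} (ho : PT o)
    (hg : PT fun p : ε × α => g p.1 p.2) : PT fun e => (o e).bind (g e) := by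
  have : PT fun e => (o e).elim none (fun a => g e a) := by fun_prop
  exact this.of_eq fun e => by cases o e <;> rfl

@[fun_prop]
theorem PT.not {f : ε → Bool} (hf : PT f) : PT fun e => !(f e) := by
  have : PT fun e => bif f e then false else true := by fun_prop
  exact this.of_eq fun e => by cases f e <;> rfl

@[fun_prop]
theorem PT.and {f g : ε → Bool} (hf : PT f) (hg : PT g) : PT fun e => f e && g e := by
  have : PT fun e => bif f e then g e else false := by fun_prop
  exact this.of_eq fun e => by cases f e <;> rfl

@[fun_prop]
theorem PT.or {f g : ε → Bool} (hf : PT f) (hg : PT g) : PT fun e => f e || g e := by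
  have : PT fun e => bif f e then true else g e := by fun_prop
  exact this.of_eq fun e => by cases f e <;> rfl

/-! ### Sizes -/

theorem esize_pair (a : α) (b : β) : esize (a, b) = esize a + esize b + 1 := by
  simp [esize, enc]

@[simp] theorem esize_nil : esize ([] : List α) = 1 := rfl

@[simp] theorem esize_cons (a : α) (l : List α) : esize (a :: l) = esize a + esize l + 1 := by
  simp [esize, enc, encList]

theorem esize_append (l l' : List α) : esize (l ++ l') + 1 = esize l + esize l' := by
  induction l with
  | nil => simp [add_comm]
  | cons a l ih => simp; omega

theorem esize_reverse (l : List α) : esize l.reverse = esize l := by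
  induction l with
  | nil => rfl
  | cons a l ih =>
    have := esize_append l.reverse [a]
    simp at *
    omega

theorem esize_le_of_sublist {l l' : List α} (h : l.Sublist l') : esize l ≤ esize l' := by
  induction h with
  | slnil => simp
  | cons a _ ih => simp; omega
  | cons_cons a _ ih => simp; omega

theorem esize_le_of_mem {l : List α} {a : α} (h : a ∈ l) : esize a ≤ esize l := by
  have := esize_le_of_sublist (List.singleton_sublist.2 h)
  simp at this
  omega

theorem esize_list_le {l : List α} {B : ℕ} (h : ∀ a ∈ l, esize a ≤ B) :
    esize l ≤ l.length * (B + 1) + 1 := by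
  induction l with
  | nil => simp
  | cons a l ih =>
    have h1 := h a (by simp)
    have h2 := ih fun b hb => h b (by simp [hb])
    simp only [esize_cons, List.length_cons]
    linarith

@[simp] theorem esize_nat (n : ℕ) : esize n = 2 * n + 1 := by
  induction n with
  | zero => rfl
  | succ n ih => simp [esize, enc, encNat] at *; omega

theorem esize_bool (b : Bool) : esize b ≤ 3 := by cases b <;> simp [esize, enc]

@[simp] theorem esize_none : esize (none : Option α) = 1 := rfl

@[simp] theorem esize_some (a : α) : esize (Option.some a) = esize a + 2 := by
  simp [esize, enc]; omega

theorem PB.self : PB fun a : α => esize a := PT.id.pb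

theorem spine_enc_list (l : List α) : (Enc.enc l).spine = l.length := by
  induction l with
  | nil => rfl
  | cons a l ih => simpa [enc, encList, spine] using ih

theorem spine_enc_nat (n : ℕ) : (Enc.enc n).spine = n := by
  induction n with
  | zero => rfl
  | succ n ih => simpa [enc, encNat, spine] using ih

/-! ### Iteration -/

theorem PT.iterate_spine {f : ε → σ → σ} {n : ε → SExp} {s : ε → σ}
    (hf : PT fun p : ε × σ => f p.1 p.2) (hn : PT n) (hs : PT s) {B : ε → ℕ} (hB : PB B)
    (h : ∀ e, ∀ i ≤ (n e).spine, esize ((f e)^[i] (s e)) ≤ B e) :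
    PT fun e => (f e)^[(n e).spine] (s e) := by
  have key : ∀ e i, (fun p : ε × σ => (p.1, f p.1 p.2))^[i] (e, s e) = (e, (f e)^[i] (s e)) := by
    intro e i
    induction i with
    | zero => rfl
    | succ i ih => rw [Function.iterate_succ_apply', ih, Function.iterate_succ_apply']
  have h1 : PT fun e => (fun p : ε × σ => (p.1, f p.1 p.2))^[(n e).spine] (e, s e) := by
    refine PT.iter_spine (by fun_prop) hn (by fun_prop)
      ((hB.add PB.self).add (.const 1)) fun e i hi => ?_
    rw [key, esize_pair]
    have := h e i hi
    omega
  exact h1.snd.of_eq fun e => by rw [key]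

theorem PT.iterate {f : ε → σ → σ} {n : ε → ℕ} {s : ε → σ}
    (hf : PT fun p : ε × σ => f p.1 p.2) (hn : PT n) (hs : PT s) {B : ε → ℕ} (hB : PB B)
    (h : ∀ e, ∀ i ≤ n e, esize ((f e)^[i] (s e)) ≤ B e) : PT fun e => (f e)^[n e] (s e) := by
  refine .of_eq (PT.iterate_spine hf (PT.enc hn) hs hB fun e i hi => h e i ?_) fun e => ?_
  · rwa [spine_enc_nat] at hi
  · rw [spine_enc_nat]

theorem PT.foldl {f : ε → σ → α → σ} {l : ε → List α} {s : ε → σ}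
    (hf : PT fun p : (ε × σ) × α => f p.1.1 p.1.2 p.2) (hl : PT l) (hs : PT s) {B : ε → ℕ}
    (hB : PB B) (h : ∀ e l', l' <+: l e → esize (l'.foldl (f e) (s e)) ≤ B e) :
    PT fun e => (l e).foldl (f e) (s e) := by
  have key : ∀ e i l s, i ≤ l.length → (fun q : σ × List α => q.2.head?.elim q fun a =>
      (f e q.1 a, q.2.tail))^[i] (s, l) = ((l.take i).foldl (f e) s, l.drop i) := by
    intro e i
    induction i with
    | zero => simp
    | succ i ih =>
      intro l s hi
      cases l with
      | nil => simp at hi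
      | cons a l => simpa using ih l (f e s a) (by simpa using hi)
  have hf' : PT fun p : (ε × (σ × List α)) × α => f p.1.1 p.1.2.1 p.2 :=
    hf.comp (g := fun p : (ε × (σ × List α)) × α => ((p.1.1, p.1.2.1), p.2)) (by fun_prop)
  have h1 : PT fun e => (fun q : σ × List α => q.2.head?.elim q fun a =>
      (f e q.1 a, q.2.tail))^[(Enc.enc (l e)).spine] (s e, l e) := by
    refine PT.iterate_spine (.elim (by fun_prop) (by fun_prop) (hf'.pair (by fun_prop)))
      (PT.enc hl) (by fun_prop) ((hB.add hl.pb).add (.const 1)) fun e i hi => ?_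
    rw [spine_enc_list] at hi
    rw [key _ _ _ _ hi, esize_pair]
    have := h e _ (List.take_prefix i (l e))
    have := esize_le_of_sublist (List.drop_sublist i (l e))
    omega
  exact h1.fst.of_eq fun e => by rw [spine_enc_list, key _ _ _ _ le_rfl]; simp

/-! ### Lists -/

@[fun_prop]
theorem PT.reverse {l : ε → List α} (hl : PT l) : PT fun e => (l e).reverse := by
  have : PT fun e => (l e).foldl (fun s a => a :: s) [] := by
    refine PT.foldl (by fun_prop) hl (by fun_prop) hl.pb fun e l' h => ?_
    simpa [esize_reverse] using esize_le_of_sublist h.sublist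
  exact this.of_eq fun e => by simp

@[fun_prop]
theorem PT.append {l l' : ε → List α} (hl : PT l) (hl' : PT l') : PT fun e => l e ++ l' e := by
  have : PT fun e => (l e).reverse.foldl (fun s a => a :: s) (l' e) := by
    refine PT.foldl (by fun_prop) (by fun_prop) hl' (hl.pb.add hl'.pb) fun e l₁ h => ?_
    have h1 := esize_append l₁.reverse (l' e)
    have h2 := esize_le_of_sublist h.sublist
    rw [esize_reverse] at h1 h2
    simp
    omega
  exact this.of_eq fun e => by simp

@[fun_prop]
theorem PT.map {f : ε → α → β} {l : ε → List α} (hf : PT fun p : ε × α => f p.1 p.2)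
    (hl : PT l) : PT fun e => (l e).map (f e) := by
  have hf' : PT fun p : (ε × List β) × α => f p.1.1 p.2 :=
    hf.comp (g := fun p : (ε × List β) × α => (p.1.1, p.2)) (by fun_prop)
  obtain ⟨q, hq⟩ := hf.pb
  have : PT fun e => (l e).foldl (fun s a => f e a :: s) [] := by
    refine PT.foldl (by fun_prop) hl (by fun_prop)
      (((hl.pb.mul (((PB.self.add hl.pb).add (.const 1)).eval q |>.add (.const 1)))).add
        (.const 1)) fun e l' h => ?_
    have h1 : l'.foldl (fun s a => f e a :: s) [] = (l'.map (f e)).reverse := by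
      simp
    rw [h1, esize_reverse]
    refine (esize_list_le (B := q.eval (esize e + esize (l e) + 1)) ?_).trans ?_
    · intro b hb
      obtain ⟨a, ha, rfl⟩ := List.mem_map.1 hb
      refine (hq (e, a)).trans (eval_mono _ ?_)
      have := esize_le_of_mem (h.subset ha)
      rw [esize_pair]
      omega
    · have := h.length_le.trans (length_le_esize (l e))
      simp only [List.length_map]
      gcongr
  exact this.reverse.of_eq fun e => by simp

@[fun_prop]
theorem PT.flatten {l : ε → List (List α)} (hl : PT l) : PT fun e => (l e).flatten := by
  have : PT fun e => (l e).foldl (fun s a => s ++ a) [] := by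
    refine PT.foldl (by fun_prop) hl (by fun_prop) hl.pb fun e l' h => ?_
    refine le_trans ?_ (esize_le_of_sublist h.sublist)
    have key : ∀ (l' : List (List α)) s,
        esize (l'.foldl (fun s a => s ++ a) s) + 1 ≤ esize s + esize l' := by
      intro l'
      induction l' with
      | nil => simp
      | cons a l' ih =>
        intro s
        have h1 := ih (s ++ a)
        have h2 := esize_append s a
        simp
        omega
    have := key l' []
    simp at this
    omega
  exact this.of_eq fun e => by simpa using List.foldl_append_eq_append (l := l e) (f := fun a => a) (l' := [])

@[fun_prop]
theorem PT.flatMap {f : ε → α → List β} {l : ε → List α} (hf : PT fun p : ε × α => f p.1 p.2)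
    (hl : PT l) : PT fun e => (l e).flatMap (f e) := by
  have : PT fun e => ((l e).map (f e)).flatten := by fun_prop
  exact this.of_eq fun e => by rw [List.flatMap_def]

@[fun_prop]
theorem PT.filterMap {f : ε → α → Option β} {l : ε → List α}
    (hf : PT fun p : ε × α => f p.1 p.2) (hl : PT l) : PT fun e => (l e).filterMap (f e) := by
  have : PT fun e => (l e).flatMap fun a => (f e a).elim [] fun b => [b] := by fun_prop
  refine this.of_eq fun e => ?_
  rw [List.filterMap_eq_flatMap_toList]
  congr 1
  funext a
  cases f e a <;> rfl

@[fun_prop]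
theorem PT.filter {f : ε → α → Bool} {l : ε → List α}
    (hf : PT fun p : ε × α => f p.1 p.2) (hl : PT l) : PT fun e => (l e).filter (f e) := by
  have : PT fun e => (l e).filterMap fun a => bif f e a then Option.some a else none := by fun_prop
  refine this.of_eq fun e => ?_
  rw [← List.filterMap_eq_filter]
  congr 1
  funext a
  cases h : f e a <;> simp [h, Option.guard]

@[fun_prop]
theorem PT.find? {f : ε → α → Bool} {l : ε → List α}
    (hf : PT fun p : ε × α => f p.1 p.2) (hl : PT l) : PT fun e => (l e).find? (f e) := by
  have : PT fun e => ((l e).filter (f e)).head? := by fun_prop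
  exact this.of_eq fun e => by simp

@[fun_prop]
theorem PT.any {f : ε → α → Bool} {l : ε → List α}
    (hf : PT fun p : ε × α => f p.1 p.2) (hl : PT l) : PT fun e => (l e).any (f e) := by
  have : PT fun e => ((l e).find? (f e)).isSome := by fun_prop
  exact this.of_eq fun e => by rw [Bool.eq_iff_iff, List.find?_isSome, List.any_eq_true]

@[fun_prop]
theorem PT.all {f : ε → α → Bool} {l : ε → List α}
    (hf : PT fun p : ε × α => f p.1 p.2) (hl : PT l) : PT fun e => (l e).all (f e) := by
  have : PT fun e => !((l e).any fun a => !(f e a)) := by fun_prop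
  exact this.of_eq fun e => by rw [List.all_eq_not_any_not]

/-! ### Numbers -/

@[fun_prop]
theorem PT.succ {f : ε → ℕ} (hf : PT f) : PT fun e => f e + 1 :=
  .recode (.sexp_cons (.const .nil) (PT.enc hf)) fun _ => rfl

theorem PT.pred {f : ε → ℕ} (hf : PT f) : PT fun e => f e - 1 :=
  .recode (PT.cdr.comp (PT.enc hf)) fun e => by cases f e <;> rfl

@[fun_prop]
theorem PT.add {f g : ε → ℕ} (hf : PT f) (hg : PT g) : PT fun e => f e + g e := by
  have key : ∀ i n : ℕ, (fun n => n + 1)^[i] n = n + i := fun i n => by simp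
  have : PT fun e => (fun n => n + 1)^[g e] (f e) := by
    refine PT.iterate (by fun_prop) hg hf (hf.pb.add hg.pb) fun e i hi => ?_
    rw [key]
    simp
    omega
  exact this.of_eq fun e => key _ _

@[fun_prop]
theorem PT.sub {f g : ε → ℕ} (hf : PT f) (hg : PT g) : PT fun e => f e - g e := by
  have key : ∀ i n : ℕ, (fun n => n - 1)^[i] n = n - i := by
    intro i n
    induction i with
    | zero => rfl
    | succ i ih => rw [Function.iterate_succ_apply', ih]; omega
  have : PT fun e => (fun n => n - 1)^[g e] (f e) := by
    refine PT.iterate (.pred (by fun_prop)) hg hf hf.pb fun e i hi => ?_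
    rw [key]
    simp
  exact this.of_eq fun e => key _ _

@[fun_prop]
theorem PT.mul {f g : ε → ℕ} (hf : PT f) (hg : PT g) : PT fun e => f e * g e := by
  have key : ∀ (m i n : ℕ), (fun n => n + m)^[i] n = n + m * i := by
    intro m i n
    induction i with
    | zero => rfl
    | succ i ih => rw [Function.iterate_succ_apply', ih]; ring
  have : PT fun e => (fun n => n + f e)^[g e] 0 := by
    refine PT.iterate (by fun_prop) hg (by fun_prop)
      (((PB.const 2).mul (hf.pb.mul hg.pb)).add (.const 1)) fun e i hi => ?_
    have := Nat.mul_le_mul_left (f e) hi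
    have h2 : f e * g e ≤ esize (f e) * esize (g e) := by
      apply Nat.mul_le_mul <;> simp <;> omega
    rw [key, esize_nat]
    omega
  exact this.of_eq fun e => by rw [key]; simp

theorem PT.isPos {f : ε → ℕ} (hf : PT f) : PT fun e => decide (0 < f e) :=
  (PT.isCons.comp (PT.enc hf)).of_eq fun e => by cases f e <;> simp [Enc.enc, encNat, SExp.isCons]

@[fun_prop]
theorem PT.lt {f g : ε → ℕ} (hf : PT f) (hg : PT g) : PT fun e => decide (f e < g e) :=
  (PT.isPos (hg.sub hf)).of_eq fun e => by simp

@[fun_prop]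
theorem PT.le {f g : ε → ℕ} (hf : PT f) (hg : PT g) : PT fun e => decide (f e ≤ g e) :=
  (PT.lt hf hg.succ).of_eq fun e => by simp

@[fun_prop]
theorem PT.nat_beq {f g : ε → ℕ} (hf : PT f) (hg : PT g) : PT fun e => f e == g e := by
  have : PT fun e => decide (f e ≤ g e) && decide (g e ≤ f e) := by fun_prop
  exact this.of_eq fun e => by rw [Bool.eq_iff_iff]; simp; omega

@[fun_prop]
theorem PT.length {l : ε → List α} (hl : PT l) : PT fun e => (l e).length := by
  have : PT fun e => (fun n : ℕ => n + 1)^[(Enc.enc (l e)).spine] 0 := by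
    refine PT.iterate_spine (by fun_prop) (PT.enc hl) (by fun_prop)
      (((PB.const 2).mul hl.pb).add (.const 1)) fun e i hi => ?_
    rw [spine_enc_list] at hi
    have := length_le_esize (l e)
    simp
    omega
  exact this.of_eq fun e => by simp [spine_enc_list]

@[fun_prop]
theorem PT.drop {n : ε → ℕ} {l : ε → List α} (hn : PT n) (hl : PT l) :
    PT fun e => (l e).drop (n e) := by
  have key : ∀ (i : ℕ) (l : List α), List.tail^[i] l = l.drop i := by
    intro i l
    induction i generalizing l with
    | zero => rfl
    | succ i ih => rw [Function.iterate_succ_apply, ih]; simp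
  have : PT fun e => List.tail^[n e] (l e) := by
    refine PT.iterate (by fun_prop) hn hl hl.pb fun e i hi => ?_
    rw [key]
    exact esize_le_of_sublist (List.drop_sublist _ _)
  exact this.of_eq fun e => key _ _

@[fun_prop]
theorem PT.getElem? {n : ε → ℕ} {l : ε → List α} (hn : PT n) (hl : PT l) :
    PT fun e => (l e)[n e]? := by
  have : PT fun e => ((l e).drop (n e)).head? := by fun_prop
  exact this.of_eq fun e => by simp

@[fun_prop]
theorem PT.list_getD {n : ε → ℕ} {l : ε → List α} {d : ε → α} (hl : PT l) (hn : PT n)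
    (hd : PT d) : PT fun e => (l e).getD (n e) (d e) := by
  have : PT fun e => ((l e)[n e]?).getD (d e) := by fun_prop
  exact this.of_eq fun e => by simp

@[fun_prop]
theorem PT.range {n : ε → ℕ} (hn : PT n) : PT fun e => List.range (n e) := by
  have key : ∀ i : ℕ, (fun l : List ℕ => l ++ [l.length])^[i] [] = List.range i := by
    intro i
    induction i with
    | zero => rfl
    | succ i ih => rw [Function.iterate_succ_apply', ih, List.range_succ]; simp
  have : PT fun e => (fun l : List ℕ => l ++ [l.length])^[n e] [] := by
    refine PT.iterate (by fun_prop) hn (by fun_prop)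
      ((hn.pb.mul (hn.pb.add (.const 1))).add (.const 1)) fun e i hi => ?_
    rw [key]
    refine (esize_list_le (B := esize (n e)) ?_).trans ?_
    · intro j hj
      simp at *
      omega
    · simp only [List.length_range]
      gcongr
      simp; omega
  exact this.of_eq fun e => key _

@[fun_prop]
theorem PT.contains_nat {a : ε → ℕ} {l : ε → List ℕ} (ha : PT a) (hl : PT l) :
    PT fun e => (l e).contains (a e) := by
  have : PT fun e => (l e).any fun b => a e == b := by fun_prop
  exact this.of_eq fun e => by rw [List.contains_eq_any_beq]

@[fun_prop]
theorem PT.option_nat_beq {f g : ε → Option ℕ} (hf : PT f) (hg : PT g) :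
    PT fun e => f e == g e := by
  have : PT fun e => (f e).elim (!(g e).isSome) fun a => (g e).elim false fun b => a == b := by
    fun_prop
  exact this.of_eq fun e => by cases f e <;> cases g e <;> rfl

@[fun_prop]
theorem PT.list_nat_beq {f g : ε → List ℕ} (hf : PT f) (hg : PT g) : PT fun e => f e == g e := by
  have : PT fun e => ((f e).length == (g e).length) &&
      (List.range (f e).length).all fun i => (f e)[i]? == (g e)[i]? := by fun_prop
  refine this.of_eq fun e => ?_
  rw [Bool.eq_iff_iff]
  simp only [Bool.and_eq_true, beq_iff_eq, List.all_eq_true, List.mem_range]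
  refine ⟨fun ⟨h, h'⟩ => List.ext_getElem? fun i => ?_, fun h => by simp [h]⟩
  by_cases hi : i < (f e).length
  · exact h' i hi
  · rw [List.getElem?_eq_none (by omega), List.getElem?_eq_none (by omega)]

@[fun_prop]
theorem PT.contains_list {a : ε → List ℕ} {l : ε → List (List ℕ)} (ha : PT a) (hl : PT l) :
    PT fun e => (l e).contains (a e) := by
  have : PT fun e => (l e).any fun b => a e == b := by fun_prop
  exact this.of_eq fun e => by rw [List.contains_eq_any_beq]

end

end CPTWSC

namespace CPTWSC

open Enc (enc)

/-! ## Codes for hereditarily finite sets -/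

/-- An entry `(some a, [])` is the atom with number `a`, an entry `(none, l)` is the set of the
values at the positions `l` of the list that follows the entry. -/
abbrev Ent : Type := Option ℕ × List ℕ

/-- A list of entries is a code for the value of its first entry. -/
abbrev Code : Type := List Ent

section

variable {α β ε σ : Type} [Enc α] [Enc β] [Enc ε] [Enc σ]

theorem esize_foldl_le {f : σ → α → σ} {c : ℕ}
    (h : ∀ s a, esize (f s a) ≤ esize s + c * (esize a + 1)) (l : List α) (s : σ) :
    esize (l.foldl f s) ≤ esize s + c * esize l := by
  induction l generalizing s with
  | nil => simp
  | cons a l ih =>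
    refine (ih (f s a)).trans ((Nat.add_le_add_right (h s a) _).trans ?_)
    rw [esize_cons]
    linarith

theorem PT.foldl_of_le {f : ε → σ → α → σ} {l : ε → List α} {s : ε → σ}
    (hf : PT fun p : (ε × σ) × α => f p.1.1 p.1.2 p.2) (hl : PT l) (hs : PT s) (c : ℕ)
    (h : ∀ e s a, esize (f e s a) ≤ esize s + c * (esize a + 1)) :
    PT fun e => (l e).foldl (f e) (s e) :=
  .foldl hf hl hs (hs.pb.add ((PB.const c).mul hl.pb)) fun e l' hl' =>
    (esize_foldl_le (h e) l' (s e)).trans (by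
      have := esize_le_of_sublist hl'.sublist
      gcongr)

@[fun_prop]
theorem PT.take {n : ε → ℕ} {l : ε → List α} (hn : PT n) (hl : PT l) :
    PT fun e => (l e).take (n e) := by
  have : PT fun e => ((l e).reverse.drop ((l e).length - n e)).reverse := by fun_prop
  refine this.of_eq fun e => ?_
  rw [List.drop_reverse, List.reverse_reverse]
  rcases le_total (n e) (l e).length with h | h
  · rw [Nat.sub_sub_self h]
  · rw [Nat.sub_eq_zero_of_le h, Nat.sub_zero, List.take_length, List.take_of_length_le h]

/-- Removes duplicates. -/
def dedupNat (l : List ℕ) : List ℕ :=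
  l.foldl (fun s a => bif s.contains a then s else a :: s) []

@[fun_prop]
theorem PT.dedupNat {l : ε → List ℕ} (hl : PT l) : PT fun e => dedupNat (l e) := by
  unfold CPTWSC.dedupNat
  refine .foldl_of_le (by fun_prop) hl (by fun_prop) 1 fun e s a => ?_
  cases s.contains a
  · simp; omega
  · simp

/-- Equality of lists as sets. -/
def setEq (l l' : List ℕ) : Bool := (l.all fun a => l'.contains a) && l'.all fun a => l.contains a

@[fun_prop]
theorem PT.setEq {l l' : ε → List ℕ} (hl : PT l) (hl' : PT l') :
    PT fun e => setEq (l e) (l' e) := by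
  unfold CPTWSC.setEq
  fun_prop

/-- A code for the empty set. -/
def emptyC : Code := [(none, [])]

/-- A code for an atom. -/
def atomC (a : ℕ) : Code := [(some a, [])]

@[fun_prop]
theorem PT.atomC {f : ε → ℕ} (hf : PT f) : PT fun e => atomC (f e) := by
  unfold CPTWSC.atomC
  fun_prop

/-- A code for the set of given elements. -/
def ofListC (vs : List Code) : Code :=
  (none, (List.range vs.length).map fun i => (vs.take i).flatten.length) :: vs.flatten

@[fun_prop]
theorem PT.ofListC {f : ε → List Code} (hf : PT f) : PT fun e => ofListC (f e) := by
  unfold CPTWSC.ofListC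
  fun_prop

/-- Codes for the elements. -/
def elemsC (v : Code) : List Code := (v.headD (none, [])).2.map fun j => v.tail.drop j

@[fun_prop]
theorem PT.elemsC {f : ε → Code} (hf : PT f) : PT fun e => elemsC (f e) := by
  unfold CPTWSC.elemsC
  fun_prop

/-! ### Normal forms -/

/-- The positions in the tail of a code that are needed if the positions `need` are needed in the
code with first entry `x`. -/
def needTail (need : List ℕ) (x : Ent) : List ℕ :=
  ((need.filter fun j => decide (0 < j)).map fun j => j - 1) ++
    bif need.contains 0 then x.2 else []

/-- Translates an entry. -/
def translate (m : List ℕ) (x : Ent) : Ent := (x.1, dedupNat (x.2.map fun j => m.getD j 0))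

/-- The entry at position `p` of `h` describes the same value as the entry `y` in front of `h`. -/
def describes (h : Code) (y : Ent) (p : ℕ) : Bool :=
  h[p]?.elim false fun z => (z.1 == y.1) && setEq (z.2.map fun j => j + (p + 1)) y.2

/-- One step of `compress`. -/
def compressStep (s : Code × List ℕ) (q : Bool × Ent) : Code × List ℕ :=
  bif q.1 then
    ((List.range s.1.length).find? (describes s.1 (translate s.2 q.2))).elim
      (translate s.2 q.2 :: s.1, 0 :: s.2.map fun j => j + 1) fun p => (s.1, p :: s.2)
  else (s.1, 0 :: s.2)

/-- A code without repetitions for the values at the positions `need` and the sets needed for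
them, and the position in this code for every position of the given code. -/
def compress : List ℕ → Code → Code × List ℕ
  | _, [] => ([], [])
  | need, x :: v => compressStep (compress (needTail need x) v) (need.contains 0, x)

/-- A code without repetitions and without unnecessary sets. -/
def norm (v : Code) : Code := (compress [0] v).1.drop ((compress [0] v).2.headD 0)

/-- One step in the computation of the needed positions. -/
def markStep (s : List ℕ × List (Bool × Ent)) (x : Ent) : List ℕ × List (Bool × Ent) :=
  (needTail s.1 x, (s.1.contains 0, x) :: s.2)

theorem foldl_markStep (v : Code) (need : List ℕ) (out : List (Bool × Ent)) :
    (v.foldl markStep (need, out)).2.foldl compressStep ([], []) =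
      out.foldl compressStep (compress need v) := by
  induction v generalizing need out with
  | nil => rfl
  | cons x v ih => rw [List.foldl_cons, markStep, ih]; rfl

@[fun_prop]
theorem PT.needTail {f : ε → List ℕ} {g : ε → Ent} (hf : PT f) (hg : PT g) :
    PT fun e => needTail (f e) (g e) := by
  have : PT fun e => ((f e).filterMap fun j => bif decide (0 < j) then Option.some (j - 1) else none) ++
    bif (f e).contains 0 then (g e).2 else [] := by fun_prop
  refine this.of_eq fun e => ?_
  unfold CPTWSC.needTail
  congr 1
  induction f e with
  | nil => rfl
  | cons j l ih => cases j <;> simp [ih]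

theorem esize_map_pred_filter (l : List ℕ) :
    esize ((l.filter fun j => decide (0 < j)).map fun j => j - 1) ≤ esize l := by
  induction l with
  | nil => simp
  | cons j l ih => cases j <;> simp at * <;> omega

theorem PT.markStep {f : ε → List ℕ × List (Bool × Ent)} {g : ε → Ent} (hf : PT f) (hg : PT g) :
    PT fun e => markStep (f e) (g e) := by
  unfold CPTWSC.markStep
  fun_prop

theorem esize_markStep_le (s : List ℕ × List (Bool × Ent)) (x : Ent) :
    esize (markStep s x) ≤ esize s + 5 * (esize x + 1) := by
  have h1 := esize_map_pred_filter s.1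
  have h2 : esize (bif s.1.contains 0 then x.2 else []) ≤ esize x := by
    have hx : esize x = esize x.1 + esize x.2 + 1 := esize_pair x.1 x.2
    cases s.1.contains 0
    · simp only [cond_false, esize_nil]; omega
    · simp only [cond_true]; omega
  have h3 := esize_append ((s.1.filter fun j => decide (0 < j)).map fun j => j - 1)
    (bif s.1.contains 0 then x.2 else [])
  have h4 := esize_bool (s.1.contains 0)
  have h5 : esize s = esize s.1 + esize s.2 + 1 := esize_pair s.1 s.2
  rw [CPTWSC.markStep, needTail, esize_pair, esize_cons, esize_pair]
  omega

@[fun_prop]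
theorem PT.translate {f : ε → List ℕ} {g : ε → Ent} (hf : PT f) (hg : PT g) :
    PT fun e => translate (f e) (g e) := by
  unfold CPTWSC.translate
  fun_prop

@[fun_prop]
theorem PT.describes {f : ε → Code} {g : ε → Ent} {p : ε → ℕ} (hf : PT f) (hg : PT g) (hp : PT p) :
    PT fun e => describes (f e) (g e) (p e) := by
  unfold CPTWSC.describes
  fun_prop

@[fun_prop]
theorem PT.compressStep {f : ε → Code × List ℕ} {g : ε → Bool × Ent} (hf : PT f) (hg : PT g) :
    PT fun e => compressStep (f e) (g e) := by
  unfold CPTWSC.compressStep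
  fun_prop

theorem mem_dedupNat {l : List ℕ} {a : ℕ} : a ∈ dedupNat l ↔ a ∈ l := by
  have key : ∀ (l s : List ℕ), a ∈ l.foldl (fun s a => bif s.contains a then s else a :: s) s ↔
      a ∈ s ∨ a ∈ l := by
    intro l
    induction l with
    | nil => simp
    | cons b l ih =>
      intro s
      rw [List.foldl_cons, ih]
      cases h : s.contains b
      · simp; tauto
      · simp at *
        constructor
        · tauto
        · rintro (h | rfl | h) <;> tauto
  exact (key l []).trans (by simp)

theorem nodup_dedupNat (l : List ℕ) : (dedupNat l).Nodup := by
  have key : ∀ (l s : List ℕ), s.Nodup →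
      (l.foldl (fun s a => bif s.contains a then s else a :: s) s).Nodup := by
    intro l
    induction l with
    | nil => simp
    | cons b l ih =>
      intro s hs
      rw [List.foldl_cons]
      apply ih
      cases h : s.contains b
      · simp at *; tauto
      · simpa
  exact key l [] List.nodup_nil

theorem length_dedupNat_le (l : List ℕ) : (dedupNat l).length ≤ l.length :=
  (List.subperm_of_subset (nodup_dedupNat l) fun _ h => mem_dedupNat.1 h).length_le

/-- A bound for the results of `compressStep`. -/
structure CompressBound (E k : ℕ) (s : Code × List ℕ) : Prop where
  length_map : s.2.length ≤ k
  map_le : ∀ j ∈ s.2, j ≤ k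
  length : s.1.length ≤ k
  esize_fst : ∀ x ∈ s.1, esize x.1 ≤ E
  length_snd : ∀ x ∈ s.1, x.2.length ≤ E
  snd_le : ∀ x ∈ s.1, ∀ j ∈ x.2, j ≤ k

theorem CompressBound.step {E k : ℕ} {s : Code × List ℕ} (h : CompressBound E k s)
    {q : Bool × Ent} (hq : esize q ≤ E) : CompressBound E (k + 1) (compressStep s q) := by
  have h1 : esize q = esize q.1 + (esize q.2.1 + esize q.2.2 + 1) + 1 := by
    rw [← esize_pair, ← esize_pair]
  have h2 := length_le_esize q.2.2
  have ht : ∀ j ∈ (translate s.2 q.2).2, j ≤ k := by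
    intro j hj
    obtain ⟨i, -, rfl⟩ := List.mem_map.1 (mem_dedupNat.1 hj)
    rw [List.getD_eq_getElem?_getD]
    cases h' : s.2[i]? with
    | none => simp
    | some j => simpa using h.map_le j (List.mem_of_getElem? h')
  unfold compressStep
  cases q.1 with
  | false =>
    exact ⟨by simp [h.length_map], by simpa using fun j hj => (h.map_le j hj).trans (by simp),
      h.length.trans (by simp), h.esize_fst, h.length_snd,
      fun x hx j hj => (h.snd_le x hx j hj).trans (by simp)⟩
  | true =>
    rw [cond_true]
    cases hp : (List.range s.1.length).find? (describes s.1 (translate s.2 q.2)) with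
    | none =>
      refine ⟨by simp [h.length_map], by simpa using h.map_le, by simp [h.length], ?_, ?_, ?_⟩
      · simp only [Option.elim_none, List.mem_cons]
        rintro x (rfl | hx)
        · simp only [translate]; omega
        · exact h.esize_fst x hx
      · simp only [Option.elim_none, List.mem_cons]
        rintro x (rfl | hx)
        · have := length_dedupNat_le (q.2.2.map fun j => s.2.getD j 0)
          simp only [translate]
          simp only [List.length_map] at this
          omega
        · exact h.length_snd x hx
      · simp only [Option.elim_none, List.mem_cons]
        rintro x (rfl | hx) j hj
        · exact (ht j hj).trans (by simp)
        · exact (h.snd_le x hx j hj).trans (by simp)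
    | some p =>
      have hp' := List.mem_range.1 (List.mem_of_find?_eq_some hp)
      have := h.length
      exact ⟨by simp [h.length_map], by
        simpa using ⟨by omega, fun j hj => (h.map_le j hj).trans (by simp)⟩,
        h.length.trans (by simp), h.esize_fst, h.length_snd,
        fun x hx j hj => (h.snd_le x hx j hj).trans (by simp)⟩

theorem esize_nat_list_le {l : List ℕ} {L B : ℕ} (hl : l.length ≤ L) (h : ∀ j ∈ l, j ≤ B) :
    esize l ≤ L * (2 * B + 2) + 1 := by
  refine (esize_list_le (B := 2 * B + 1) fun j hj => ?_).trans ?_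
  · have := h j hj
    simp; omega
  · gcongr

theorem CompressBound.esize_le {E k : ℕ} {s : Code × List ℕ} (h : CompressBound E k s) :
    esize s ≤ (k * (E + (E * (2 * k + 2) + 1) + 1 + 1) + 1) + (k * (2 * k + 2) + 1) + 1 := by
  have h1 := esize_nat_list_le h.length_map h.map_le
  have h2 : esize s.1 ≤ k * (E + (E * (2 * k + 2) + 1) + 1 + 1) + 1 := by
    refine (esize_list_le (B := E + (E * (2 * k + 2) + 1) + 1) fun x hx => ?_).trans ?_
    · have h3 := esize_nat_list_le (h.length_snd x hx) (h.snd_le x hx)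
      have h4 := h.esize_fst x hx
      have h5 : esize x = _ := esize_pair x.1 x.2
      omega
    · gcongr
      exact h.length
  have h5 : esize s = _ := esize_pair s.1 s.2
  omega

theorem CompressBound.foldl {E : ℕ} {l : List (Bool × Ent)} (hl : ∀ q ∈ l, esize q ≤ E) {k : ℕ}
    {s : Code × List ℕ} (h : CompressBound E k s) :
    CompressBound E (k + l.length) (l.foldl compressStep s) := by
  induction l generalizing k s with
  | nil => exact h
  | cons q l ih =>
    have := ih (fun q hq => hl q (by simp [hq])) (h.step (hl q (by simp)))
    rwa [add_right_comm, add_assoc, ← List.length_cons] at this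

@[fun_prop]
theorem PT.compress {f : ε → List ℕ} {g : ε → Code} (hf : PT f) (hg : PT g) :
    PT fun e => compress (f e) (g e) := by
  have h1 : PT fun e => ((g e).foldl CPTWSC.markStep (f e, [])).2 :=
    (PT.foldl_of_le (.markStep (by fun_prop) (by fun_prop)) hg (by fun_prop) 5
      fun _ => esize_markStep_le).snd
  have h2 : PT fun e => (((g e).foldl CPTWSC.markStep (f e, [])).2).foldl
      CPTWSC.compressStep ([], []) := by
    refine .foldl (by fun_prop) h1 (.const _) (B := fun e =>
      (fun E k : ℕ => (k * (E + (E * (2 * k + 2) + 1) + 1 + 1) + 1) + (k * (2 * k + 2) + 1) + 1)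
        (esize ((g e).foldl CPTWSC.markStep (f e, [])).2)
        (esize ((g e).foldl CPTWSC.markStep (f e, [])).2)) ?_ fun e l' h => ?_
    · have h := h1.pb
      have hk := ((PB.const 2).mul h).add (.const 2)
      exact (((h.mul (((h.add ((h.mul hk).add (.const 1))).add (.const 1)).add (.const 1))).add
        (.const 1)).add ((h.mul hk).add (.const 1))).add (.const 1)
    · have hb : CompressBound (esize ((g e).foldl CPTWSC.markStep (f e, [])).2) 0 ([], []) :=
        ⟨by simp, by simp, by simp, by simp, by simp, by simp⟩
      have := hb.foldl (l := l') fun q hq => esize_le_of_mem (h.subset hq)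
      refine this.esize_le.trans ?_
      have := h.length_le.trans (length_le_esize _)
      simp only [zero_add]
      gcongr
  exact h2.of_eq fun e => foldl_markStep _ _ []

@[fun_prop]
theorem PT.norm {f : ε → Code} (hf : PT f) : PT fun e => norm (f e) := by
  unfold CPTWSC.norm
  fun_prop

/-- The number of elements. -/
def cardC (v : Code) : ℕ := ((norm v).headD (none, [])).2.length

/-- Equality of the values. -/
def eqC (v w : Code) : Bool := cardC (ofListC [v, w]) == 1

@[fun_prop]
theorem PT.cardC {f : ε → Code} (hf : PT f) : PT fun e => cardC (f e) := by
  unfold CPTWSC.cardC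
  fun_prop

@[fun_prop]
theorem PT.eqC {f g : ε → Code} (hf : PT f) (hg : PT g) : PT fun e => eqC (f e) (g e) := by
  unfold CPTWSC.eqC
  fun_prop

/-- A bound for codes in normal form, in terms of the number `n` of atoms and the size `N` of the
transitive closure. -/
def small (n N : ℕ) (v : Code) : Bool :=
  decide (v.length ≤ N + 1) && v.all fun x => (x.1.elim true fun a => decide (a < n)) &&
    (decide (x.2.length ≤ N + 1) && x.2.all fun j => decide (j ≤ N + 1))

@[fun_prop]
theorem PT.small {n N : ε → ℕ} {v : ε → Code} (hn : PT n) (hN : PT N) (hv : PT v) :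
    PT fun e => small (n e) (N e) (v e) := by
  unfold CPTWSC.small
  fun_prop

/-- A bound for the size of small codes. -/
def smallBound (n N : ℕ) : ℕ :=
  (N + 1) * (2 * n + 3 + ((N + 1) * (2 * (N + 1) + 2) + 1) + 1 + 1) + 1

theorem esize_le_of_small {n N : ℕ} {v : Code} (h : small n N v = true) :
    esize v ≤ smallBound n N := by
  simp only [CPTWSC.small, Bool.and_eq_true, decide_eq_true_eq, List.all_eq_true] at h
  refine (esize_list_le (B := 2 * n + 3 + ((N + 1) * (2 * (N + 1) + 2) + 1) + 1)
    fun x hx => ?_).trans ?_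
  · obtain ⟨h1, h2, h3⟩ := h.2 x hx
    have h4 := esize_nat_list_le h2 h3
    have h5 : esize x.1 ≤ 2 * n + 3 := by
      cases hx1 : x.1 with
      | none => simp
      | some a => simp [hx1] at *; omega
    have h5 : esize x = _ := esize_pair x.1 x.2
    omega
  · rw [smallBound]
    gcongr
    exact h.1

theorem PB.smallBound {n N : ε → ℕ} (hn : PB n) (hN : PB N) :
    PB fun e => smallBound (n e) (N e) := by
  have h1 := hN.add (.const 1)
  exact (h1.mul ((((((PB.const 2).mul hn).add (.const 3)).add ((h1.mul (((PB.const 2).mul h1).add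
    (.const 2))).add (.const 1))).add (.const 1)).add (.const 1))).add (.const 1)

end

end CPTWSC

namespace CPTWSC

/-! ## The values of codes -/

/-- All positions in a code exist and all atoms are less than `n`. -/
def WF (n : ℕ) : Code → Prop
  | [] => True
  | x :: v => ((∀ a, x.1 = some a → a < n ∧ x.2 = []) ∧ ∀ j ∈ x.2, j < v.length) ∧ WF n v

/-- A well-formed code for an element of `HF A`. -/
def Good (n : ℕ) (v : Code) : Prop := v ≠ [] ∧ WF n v

section

variable {A : Type} {n : ℕ} (e : Fin n ≃ A)

/-- The atom with number `a`. -/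
def atomOf (a : ℕ) : HF A := if h : a < n then HF.atom (e ⟨a, h⟩) else ∅

/-- The value of an entry that is followed by entries with given values. -/
noncomputable def entVal (vs : List (HF A)) (x : Ent) : HF A :=
  x.1.elim (HF.ofFinset (x.2.filterMap fun j => vs[j]?).toFinset) (atomOf e)

/-- The values of all entries. -/
noncomputable def vals : Code → List (HF A)
  | [] => []
  | x :: v => entVal e (vals v) x :: vals v

/-- The value of a code. -/
noncomputable def den (v : Code) : HF A := (vals e v).headD ∅

variable {e}

theorem length_vals (v : Code) : (vals e v).length = v.length := by
  induction v with
  | nil => rfl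
  | cons x v ih => simp [vals, ih]

theorem vals_drop (v : Code) (k : ℕ) : vals e (v.drop k) = (vals e v).drop k := by
  induction v generalizing k with
  | nil => simp [vals]
  | cons x v ih => cases k <;> simp [vals, ih]

theorem den_drop (v : Code) (k : ℕ) : den e (v.drop k) = ((vals e v)[k]?).getD ∅ := by
  rw [den, vals_drop, List.headD_eq_head?_getD, List.head?_drop]

theorem WF.drop {v : Code} (h : WF n v) (k : ℕ) : WF n (v.drop k) := by
  induction v generalizing k with
  | nil => simpa
  | cons x v ih => cases k with
    | zero => exact h
    | succ k => exact ih h.2 k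

theorem WF.entry {v : Code} (h : WF n v) {p : ℕ} {x : Ent} (hx : v[p]? = some x) :
    (∀ a, x.1 = some a → a < n ∧ x.2 = []) ∧ ∀ j ∈ x.2, j + (p + 1) < v.length := by
  induction v generalizing p with
  | nil => simp at hx
  | cons y v ih => cases p with
    | zero =>
      obtain rfl : y = x := by simpa using hx
      exact ⟨h.1.1, fun j hj => by simpa using h.1.2 j hj⟩
    | succ p =>
      have := ih h.2 (by simpa using hx)
      exact ⟨this.1, fun j hj => by have := this.2 j hj; simp; omega⟩

theorem vals_entry {v : Code} {p : ℕ} {x : Ent} (hx : v[p]? = some x) :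
    (vals e v)[p]? = some (entVal e (vals e (v.drop (p + 1))) x) := by
  induction v generalizing p with
  | nil => simp at hx
  | cons y v ih => cases p with
    | zero =>
      obtain rfl : y = x := by simpa using hx
      simp [vals]
    | succ p => simpa [vals] using ih (by simpa using hx)

theorem entVal_atom {vs : List (HF A)} {a : ℕ} (h : a < n) {l : List ℕ} :
    entVal e vs (some a, l) = HF.atom (e ⟨a, h⟩) := by
  simp [entVal, atomOf, h]

theorem entVal_set {vs : List (HF A)} {l : List ℕ} :
    entVal e vs (none, l) = HF.ofFinset (l.filterMap fun j => vs[j]?).toFinset := rfl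

theorem mem_elems_entVal {vs : List (HF A)} {x : Ent} (hx : ∀ a, x.1 = some a → a < n ∧ x.2 = [])
    {u : HF A} : u ∈ (entVal e vs x).elems ↔ ∃ j ∈ x.2, vs[j]? = some u := by
  obtain ⟨_ | a, l⟩ := x
  · simp [entVal_set, HF.elems_ofFinset]
  · obtain ⟨h, rfl⟩ := hx a rfl
    simp [entVal_atom h, HF.elems_atom]

theorem entVal_congr {vs ws : List (HF A)} {x y : Ent} (h1 : x.1 = y.1)
    (h2 : ∀ u, (∃ j ∈ x.2, vs[j]? = some u) ↔ ∃ j ∈ y.2, ws[j]? = some u) :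
    entVal e vs x = entVal e ws y := by
  unfold entVal
  rw [h1]
  congr 2
  ext u
  simpa using h2 u

/-- Every element of a value is a later value. -/
theorem WF.mem_vals_of_mem_elems {v : Code} (h : WF n v) {p : ℕ} {a u : HF A}
    (ha : (vals e v)[p]? = some a) (hu : u ∈ a.elems) : ∃ q, p < q ∧ (vals e v)[q]? = some u := by
  obtain ⟨x, hx⟩ : ∃ x, v[p]? = some x := by
    have := (List.getElem?_eq_some_iff.1 ha).1
    rw [length_vals] at this
    exact ⟨_, List.getElem?_eq_getElem this⟩
  obtain rfl : _ = a := Option.some.inj ((vals_entry hx).symm.trans ha)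
  obtain ⟨j, -, hj⟩ := (mem_elems_entVal (h.entry hx).1).1 hu
  rw [vals_drop, List.getElem?_drop] at hj
  exact ⟨_, by omega, hj⟩

theorem getElem?_inj_of_nodup {α : Type} {l : List α} (h : l.Nodup) {i j : ℕ} {a : α}
    (hi : l[i]? = some a) (hj : l[j]? = some a) : i = j :=
  List.getElem?_inj (List.getElem?_eq_some_iff.1 hi).1 h |>.1 (hi.trans hj.symm)

theorem setEq_iff {l l' : List ℕ} : setEq l l' = true ↔ ∀ a, a ∈ l ↔ a ∈ l' := by
  simp only [setEq, Bool.and_eq_true, List.all_eq_true, List.contains_iff_mem]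
  exact ⟨fun h a => ⟨h.1 a, h.2 a⟩, fun h => ⟨fun a => (h a).1, fun a => (h a).2⟩⟩

theorem describes_iff {h : Code} {y : Ent} {p : ℕ} : describes h y p = true ↔
    ∃ z, h[p]? = some z ∧ z.1 = y.1 ∧ ∀ j, j ∈ z.2.map (fun j => j + (p + 1)) ↔ j ∈ y.2 := by
  unfold describes
  cases h[p]? with
  | none => simp
  | some z => simp [setEq_iff]

/-- A code without repetitions describes a value at most once. -/
theorem describes_iff_vals {h : Code} (hh : WF n h) (hn : (vals e h).Nodup) {y : Ent}
    (hy : (∀ a, y.1 = some a → a < n ∧ y.2 = []) ∧ ∀ j ∈ y.2, j < h.length) {p : ℕ} :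
    describes h y p = true ↔ (vals e h)[p]? = some (entVal e (vals e h) y) := by
  rw [describes_iff]
  constructor
  · rintro ⟨z, hz, h1, h2⟩
    rw [vals_entry hz, vals_drop]
    congr 1
    refine entVal_congr h1 fun u => ?_
    simp only [← h2, List.mem_map, List.getElem?_drop]
    constructor
    · rintro ⟨j, hj, hu⟩
      exact ⟨_, ⟨j, hj, rfl⟩, by rwa [add_comm]⟩
    · rintro ⟨_, ⟨j, hj, rfl⟩, hu⟩
      exact ⟨j, hj, by rwa [add_comm]⟩
  · intro hp
    obtain ⟨z, hz⟩ : ∃ z, h[p]? = some z := by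
      have := (List.getElem?_eq_some_iff.1 hp).1
      rw [length_vals] at this
      exact ⟨_, List.getElem?_eq_getElem this⟩
    refine ⟨z, hz, ?_⟩
    have hw := hh.entry hz
    have hval := Option.some.inj ((vals_entry hz).symm.trans hp)
    have hel : ∀ u, (∃ j ∈ z.2, (vals e h)[j + (p + 1)]? = some u) ↔
        ∃ j ∈ y.2, (vals e h)[j]? = some u := fun u => by
      rw [← mem_elems_entVal hy.1, ← hval, mem_elems_entVal hw.1]
      simp only [vals_drop, List.getElem?_drop, add_comm]
    constructor
    · obtain ⟨_ | a, l⟩ := z <;> obtain ⟨_ | b, l'⟩ := y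
      · rfl
      · rw [entVal_atom (hy.1 b rfl).1] at hval
        exact absurd hval.symm (HF.atom_ne_ofFinset _ _)
      · rw [entVal_atom (hw.1 a rfl).1] at hval
        exact absurd hval (HF.atom_ne_ofFinset _ _)
      · rw [entVal_atom (hy.1 b rfl).1, entVal_atom (hw.1 a rfl).1] at hval
        have := e.injective (HF.atom_injective hval)
        simpa using this
    · intro j
      rw [List.mem_map]
      constructor
      · rintro ⟨j, hj, rfl⟩
        obtain ⟨u, hu⟩ : ∃ u, (vals e h)[j + (p + 1)]? = some u :=
          ⟨_, List.getElem?_eq_getElem (by rw [length_vals]; exact hw.2 j hj)⟩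
        obtain ⟨i, hi, hiu⟩ := (hel u).1 ⟨j, hj, hu⟩
        rwa [getElem?_inj_of_nodup hn hu hiu]
      · intro hj
        obtain ⟨u, hu⟩ : ∃ u, (vals e h)[j]? = some u :=
          ⟨_, List.getElem?_eq_getElem (by rw [length_vals]; exact hy.2 j hj)⟩
        obtain ⟨i, hi, hiu⟩ := (hel u).2 ⟨j, hj, hu⟩
        exact ⟨i, hi, getElem?_inj_of_nodup hn hiu hu⟩

/-! ### Normal forms -/

variable (e) in
/-- What `compress` achieves. -/
structure CompressSpec (need : List ℕ) (v : Code) (s : Code × List ℕ) : Prop where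
  length_map : s.2.length = v.length
  wf : WF n s.1
  nodup : (vals e s.1).Nodup
  nodup_snd : ∀ x ∈ s.1, x.2.Nodup
  map : ∀ j ∈ need, j < v.length → (vals e s.1)[s.2.getD j 0]? = (vals e v)[j]?
  closed : ∀ P : HF A → Prop, (∀ x y, P y → x ∈ y.elems → P x) →
    (∀ j ∈ need, ∀ x, (vals e v)[j]? = some x → P x) → ∀ x ∈ vals e s.1, P x

theorem CompressSpec.cons {need : List ℕ} {v : Code} {s : Code × List ℕ} {x : Ent}
    (h : CompressSpec e (needTail need x) v s) (hx : WF n (x :: v)) :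
    CompressSpec e need (x :: v) (compressStep s (need.contains 0, x)) := by
  have hmap : ∀ j ∈ need, 0 < j → j < (x :: v).length →
      (vals e s.1)[s.2.getD (j - 1) 0]? = (vals e (x :: v))[j]? := by
    intro j hj hj0 hjv
    rw [h.map (j - 1) _ (by simp at hjv; omega)]
    · obtain ⟨j, rfl⟩ := Nat.exists_eq_succ_of_ne_zero hj0.ne'
      simp [vals]
    · rw [needTail]
      exact List.mem_append_left _ (List.mem_map.2 ⟨j, List.mem_filter.2 ⟨hj, by simpa⟩, rfl⟩)
  have hcl : ∀ P : HF A → Prop, (∀ x y, P y → x ∈ y.elems → P x) →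
      (∀ j ∈ need, ∀ y, (vals e (x :: v))[j]? = some y → P y) → ∀ y ∈ vals e s.1, P y := by
    intro P hP hneed
    refine h.closed P hP fun j hj y hy => ?_
    rcases List.mem_append.1 hj with hj | hj
    · obtain ⟨i, hi, rfl⟩ := List.mem_map.1 hj
      obtain ⟨hi, hi0⟩ := List.mem_filter.1 hi
      obtain ⟨i, rfl⟩ := Nat.exists_eq_succ_of_ne_zero (of_decide_eq_true hi0).ne'
      exact hneed _ hi y (by simpa [vals] using hy)
    · cases h0 : need.contains 0 with
      | false => rw [h0] at hj; simp at hj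
      | true =>
        rw [h0, cond_true] at hj
        refine hP y _ (hneed 0 (List.contains_iff_mem.1 h0) _ rfl) ?_
        exact (mem_elems_entVal hx.1.1).2 ⟨j, hj, hy⟩
  unfold compressStep
  cases h0 : need.contains 0 with
  | false =>
    refine ⟨by simp [h.length_map], h.wf, h.nodup, h.nodup_snd, fun j hj hjv => ?_, hcl⟩
    have hj0 : 0 < j := Nat.pos_of_ne_zero fun h' => by simp_all
    rw [← hmap j hj hj0 hjv]
    obtain ⟨j, rfl⟩ := Nat.exists_eq_succ_of_ne_zero hj0.ne'
    rfl
  | true =>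
    have hneed : ∀ j ∈ x.2, j ∈ needTail need x := fun j hj => by
      rw [needTail, h0]; exact List.mem_append_right _ hj
    have hmap' : ∀ j ∈ x.2, (vals e s.1)[s.2.getD j 0]? = (vals e v)[j]? := fun j hj =>
      h.map j (hneed j hj) (hx.1.2 j hj)
    have hy : entVal e (vals e s.1) (translate s.2 x) = entVal e (vals e v) x := by
      refine entVal_congr rfl fun u => ?_
      simp only [translate, mem_dedupNat, List.mem_map]
      constructor
      · rintro ⟨_, ⟨j, hj, rfl⟩, hu⟩
        exact ⟨j, hj, (hmap' j hj).symm.trans hu⟩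
      · rintro ⟨j, hj, hu⟩
        exact ⟨_, ⟨j, hj, rfl⟩, (hmap' j hj).trans hu⟩
    have hyw : (∀ a, (translate s.2 x).1 = some a → a < n ∧ (translate s.2 x).2 = []) ∧
        ∀ j ∈ (translate s.2 x).2, j < s.1.length := by
      constructor
      · intro a ha
        have := hx.1.1 a ha
        exact ⟨this.1, by simp [translate, this.2, dedupNat]⟩
      · intro j hj
        obtain ⟨i, hi, rfl⟩ := List.mem_map.1 (mem_dedupNat.1 hj)
        have h1 := hmap' i hi
        have h2 := hx.1.2 i hi
        rw [← length_vals (e := e)] at h2 ⊢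
        rw [List.getElem?_eq_getElem h2] at h1
        exact (List.getElem?_eq_some_iff.1 h1).1
    rw [cond_true]
    cases hp : (List.range s.1.length).find? (describes s.1 (translate s.2 x)) with
    | none =>
      refine ⟨by simp [h.length_map], ⟨hyw, h.wf⟩, List.nodup_cons.2 ⟨fun hmem => ?_, h.nodup⟩, ?_, fun j hj hjv => ?_,
        fun P hP hneed => ?_⟩
      · obtain ⟨p, hp'⟩ := List.mem_iff_getElem?.1 hmem
        have hlt := (List.getElem?_eq_some_iff.1 hp').1
        rw [length_vals] at hlt
        exact List.find?_eq_none.1 hp p (List.mem_range.2 hlt)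
          ((describes_iff_vals h.wf h.nodup hyw).2 hp')
      · rintro z (_ | ⟨_, hz⟩)
        · exact nodup_dedupNat _
        · exact h.nodup_snd z hz
      · cases j with
        | zero => simp [vals, hy]
        | succ j =>
          rw [← hmap _ hj (by simp) hjv]
          have hlt : j < s.2.length := by simpa [h.length_map] using hjv
          simp [vals, hlt]
      · intro y hy'
        rcases List.mem_cons.1 hy' with rfl | hy'
        · rw [hy]; exact hneed 0 (List.contains_iff_mem.1 h0) _ rfl
        · exact hcl P hP hneed y hy'
    | some p =>
      have hd := (describes_iff_vals h.wf h.nodup hyw).1 (List.find?_some hp)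
      refine ⟨by simp [h.length_map], h.wf, h.nodup, h.nodup_snd, fun j hj hjv => ?_, hcl⟩
      cases j with
      | zero => simp [vals, hd, hy]
      | succ j => exact hmap _ hj (by simp) hjv

theorem compress_spec {v : Code} (hv : WF n v) (need : List ℕ) :
    CompressSpec e need v (compress need v) := by
  induction v generalizing need with
  | nil => exact ⟨rfl, trivial, List.nodup_nil, by simp [compress], by simp, by simp [compress, vals]⟩
  | cons x v ih => exact (ih hv.2 _).cons hv

theorem getD_zero (l : List ℕ) (d : ℕ) : l.getD 0 d = l.headD d := by cases l <;> rfl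

theorem compress_head {v : Code} (hv : Good n v) :
    (vals e (compress [0] v).1)[(compress [0] v).2.headD 0]? = some (den e v) := by
  obtain ⟨x, v, rfl⟩ := List.exists_cons_of_ne_nil hv.1
  have := (compress_spec (e := e) hv.2 [0]).map 0 (by simp) (by simp)
  rw [getD_zero] at this
  exact this

theorem norm_eq_cons (e : Fin n ≃ A) {v : Code} (hv : Good n v) : ∃ x w, norm v = x :: w := by
  refine List.exists_cons_of_ne_nil fun h => ?_
  have := (List.getElem?_eq_some_iff.1 (compress_head (e := e) hv)).1
  rw [length_vals] at this
  have := List.drop_eq_nil_iff.1 h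
  omega

theorem den_norm {v : Code} (hv : Good n v) : den e (norm v) = den e v := by
  rw [norm, den_drop, compress_head hv]
  rfl

theorem good_norm (e : Fin n ≃ A) {v : Code} (hv : Good n v) : Good n (norm v) := by
  obtain ⟨x, w, h⟩ := norm_eq_cons e hv
  exact ⟨by simp [h], (compress_spec (e := e) hv.2 [0]).wf.drop _⟩

theorem nodup_vals_norm {v : Code} (hv : Good n v) : (vals e (norm v)).Nodup := by
  rw [norm, vals_drop]
  exact (compress_spec hv.2 [0]).nodup.sublist (List.drop_sublist _ _)

theorem vals_norm {v : Code} (hv : Good n v) :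
    vals e (norm v) = den e v :: vals e (norm v).tail := by
  obtain ⟨x, w, h⟩ := norm_eq_cons e hv
  rw [← den_norm hv, h]
  rfl

theorem TC_den {v : Code} (hv : Good n v) :
    (den e v).TC = {x | x ∈ vals e (norm v).tail} := by
  have hn := nodup_vals_norm (e := e) hv
  rw [vals_norm hv] at hn
  ext x
  constructor
  · intro hx
    have key : ∀ x, Relation.TransGen (fun x y : HF A => x ∈ y.elems) x (den e v) →
        ∃ p, (vals e (norm v))[p + 1]? = some x := by
      intro x hx
      induction hx using Relation.TransGen.head_induction_on with
      | single h =>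
        obtain ⟨q, hq, h'⟩ := (good_norm e hv).2.mem_vals_of_mem_elems (p := 0)
          (by rw [vals_norm hv]; rfl) h
        exact ⟨q - 1, by rwa [Nat.sub_add_cancel hq]⟩
      | head h _ ih =>
        obtain ⟨p, hp⟩ := ih
        obtain ⟨q, hq, h'⟩ := (good_norm e hv).2.mem_vals_of_mem_elems hp h
        exact ⟨q - 1, by rwa [Nat.sub_add_cancel (by omega)]⟩
    obtain ⟨p, hp⟩ := key x hx
    rw [vals_norm hv, List.getElem?_cons_succ] at hp
    exact List.mem_of_getElem? hp
  · intro hx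
    have hx' : x ∈ vals e (compress [0] v).1 := by
      have : x ∈ vals e (norm v) := by rw [vals_norm hv]; exact List.mem_cons_of_mem _ hx
      rw [norm, vals_drop] at this
      exact List.mem_of_mem_drop this
    have := (compress_spec (e := e) hv.2 [0]).closed
      (fun x => Relation.ReflTransGen (fun x y : HF A => x ∈ y.elems) x (den e v))
      (fun x y hy hxy => .head hxy hy) (fun j hj y hy => ?_) x hx'
    · rcases Relation.reflTransGen_iff_eq_or_transGen.1 this with h | h
      · rw [← h] at hx
        exact absurd hx (List.nodup_cons.1 hn).1
      · exact h
    · obtain rfl : j = 0 := by simpa using hj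
      obtain ⟨z, v, rfl⟩ := List.exists_cons_of_ne_nil hv.1
      obtain rfl : den e (z :: v) = y := Option.some.inj hy
      exact .refl

theorem TC_encard {v : Code} (hv : Good n v) :
    (den e v).TC.encard = ((norm v).length - 1 : ℕ) := by
  classical
  have hn := nodup_vals_norm (e := e) hv
  rw [vals_norm hv] at hn
  have : (den e v).TC = ((vals e (norm v).tail).toFinset : Set (HF A)) := by
    rw [TC_den hv]; ext; simp
  rw [this, Set.encard_coe_eq_coe_finsetCard, List.toFinset_card_of_nodup (List.nodup_cons.1 hn).2,
    length_vals, List.length_tail]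

theorem elems_den {v : Code} (hv : WF n v) :
    (den e v).elems = ((elemsC v).map (den e)).toFinset := by
  cases v with
  | nil => simp [den, vals, elemsC, ← HF.ofFinset_empty, HF.elems_ofFinset]
  | cons x v =>
    ext u
    simp only [den, vals, List.headD_cons, mem_elems_entVal hv.1.1, elemsC, List.tail_cons,
      List.map_map, List.mem_toFinset, List.mem_map, Function.comp]
    refine exists_congr fun j => and_congr_right fun hj => ?_
    have : j < (vals e v).length := by rw [length_vals]; exact hv.1.2 j hj
    have hd : den e (v.drop j) = _ := den_drop v j
    rw [den] at hd
    rw [hd, List.getElem?_eq_getElem this]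
    simp

theorem mem_elems_den {v : Code} (hv : WF n v) {x : HF A} :
    x ∈ (den e v).elems ↔ ∃ w ∈ elemsC v, den e w = x := by
  simp [elems_den hv]

theorem good_of_mem_elemsC {v w : Code} (hv : WF n v) (hw : w ∈ elemsC v) : Good n w := by
  cases v with
  | nil => simp [elemsC] at hw
  | cons x v =>
    obtain ⟨j, hj, rfl⟩ := List.mem_map.1 hw
    refine ⟨fun h => ?_, hv.2.drop j⟩
    have := hv.1.2 j hj
    have := List.drop_eq_nil_iff.1 h
    simp at this
    omega

theorem cardC_eq (e : Fin n ≃ A) {v : Code} (hv : Good n v) :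
    cardC v = (den e v).elems.card := by
  have hg := good_norm e hv
  have hn := nodup_vals_norm (e := e) hv
  obtain ⟨x, w, h⟩ := norm_eq_cons e hv
  have hx : x.2.Nodup := (compress_spec (e := e) hv.2 [0]).nodup_snd x (by
    refine List.mem_of_mem_drop (i := (compress [0] v).2.headD 0) ?_
    rw [norm] at h
    rw [h]
    simp)
  rw [← den_norm hv, elems_den hg.2, List.toFinset_card_of_nodup]
  · simp [cardC, elemsC]
  · rw [h] at hg hn ⊢
    simp only [elemsC, List.headD_cons, List.tail_cons, List.map_map]
    refine List.Nodup.map_on (fun i hi j hj hij => ?_) hx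
    have hi' : i < (vals e w).length := by rw [length_vals]; exact hg.2.1.2 i hi
    have hj' : j < (vals e w).length := by rw [length_vals]; exact hg.2.1.2 j hj
    simp only [Function.comp, den_drop, List.getElem?_eq_getElem hi', List.getElem?_eq_getElem hj',
      Option.getD_some] at hij
    exact (List.Nodup.getElem_inj_iff (List.nodup_cons.1 hn).2).1 hij

theorem small_norm_iff {N : ℕ} {v : Code} (hv : Good n v) :
    small n N (norm v) = true ↔ (den e v).TC.encard ≤ N := by
  rw [TC_encard hv, Nat.cast_le]
  simp only [small, Bool.and_eq_true, decide_eq_true_eq, List.all_eq_true]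
  refine ⟨fun h => by omega, fun h => ⟨by omega, fun x hx => ?_⟩⟩
  obtain ⟨p, hp⟩ := List.mem_iff_getElem?.1 hx
  have hw := (good_norm e hv).2.entry hp
  refine ⟨?_, ?_, fun j hj => ?_⟩
  · cases h1 : x.1 with
    | none => rfl
    | some a => simpa using (hw.1 a h1).1
  · have hnd := (compress_spec (e := e) hv.2 [0]).nodup_snd x (List.mem_of_mem_drop hx)
    have := (List.subperm_of_subset (l₂ := List.range (N + 1)) hnd fun j hj =>
      List.mem_range.2 (by have := hw.2 j hj; omega)).length_le
    simpa using this
  · have := hw.2 j hj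
    omega

/-! ### Constructions of codes -/

theorem WF.append {v w : Code} (hv : WF n v) (hw : WF n w) : WF n (v ++ w) := by
  induction v with
  | nil => exact hw
  | cons x v ih =>
    exact ⟨⟨hv.1.1, fun j hj => (hv.1.2 j hj).trans_le (by simp)⟩, ih hv.2⟩

theorem vals_append {v : Code} (hv : WF n v) (w : Code) :
    vals e (v ++ w) = vals e v ++ vals e w := by
  induction v with
  | nil => rfl
  | cons x v ih =>
    simp only [List.cons_append, vals, ih hv.2, List.cons.injEq, and_true]
    refine entVal_congr rfl fun u => exists_congr fun j => and_congr_right fun hj => ?_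
    rw [List.getElem?_append_left]
    rw [length_vals]
    exact hv.1.2 j hj

theorem den_append {v : Code} (hv : Good n v) (w : Code) : den e (v ++ w) = den e v := by
  obtain ⟨x, v, rfl⟩ := List.exists_cons_of_ne_nil hv.1
  rw [den, vals_append hv.2]
  rfl

theorem WF.flatten {vs : List Code} (h : ∀ v ∈ vs, WF n v) : WF n vs.flatten := by
  induction vs with
  | nil => trivial
  | cons v vs ih =>
    rw [List.flatten_cons]
    exact (h v (by simp)).append (ih fun w hw => h w (by simp [hw]))

theorem drop_flatten_take {α : Type} (vs : List (List α)) (i : ℕ) :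
    vs.flatten.drop (vs.take i).flatten.length = (vs.drop i).flatten := by
  conv_lhs => rw [← List.take_append_drop i vs, List.flatten_append, List.drop_append]
  simp

theorem good_ofListC {vs : List Code} (h : ∀ v ∈ vs, Good n v) : Good n (ofListC vs) := by
  refine ⟨by simp [ofListC], ⟨⟨by simp, fun j hj => ?_⟩, WF.flatten fun v hv => (h v hv).2⟩⟩
  obtain ⟨i, hi, rfl⟩ := List.mem_map.1 hj
  rw [List.mem_range] at hi
  by_contra hlt
  have := List.drop_eq_nil_iff.2 (not_lt.1 hlt)
  rw [drop_flatten_take, List.drop_eq_getElem_cons hi, List.flatten_cons] at this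
  exact (h _ (List.getElem_mem hi)).1 (List.append_eq_nil_iff.1 this).1

theorem den_ofListC {vs : List Code} (h : ∀ v ∈ vs, Good n v) :
    den e (ofListC vs) = HF.ofFinset (vs.map (den e)).toFinset := by
  have hg := good_ofListC h
  have : den e (ofListC vs) = HF.ofFinset (den e (ofListC vs)).elems := by
    conv_rhs => rw [den, ofListC, vals, List.headD_cons, entVal_set, HF.elems_ofFinset]
    rfl
  rw [this, elems_den hg.2]
  congr 2
  refine List.ext_getElem (by simp [elemsC, ofListC]) fun i h1 h2 => ?_
  simp only [List.length_map] at h2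
  simp only [elemsC, ofListC, List.headD_cons, List.tail_cons, List.map_map, List.getElem_map,
    Function.comp, List.getElem_range, drop_flatten_take, List.drop_eq_getElem_cons h2,
    List.flatten_cons]
  exact den_append (h _ (List.getElem_mem h2)) _

theorem good_emptyC : Good n emptyC := ⟨by simp [emptyC], by simp [WF, emptyC]⟩

theorem den_emptyC : den e emptyC = ∅ := HF.ofFinset_empty

theorem good_atomC {a : ℕ} (h : a < n) : Good n (atomC a) := ⟨by simp [atomC], by simp [WF, atomC, h]⟩

theorem den_atomC {a : ℕ} (h : a < n) : den e (atomC a) = HF.atom (e ⟨a, h⟩) :=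
  entVal_atom (vs := []) (l := []) h

theorem eqC_iff (e : Fin n ≃ A) {v w : Code} (hv : Good n v) (hw : Good n w) :
    eqC v w = true ↔ den e v = den e w := by
  have h : ∀ u ∈ [v, w], Good n u := by simp [hv, hw]
  rw [eqC, beq_iff_eq, cardC_eq e (good_ofListC h), den_ofListC h, HF.elems_ofFinset,
    Finset.card_eq_one]
  simp only [List.map_cons, List.map_nil, List.toFinset_cons, List.toFinset_nil]
  constructor
  · rintro ⟨a, ha⟩
    have h1 : den e v ∈ ({a} : Finset (HF A)) := by rw [← ha]; simp
    have h2 : den e w ∈ ({a} : Finset (HF A)) := by rw [← ha]; simp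
    rw [Finset.mem_singleton] at h1 h2
    rw [h1, h2]
  · intro h
    exact ⟨den e w, by simp [h]⟩

end

end CPTWSC

namespace CPTWSC

open Enc (enc)

/-! ## Evaluation on codes -/

/-- The number of atoms, the bound, and the tuples in the relations. -/
abbrev Ctx : Type := ℕ × ℕ × List (List (List ℕ))

/-- An assignment, as a list of the values of variables. -/
abbrev Asg : Type := List (ℕ × Code)

/-- The value of a variable. -/
def lookup (ρ : Asg) (v : ℕ) : Code := (ρ.find? fun q => q.1 == v).elim emptyC fun q => q.2

/-- The set of all atoms. -/
def atomsC (n : ℕ) : Code := ofListC ((List.range n).map atomC)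

/-- The union. -/
def unionC (v : Code) : Code := ofListC ((elemsC v).flatMap elemsC)

/-- The unique element. -/
def uniqueC (v : Code) : Code := bif cardC v == 1 then (elemsC v).headD emptyC else emptyC

/-- Von Neumann ordinals. -/
def ofNatC (k : ℕ) : Code := (List.range (k + 1)).reverse.map fun i => (none, List.range i)

/-- Comprehension. -/
def comprC (m : Code) (s : Code → Option Code) (Φ : Code → Option Bool) : Option Code :=
  (fun l : List (Option (Option Code)) => bif l.all fun o => o.isSome then
    some (ofListC (l.filterMap fun o => o.getD none)) else none)
  ((elemsC m).map fun b => (Φ b).elim none fun c => bif c then (s b).map some else some none)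

/-- One step of an iteration; the first component of the state is the result if it is known
already. -/
def iterStep (n N : ℕ) (F : Code → Option Code) (s : Option (Option Code) × Code) :
    Option (Option Code) × Code :=
  s.1.elim
    ((F s.2).elim (some none, emptyC) fun a => bif eqC a s.2 then (some (some s.2), emptyC)
      else bif small n N (norm a) then (none, norm a) else (some (some emptyC), emptyC))
    fun _ => s

/-- Iteration. -/
def iterC (n N : ℕ) (F : Code → Option Code) : Option Code :=
  ((iterStep n N F)^[N + 1] (none, emptyC)).1.getD (some emptyC)

/-- Membership of a tuple in a relation. -/
def relC (R : List (List ℕ)) (vs : List (Option Code)) : Option Bool :=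
  bif vs.all fun o => o.isSome then
    some ((vs.all fun o => ((o.getD emptyC).headD (none, [])).1.isSome) &&
      R.contains (vs.filterMap fun o => ((o.getD emptyC).headD (none, [])).1))
  else none

/-- Kuratowski pairs. -/
def kpairC (a b : Code) : Code := ofListC [ofListC [a, a], ofListC [a, b]]

/-- The graph of a map of the atoms given by the list of its values. -/
def graphC (n : ℕ) (π : List ℕ) : Code :=
  ofListC ((List.range n).map fun i => kpairC (atomC i) (atomC (π.getD i 0)))

/-- The map with a given graph. -/
def ungraph (n : ℕ) (m : Code) : List ℕ :=
  (List.range n).map fun i => ((List.range n).find? fun j =>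
    (elemsC m).any fun q => eqC q (kpairC (atomC i) (atomC j))).getD 0

/-- The action of a map of the atoms. -/
def mapC (π : List ℕ) (v : Code) : Code := v.map fun x => (x.1.map fun a => π.getD a 0, x.2)

/-- `π` is an automorphism. -/
def autC (ar : List ℕ) (n : ℕ) (rels : List (List (List ℕ))) (π : List ℕ) : Bool :=
  ((List.range n).all fun j => π.contains j) &&
  (List.range ar.length).all fun i => (rels.getD i []).all fun t =>
    !(t.length == ar.getD i 0 && t.all fun a => decide (a < n)) ||
      (rels.getD i []).contains (t.map fun a => π.getD a 0)

/-- `M` witnesses that `Q` is an orbit of the group of automorphisms that fix the sets `fix`. -/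
def witnessesC (ar : List ℕ) (n : ℕ) (rels : List (List (List ℕ))) (fix : List Code) (M Q : Code) :
    Bool :=
  ((elemsC M).all fun m => eqC m (graphC n (ungraph n m)) && (autC ar n rels (ungraph n m) &&
    fix.all fun v => eqC (mapC (ungraph n m) v) v)) &&
  (elemsC Q).all fun b => (elemsC Q).all fun c => (elemsC M).any fun m =>
    eqC (mapC (ungraph n m) b) c

/-- One step of a run; the state tells whether a fixed point is reached and what the run is. -/
def runStep (n N : ℕ) (step : Code → Code → Option Code) (choice : Code → Option Code)
    (s : Option (Bool × List Code)) : Option (Bool × List Code) :=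
  s.bind fun q => bif q.1 then some q else
    (choice (q.2.headD emptyC)).bind fun m =>
      (step (q.2.headD emptyC) ((elemsC m).headD emptyC)).bind fun b =>
        bif small n N (norm b) then some (eqC b (q.2.headD emptyC), norm b :: q.2) else none

/-- A path that is not too long. -/
def pathC (n N : ℕ) (step : Code → Code → Option Code) (choice : Code → Option Code) :
    Option (List Code) :=
  ((runStep n N step choice)^[N] (some (false, [emptyC]))).bind fun q =>
    bif q.1 && decide (q.2.length ≤ N) then some q.2 else none

/-- A path is witnessed. -/
def witnessesPathC (ar : List ℕ) (n : ℕ) (rels : List (List (List ℕ))) (fix : List Code)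
    (choice : Code → Option Code) (wit : Code → Code → Option Code) (l : List Code) : Bool :=
  (List.range l.tail.length).all fun k =>
    (wit (l.headD emptyC) ((l.tail.drop k).headD emptyC)).elim false fun M =>
      (choice ((l.tail.drop k).headD emptyC)).elim false fun Q =>
        witnessesC ar n rels (fix ++ l.tail.drop k) M Q

/-- The fixed-point operator. -/
def wscC (ar : List ℕ) (n N : ℕ) (rels : List (List (List ℕ))) (fix : List Code)
    (step : Code → Code → Option Code) (choice : Code → Option Code)
    (wit : Code → Code → Option Code) (out : Code → Option Bool) : Option Bool :=
  (pathC n N step choice).bind fun l => bif witnessesPathC ar n rels fix choice wit l then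
    out (l.headD emptyC) else none

section

variable {ℓ : ℕ} {ar : Fin ℓ → ℕ}

mutual

/-- Evaluation of terms on codes. -/
noncomputable def Term.code (c : Ctx) : Term ar → Asg → Option Code
  | .var v, ρ => some (lookup ρ v)
  | .empty, _ => some emptyC
  | .atoms, _ => some (atomsC c.1)
  | .pair s t, ρ => (s.code c ρ).bind fun a => (t.code c ρ).map fun b => ofListC [a, b]
  | .union s, ρ => (s.code c ρ).map unionC
  | .unique s, ρ => (s.code c ρ).map uniqueC
  | .card s, ρ => (s.code c ρ).map fun a => ofNatC (cardC a)
  | .compr s y t Φ, ρ => (t.code c ρ).bind fun m =>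
      comprC m (fun b => s.code c ((y, b) :: ρ)) fun b => Φ.code c ((y, b) :: ρ)
  | .iter s y, ρ => iterC c.1 c.2.1 fun b => s.code c ((y, b) :: ρ)

/-- Evaluation of formulas on codes. -/
noncomputable def Formula.code (c : Ctx) : Formula ar → Asg → Option Bool
  | .rel i t, ρ => relC (c.2.2.getD i []) (List.ofFn fun j => (t j).code c ρ)
  | .eq s t, ρ => (s.code c ρ).bind fun a => (t.code c ρ).map fun b => eqC a b
  | .not Φ, ρ => (Φ.code c ρ).map fun a => !a
  | .and Φ Ψ, ρ => (Φ.code c ρ).bind fun a => (Ψ.code c ρ).map fun b => a && b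
  | .or Φ Ψ, ρ => (Φ.code c ρ).bind fun a => (Ψ.code c ρ).map fun b => a || b
  | .wsc x y step choice wit out, ρ =>
      wscC (List.ofFn ar) c.1 c.2.1 c.2.2
        ((Formula.wsc x y step choice wit out).freeVars.toList.map fun v => lookup ρ v)
        (fun b d => step.code c ((y, d) :: (x, b) :: ρ)) (fun b => choice.code c ((x, b) :: ρ))
        (fun b d => wit.code c ((y, d) :: (x, b) :: ρ)) (fun b => out.code c ((x, b) :: ρ))

end

end

/-! ### Running times -/

section

variable {ε α : Type} [Enc ε] [Enc α]

@[fun_prop]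
theorem PT.lookup {f : ε → Asg} {g : ε → ℕ} (hf : PT f) (hg : PT g) :
    PT fun e => lookup (f e) (g e) := by
  unfold CPTWSC.lookup
  fun_prop

@[fun_prop]
theorem PT.atomsC {f : ε → ℕ} (hf : PT f) : PT fun e => atomsC (f e) := by
  unfold CPTWSC.atomsC
  fun_prop

@[fun_prop]
theorem PT.unionC {f : ε → Code} (hf : PT f) : PT fun e => unionC (f e) := by
  unfold CPTWSC.unionC
  fun_prop

@[fun_prop]
theorem PT.uniqueC {f : ε → Code} (hf : PT f) : PT fun e => uniqueC (f e) := by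
  unfold CPTWSC.uniqueC
  fun_prop

@[fun_prop]
theorem PT.ofNatC {f : ε → ℕ} (hf : PT f) : PT fun e => ofNatC (f e) := by
  unfold CPTWSC.ofNatC
  fun_prop

@[fun_prop]
theorem PT.comprC {m : ε → Code} {s : ε → Code → Option Code} {Φ : ε → Code → Option Bool}
    (hm : PT m) (hs : PT fun p : ε × Code => s p.1 p.2) (hΦ : PT fun p : ε × Code => Φ p.1 p.2) :
    PT fun e => comprC (m e) (s e) (Φ e) := by
  unfold CPTWSC.comprC
  fun_prop

theorem small_emptyC (n N : ℕ) : small n N emptyC = true := by simp [small, emptyC]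

theorem small_iterStep {n N : ℕ} {F : Code → Option Code} (i : ℕ) :
    (∀ o ∈ ((iterStep n N F)^[i] (none, emptyC)).1, ∀ v ∈ o, small n N v = true) ∧
      small n N ((iterStep n N F)^[i] (none, emptyC)).2 = true := by
  induction i with
  | zero => simp [small_emptyC]
  | succ i ih =>
    rw [Function.iterate_succ_apply']
    generalize (iterStep n N F)^[i] (none, emptyC) = s at *
    obtain ⟨_ | o, v⟩ := s
    · simp only [iterStep, Option.elim_none]
      cases F v with
      | none => simp [small_emptyC]
      | some a =>
        simp only [Option.elim_some]
        cases eqC a v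
        · cases h : small n N (norm a) <;> simp [small_emptyC, h]
        · simpa [small_emptyC] using ih.2
    · exact ih

@[fun_prop]
theorem PT.iterC {n N : ε → ℕ} {F : ε → Code → Option Code} (hn : PT n) (hN : PT N)
    (hF : PT fun p : ε × Code => F p.1 p.2) : PT fun e => iterC (n e) (N e) (F e) := by
  unfold CPTWSC.iterC
  have hF' : PT fun p : ε × Option (Option Code) × Code => F p.1 p.2.2 :=
    hF.comp (g := fun p : ε × Option (Option Code) × Code => (p.1, p.2.2)) (by fun_prop)
  have hS : PT fun p : ε × Option (Option Code) × Code => iterStep (n p.1) (N p.1) (F p.1) p.2 := by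
    unfold iterStep
    fun_prop
  have hb : PB fun e => smallBound (n e) (N e) :=
    .smallBound (hn.pb.of_le fun e => by simp; omega) (hN.pb.of_le fun e => by simp; omega)
  have : PT fun e => (iterStep (n e) (N e) (F e))^[N e + 1] (none, emptyC) := by
    refine .iterate hS (by fun_prop) (.const _) (((PB.const 2).mul hb).add (.const 6))
      fun e i _ => ?_
    have h := small_iterStep (n := n e) (N := N e) (F := F e) i
    generalize (iterStep (n e) (N e) (F e))^[i] (none, emptyC) = s at *
    have h2 := esize_le_of_small h.2
    rw [esize_pair]
    rcases hs : s.1 with _ | _ | v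
    · simp; omega
    · simp; omega
    · have := esize_le_of_small (h.1 _ hs v rfl)
      simp; omega
  fun_prop

@[fun_prop]
theorem PT.relC {R : ε → List (List ℕ)} {vs : ε → List (Option Code)} (hR : PT R) (hvs : PT vs) :
    PT fun e => relC (R e) (vs e) := by
  unfold CPTWSC.relC
  fun_prop

@[fun_prop]
theorem PT.kpairC {f g : ε → Code} (hf : PT f) (hg : PT g) : PT fun e => kpairC (f e) (g e) := by
  unfold CPTWSC.kpairC
  fun_prop

@[fun_prop]
theorem PT.graphC {n : ε → ℕ} {π : ε → List ℕ} (hn : PT n) (hπ : PT π) :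
    PT fun e => graphC (n e) (π e) := by
  unfold CPTWSC.graphC
  fun_prop

@[fun_prop]
theorem PT.ungraph {n : ε → ℕ} {m : ε → Code} (hn : PT n) (hm : PT m) :
    PT fun e => ungraph (n e) (m e) := by
  unfold CPTWSC.ungraph
  fun_prop

@[fun_prop]
theorem PT.mapC {π : ε → List ℕ} {v : ε → Code} (hπ : PT π) (hv : PT v) :
    PT fun e => mapC (π e) (v e) := by
  unfold CPTWSC.mapC
  fun_prop

@[fun_prop]
theorem PT.autC {ar : ε → List ℕ} {n : ε → ℕ} {rels : ε → List (List (List ℕ))} {π : ε → List ℕ}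
    (har : PT ar) (hn : PT n) (hr : PT rels) (hπ : PT π) :
    PT fun e => autC (ar e) (n e) (rels e) (π e) := by
  unfold CPTWSC.autC
  fun_prop

@[fun_prop]
theorem PT.witnessesC {ar : ε → List ℕ} {n : ε → ℕ} {rels : ε → List (List (List ℕ))}
    {fix : ε → List Code} {M Q : ε → Code} (har : PT ar) (hn : PT n) (hr : PT rels)
    (hf : PT fix) (hM : PT M) (hQ : PT Q) :
    PT fun e => witnessesC (ar e) (n e) (rels e) (fix e) (M e) (Q e) := by
  unfold CPTWSC.witnessesC
  fun_prop

theorem small_runStep {n N : ℕ} {step : Code → Code → Option Code} {choice : Code → Option Code}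
    (i : ℕ) : ∀ q ∈ (runStep n N step choice)^[i] (some (false, [emptyC])),
      q.2.length ≤ i + 1 ∧ ∀ v ∈ q.2, small n N v = true := by
  induction i with
  | zero => simp [small_emptyC]
  | succ i ih =>
    rw [Function.iterate_succ_apply']
    generalize (runStep n N step choice)^[i] (some (false, [emptyC])) = s at *
    rintro q' hq'
    rcases s with _ | ⟨d, l⟩
    · simp [runStep] at hq'
    · have := ih _ rfl
      cases d
      · simp only [runStep, Option.bind_some, cond_false, Option.mem_def,
          Option.bind_eq_some_iff] at hq'
        obtain ⟨m, -, b, -, hq'⟩ := hq'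
        cases hb : small n N (norm b)
        · simp [hb] at hq'
        · simp only [hb, cond_true, Option.some.injEq] at hq'
          subst hq'
          simpa [hb] using this
      · simp only [runStep, Option.bind_some, cond_true, Option.mem_def, Option.some.injEq] at hq'
        subst hq'
        exact ⟨this.1.trans (by simp), this.2⟩

@[fun_prop]
theorem PT.pathC {n N : ε → ℕ} {step : ε → Code → Code → Option Code}
    {choice : ε → Code → Option Code} (hn : PT n) (hN : PT N)
    (hs : PT fun p : ε × Code × Code => step p.1 p.2.1 p.2.2)
    (hc : PT fun p : ε × Code => choice p.1 p.2) :
    PT fun e => pathC (n e) (N e) (step e) (choice e) := by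
  unfold CPTWSC.pathC
  have hs' {δ : Type} [Enc δ] {f : δ → ε} {g g' : δ → Code} (hf : PT f) (hg : PT g) (hg' : PT g') :
      PT fun d => step (f d) (g d) (g' d) :=
    hs.comp (g := fun d => (f d, g d, g' d)) (by fun_prop)
  have hc' {δ : Type} [Enc δ] {f : δ → ε} {g : δ → Code} (hf : PT f) (hg : PT g) :
      PT fun d => choice (f d) (g d) :=
    hc.comp (g := fun d => (f d, g d)) (by fun_prop)
  have hS : PT fun p : ε × Option (Bool × List Code) =>
      runStep (n p.1) (N p.1) (step p.1) (choice p.1) p.2 := by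
    unfold runStep
    refine .option_bind (by fun_prop) (.cond (by fun_prop) (by fun_prop) ?_)
    refine .option_bind (hc' (by fun_prop) (by fun_prop)) (.option_bind ?_ (by fun_prop))
    exact hs' (by fun_prop) (by fun_prop) (by fun_prop)
  have hN' : PB N := hN.pb.of_le fun e => by simp; omega
  have hb : PB fun e => smallBound (n e) (N e) :=
    .smallBound (hn.pb.of_le fun e => by simp; omega) hN'
  have : PT fun e => (runStep (n e) (N e) (step e) (choice e))^[N e] (Option.some (false, [emptyC])) := by
    refine .iterate hS (by fun_prop) (.const _)
      (((hN'.add (.const 1)).mul (hb.add (.const 1))).add (.const 10)) fun e i hi => ?_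
    have h := small_runStep (n := n e) (N := N e) (step := step e) (choice := choice e) i
    generalize (runStep (n e) (N e) (step e) (choice e))^[i] (Option.some (false, [emptyC])) = s at *
    rcases s with _ | ⟨d, l⟩
    · simp
    · obtain ⟨h1, h2⟩ := h _ rfl
      have h3 : esize l ≤ l.length * (smallBound (n e) (N e) + 1) + 1 :=
        esize_list_le fun v hv => esize_le_of_small (h2 v hv)
      have h4 := esize_bool d
      have h5 : l.length * (smallBound (n e) (N e) + 1) ≤
          (N e + 1) * (smallBound (n e) (N e) + 1) := by gcongr; exact h1.trans (by omega)
      rw [esize_some, esize_pair]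
      omega
  exact .option_bind this (by fun_prop)

@[fun_prop]
theorem PT.witnessesPathC {ar : ε → List ℕ} {n : ε → ℕ} {rels : ε → List (List (List ℕ))}
    {fix : ε → List Code} {choice : ε → Code → Option Code} {wit : ε → Code → Code → Option Code}
    {l : ε → List Code} (har : PT ar) (hn : PT n) (hr : PT rels) (hf : PT fix)
    (hc : PT fun p : ε × Code => choice p.1 p.2)
    (hw : PT fun p : ε × Code × Code => wit p.1 p.2.1 p.2.2) (hl : PT l) :
    PT fun e => witnessesPathC (ar e) (n e) (rels e) (fix e) (choice e) (wit e) (l e) := by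
  unfold CPTWSC.witnessesPathC
  have hw' {δ : Type} [Enc δ] {f : δ → ε} {g g' : δ → Code} (hf : PT f) (hg : PT g) (hg' : PT g') :
      PT fun d => wit (f d) (g d) (g' d) :=
    hw.comp (g := fun d => (f d, g d, g' d)) (by fun_prop)
  have hc' {δ : Type} [Enc δ] {f : δ → ε} {g : δ → Code} (hf : PT f) (hg : PT g) :
      PT fun d => choice (f d) (g d) :=
    hc.comp (g := fun d => (f d, g d)) (by fun_prop)
  refine .all (.elim (hw' (by fun_prop) (by fun_prop) (by fun_prop)) (by fun_prop) ?_) (by fun_prop)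
  exact .elim (hc' (by fun_prop) (by fun_prop)) (by fun_prop) (by fun_prop)

theorem PT.wscC {ar : List ℕ} {n N : ε → ℕ} {rels : ε → List (List (List ℕ))}
    {fix : ε → List Code} {step : ε → Code → Code → Option Code} {choice : ε → Code → Option Code}
    {wit : ε → Code → Code → Option Code} {out : ε → Code → Option Bool} (hn : PT n) (hN : PT N)
    (hr : PT rels) (hf : PT fix) (hs : PT fun p : ε × Code × Code => step p.1 p.2.1 p.2.2)
    (hc : PT fun p : ε × Code => choice p.1 p.2)
    (hw : PT fun p : ε × Code × Code => wit p.1 p.2.1 p.2.2)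
    (ho : PT fun p : ε × Code => out p.1 p.2) :
    PT fun e => wscC ar (n e) (N e) (rels e) (fix e) (step e) (choice e) (wit e) (out e) := by
  unfold CPTWSC.wscC
  refine .option_bind (.pathC hn hN hs hc) (.cond ?_ ?_ (.const none))
  · refine .witnessesPathC (.const _) (by fun_prop) (by fun_prop) (by fun_prop) ?_ ?_ (by fun_prop)
    · exact hc.comp (g := fun p : (ε × List Code) × Code => (p.1.1, p.2)) (by fun_prop)
    · exact hw.comp (g := fun p : (ε × List Code) × Code × Code => (p.1.1, p.2)) (by fun_prop)
  · exact ho.comp (g := fun p : ε × List Code => (p.1, p.2.headD emptyC)) (by fun_prop)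

theorem PT.ofFn {k : ℕ} {f : Fin k → ε → α} (hf : ∀ j, PT (f j)) :
    PT fun e => List.ofFn fun j => f j e := by
  induction k with
  | zero => simpa using .const _
  | succ k ih =>
    simp only [List.ofFn_succ]
    exact .list_cons (hf 0) (ih fun j => hf j.succ)

variable {ℓ : ℕ} {ar : Fin ℓ → ℕ}

mutual

theorem Term.pt : ∀ s : Term ar, PT fun p : Ctx × Asg => s.code p.1 p.2
  | .var v => by unfold Term.code; fun_prop
  | .empty => by unfold Term.code; fun_prop
  | .atoms => by unfold Term.code; fun_prop
  | .pair s t => by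
    have hs := s.pt
    have ht := t.pt.comp (g := fun p : (Ctx × Asg) × Code => p.1) (by fun_prop)
    unfold Term.code; fun_prop
  | .union s => by have hs := s.pt; unfold Term.code; fun_prop
  | .unique s => by have hs := s.pt; unfold Term.code; fun_prop
  | .card s => by have hs := s.pt; unfold Term.code; fun_prop
  | .compr s y t Φ => by
    have hs := s.pt.comp (g := fun p : ((Ctx × Asg) × Code) × Code =>
      (p.1.1.1, (y, p.2) :: p.1.1.2)) (by fun_prop)
    have hΦ := Φ.pt.comp (g := fun p : ((Ctx × Asg) × Code) × Code =>
      (p.1.1.1, (y, p.2) :: p.1.1.2)) (by fun_prop)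
    unfold Term.code
    exact .option_bind t.pt (.comprC (by fun_prop) hs hΦ)
  | .iter s y => by
    have hs := s.pt.comp (g := fun p : (Ctx × Asg) × Code =>
      (p.1.1, (y, p.2) :: p.1.2)) (by fun_prop)
    unfold Term.code
    exact .iterC (by fun_prop) (by fun_prop) hs

theorem Formula.pt : ∀ Φ : Formula ar, PT fun p : Ctx × Asg => Φ.code p.1 p.2
  | .rel i t => by
    have ht := PT.ofFn fun j => (t j).pt
    unfold Formula.code
    exact .relC (by fun_prop) ht
  | .eq s t => by
    have hs := s.pt
    have ht := t.pt.comp (g := fun p : (Ctx × Asg) × Code => p.1) (by fun_prop)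
    unfold Formula.code; fun_prop
  | .not Φ => by have hs := Φ.pt; unfold Formula.code; fun_prop
  | .and Φ Ψ => by
    have hs := Φ.pt
    have ht := Ψ.pt.comp (g := fun p : (Ctx × Asg) × Bool => p.1) (by fun_prop)
    unfold Formula.code; fun_prop
  | .or Φ Ψ => by
    have hs := Φ.pt
    have ht := Ψ.pt.comp (g := fun p : (Ctx × Asg) × Bool => p.1) (by fun_prop)
    unfold Formula.code; fun_prop
  | .wsc x y step choice wit out => by
    have hs := step.pt.comp (g := fun p : (Ctx × Asg) × Code × Code =>
      (p.1.1, (y, p.2.2) :: (x, p.2.1) :: p.1.2)) (by fun_prop)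
    have hc := choice.pt.comp (g := fun p : (Ctx × Asg) × Code =>
      (p.1.1, (x, p.2) :: p.1.2)) (by fun_prop)
    have hw := wit.pt.comp (g := fun p : (Ctx × Asg) × Code × Code =>
      (p.1.1, (y, p.2.2) :: (x, p.2.1) :: p.1.2)) (by fun_prop)
    have ho := out.pt.comp (g := fun p : (Ctx × Asg) × Code =>
      (p.1.1, (x, p.2) :: p.1.2)) (by fun_prop)
    unfold Formula.code
    exact .wscC (by fun_prop) (by fun_prop) (by fun_prop) (by fun_prop) hs hc hw ho

end

end

end CPTWSC

namespace CPTWSC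

open Equiv (Perm)

/-! ## Invariance under automorphisms -/

section

variable {A : Type}

theorem mapPre_id {b : Bool} (l : Lists' A b) : mapPre id l = l := by
  induction l with
  | atom a => rfl
  | nil => rfl
  | cons' x l ih1 ih2 => simp only [mapPre, ih1, ih2]

theorem mapPre_mapPre {B C : Type} (f : B → C) (g : A → B) {b : Bool} (l : Lists' A b) :
    mapPre f (mapPre g l) = mapPre (f ∘ g) l := by
  induction l with
  | atom a => rfl
  | nil => rfl
  | cons' x l ih1 ih2 => simp only [mapPre, ih1, ih2]

namespace HF

theorem map_id (x : HF A) : map id x = x := by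
  obtain ⟨l, rfl⟩ : ∃ l, mk l = x := ⟨_, mk_out x⟩
  change mk (mapLists id l) = mk l
  rw [mapLists, mapPre_id]
  rfl

theorem map_map {B C : Type} (f : B → C) (g : A → B) (x : HF A) :
    map f (map g x) = map (f ∘ g) x := by
  obtain ⟨l, rfl⟩ : ∃ l, mk l = x := ⟨_, mk_out x⟩
  change mk (mapLists f (mapLists g l)) = mk (mapLists (f ∘ g) l)
  rw [mapLists, mapLists, mapLists, mapPre_mapPre]

theorem map_mul (φ ψ : Perm A) (x : HF A) : map (φ * ψ : Perm A) x = map φ (map ψ x) :=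
  (map_map φ ψ x).symm

theorem map_one (x : HF A) : map (1 : Perm A) x = x := map_id x

@[simp] theorem map_inv_map (φ : Perm A) (x : HF A) : map (φ⁻¹ : Perm A) (map φ x) = x := by
  rw [← map_mul, inv_mul_cancel, map_one]

@[simp] theorem map_map_inv (φ : Perm A) (x : HF A) : map φ (map (φ⁻¹ : Perm A) x) = x := by
  rw [← map_mul, mul_inv_cancel, map_one]

@[simp] theorem map_symm_map (φ : Perm A) (x : HF A) : map φ.symm (map φ x) = x := map_inv_map φ x

@[simp] theorem map_map_symm (φ : Perm A) (x : HF A) : map φ (map φ.symm x) = x := map_map_inv φ x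

theorem map_injective (φ : Perm A) : Function.Injective (map φ) :=
  Function.LeftInverse.injective (map_inv_map φ)

theorem map_empty {B : Type} (f : A → B) : map f ∅ = ∅ := by
  rw [← ofFinset_empty, map_ofFinset, Finset.image_empty, ofFinset_empty]

theorem elems_empty : (∅ : HF A).elems = ∅ := by rw [← ofFinset_empty, elems_ofFinset]

theorem mem_elems_map (φ : Perm A) {x y : HF A} : map φ x ∈ (map φ y).elems ↔ x ∈ y.elems := by
  rw [elems_map, (map_injective φ).mem_finset_image]

theorem map_pair (φ : Perm A) (x y : HF A) : map φ (pair x y) = pair (map φ x) (map φ y) := by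
  rw [pair, map_ofFinset, Finset.image_insert, Finset.image_singleton, pair]

theorem map_union (φ : Perm A) (x : HF A) : map φ (union x) = union (map φ x) := by
  rw [union, map_ofFinset, union, elems_map, Finset.image_biUnion, Finset.biUnion_image]
  simp only [elems_map]

theorem unique_eq {x y : HF A} (h : x.elems = {y}) : unique x = y := by
  have h' : ∃ b, x.elems = {b} := ⟨y, h⟩
  rw [unique, dif_pos h']
  exact Finset.singleton_injective (h'.choose_spec.symm.trans h)

theorem unique_eq_empty {x : HF A} (h : x.elems.card ≠ 1) : unique x = ∅ :=
  dif_neg fun h' => h (Finset.card_eq_one.2 h')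

theorem card_elems_map (φ : Perm A) (x : HF A) : (map φ x).elems.card = x.elems.card := by
  rw [elems_map, Finset.card_image_of_injective _ (map_injective φ)]

theorem map_unique (φ : Perm A) (x : HF A) : map φ (unique x) = unique (map φ x) := by
  by_cases h : x.elems.card = 1
  · obtain ⟨y, hy⟩ := Finset.card_eq_one.1 h
    rw [unique_eq hy, unique_eq (y := map φ y) (by rw [elems_map, hy, Finset.image_singleton])]
  · rw [unique_eq_empty h, unique_eq_empty (by rwa [card_elems_map]), map_empty]

theorem map_ofNat (φ : Perm A) (k : ℕ) : map φ (ofNat k) = ofNat k := by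
  induction k with
  | zero => exact map_empty φ
  | succ k ih => rw [ofNat, map_ofFinset, Finset.image_insert, ← elems_map, ih]

theorem map_card (φ : Perm A) (x : HF A) : map φ (card x) = card (map φ x) := by
  rw [card, map_ofNat, card, card_elems_map]

theorem encard_TC_map (φ : Perm A) (x : HF A) : (map φ x).TC.encard = x.TC.encard := by
  have h : ∀ (φ : Perm A) (x y : HF A), y ∈ x.TC → map φ y ∈ (map φ x).TC := fun φ x y h =>
    Relation.TransGen.lift (map φ) (fun _ _ => (mem_elems_map φ).2) _ _ h
  have : (map φ x).TC = map φ '' x.TC := by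
    ext y
    constructor
    · exact fun hy => ⟨_, by simpa using h φ⁻¹ _ _ hy, map_map_inv φ y⟩
    · rintro ⟨y, hy, rfl⟩
      exact h φ x y hy
  rw [this, (map_injective φ).encard_image]

theorem map_kpair (φ : Perm A) (x y : HF A) : map φ (kpair x y) = kpair (map φ x) (map φ y) := by
  simp only [kpair, map_pair]

theorem pair_eq_pair {a b c d : HF A} (h : pair a b = pair c d) :
    ({a, b} : Finset (HF A)) = {c, d} := by
  simpa [pair, elems_ofFinset] using congrArg elems h

theorem kpair_inj {a b c d : HF A} (h : kpair a b = kpair c d) : a = c ∧ b = d := by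
  have h1 : ∀ {a b c d : HF A}, pair a b = pair c d → (a = c ∧ b = d) ∨ (a = d ∧ b = c) := by
    intro a b c d h
    have h := pair_eq_pair h
    rw [← Finset.coe_inj] at h
    simpa [Set.pair_eq_pair_iff] using h
  rcases h1 h with ⟨h, h'⟩ | ⟨h, h'⟩ <;> rcases h1 h with ⟨h2, h3⟩ | ⟨h2, h3⟩ <;>
    rcases h1 h' with ⟨h4, h5⟩ | ⟨h4, h5⟩ <;> constructor <;> simp_all

variable [Fintype A]

theorem map_atoms (φ : Perm A) : map φ (atoms : HF A) = atoms := by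
  rw [atoms, map_ofFinset, Finset.image_image]
  congr 1
  ext x
  simp only [Finset.mem_image, Finset.mem_univ, true_and, Function.comp, map_atom]
  exact φ.exists_congr_left.trans (by simp)

theorem map_graph (σ φ : Perm A) : map σ (graph φ) = graph (σ * φ * σ⁻¹) := by
  rw [graph, map_ofFinset, Finset.image_image, graph]
  congr 1
  ext x
  simp only [Finset.mem_image, Finset.mem_univ, true_and, Function.comp, map_kpair, map_atom]
  exact σ.exists_congr_left.trans (by simp [Equiv.Perm.inv_def])

end HF

/-! ### Operators -/

theorem comprOp_map (φ : Perm A) {m : HF A} {s s' : HF A → Option (HF A)} {Φ Φ' : HF A → Option Bool}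
    (hs : ∀ b, s' (b.map φ) = (s b).map (HF.map φ)) (hΦ : ∀ b, Φ' (b.map φ) = Φ b) :
    comprOp (m.map φ) s' Φ' = (comprOp m s Φ).map (HF.map φ) := by
  have h : (∃ b ∈ (m.map φ).elems, Φ' b = none ∨ (Φ' b = some true ∧ s' b = none)) ↔
      ∃ b ∈ m.elems, Φ b = none ∨ (Φ b = some true ∧ s b = none) := by
    simp [HF.elems_map, hs, hΦ]
  unfold comprOp
  by_cases h' : ∃ b ∈ m.elems, Φ b = none ∨ (Φ b = some true ∧ s b = none)
  · rw [if_pos h', if_pos (h.2 h')]; rfl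
  · rw [if_neg h', if_neg (mt h.1 h'), Option.map_some, HF.map_ofFinset]
    congr 2
    ext x
    simp only [Finset.mem_eraseNone, Finset.mem_image, Finset.mem_filter, HF.elems_map]
    constructor
    · rintro ⟨_, ⟨⟨b, hb, rfl⟩, hb'⟩, hx⟩
      rw [hs, Option.map_eq_some_iff] at hx
      obtain ⟨y, hy, rfl⟩ := hx
      exact ⟨y, ⟨b, ⟨hb, by rwa [hΦ] at hb'⟩, hy⟩, rfl⟩
    · rintro ⟨y, ⟨b, ⟨hb, hb'⟩, hy⟩, rfl⟩
      exact ⟨_, ⟨⟨b, hb, rfl⟩, by rwa [hΦ]⟩, by rw [hs, hy]; rfl⟩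

theorem iterFrom_map (φ : Perm A) {N : ℕ} {F F' : HF A → Option (HF A)}
    (hF : ∀ b, F' (b.map φ) = (F b).map (HF.map φ)) (k : ℕ) (a : HF A) :
    iterFrom N F' k (a.map φ) = (iterFrom N F k a).map (HF.map φ) := by
  induction k generalizing a with
  | zero =>
    unfold iterFrom
    rw [HF.encard_TC_map, hF]
    split_ifs
    · simp [HF.map_empty]
    · cases F a with
      | none => rfl
      | some b =>
        simp only [Option.map_some, (HF.map_injective φ).eq_iff]
        split_ifs <;> simp [HF.map_empty]
  | succ k ih =>
    unfold iterFrom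
    rw [HF.encard_TC_map, hF]
    split_ifs
    · simp [HF.map_empty]
    · cases F a with
      | none => rfl
      | some b =>
        simp only [Option.map_some, (HF.map_injective φ).eq_iff]
        split_ifs
        · rfl
        · exact ih b

theorem relOp_map (φ : Perm A) {r : ℕ} {R : Set (Fin r → A)}
    (hR : ∀ t, (fun j => φ (t j)) ∈ R ↔ t ∈ R) (v : Fin r → Option (HF A)) :
    relOp R (fun j => (v j).map (HF.map φ)) = relOp R v := by
  have h : (∃ c ∈ R, ∀ j, (v j).map (HF.map φ) = some (HF.atom (c j))) ↔
      ∃ c ∈ R, ∀ j, v j = some (HF.atom (c j)) := by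
    have hat : ∀ (o : Option (HF A)) (a : A),
        o.map (HF.map φ) = some (HF.atom (φ a)) ↔ o = some (HF.atom a) := by
      intro o a
      rw [← HF.map_atom, ← Option.map_some,
        (Option.map_injective (HF.map_injective φ)).eq_iff]
    constructor
    · rintro ⟨c, hc, h⟩
      refine ⟨fun j => φ⁻¹ (c j), (hR _).1 (by simpa using hc), fun j => (hat _ _).1 ?_⟩
      simpa using h j
    · rintro ⟨c, hc, h⟩
      exact ⟨_, (hR c).2 hc, fun j => (hat _ _).2 (h j)⟩
  unfold relOp
  simp only [Option.map_eq_none_iff]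
  split_ifs
  · rfl
  · exact congrArg some (decide_eq_decide.2 h)

variable {step step' wit wit' : HF A → HF A → Option (HF A)} {choice choice' : HF A → Option (HF A)}
  {out out' : HF A → Option Bool} {G G' : Set (Perm A)} {N : ℕ}

theorem Chosen.map (φ : Perm A) (hc : ∀ b, choice' (b.map φ) = (choice b).map (HF.map φ))
    {b c : HF A} (h : Chosen choice b c) : Chosen choice' (b.map φ) (c.map φ) := by
  obtain ⟨m, hm, h⟩ := h
  refine ⟨m.map φ, by rw [hc, hm]; rfl, ?_⟩
  rcases h with h | ⟨h, rfl⟩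
  · exact .inl ((HF.mem_elems_map φ).2 h)
  · exact .inr ⟨by rw [HF.elems_map, h, Finset.image_empty], HF.map_empty φ⟩

theorem IsRun.map (φ : Perm A) (hs : ∀ b c, step' (b.map φ) (c.map φ) = (step b c).map (HF.map φ))
    (hc : ∀ b, choice' (b.map φ) = (choice b).map (HF.map φ)) {l : List (HF A)}
    (h : IsRun step choice l) : IsRun step' choice' (l.map (HF.map φ)) := by
  induction h with
  | start =>
    rw [List.map_singleton, HF.map_empty]
    exact .start
  | next _ h1 h2 h3 ih =>
    refine .next ih (fun h => h1 ?_) (h2.map φ hc) (by rw [hs, h3]; rfl)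
    rw [List.head?_map, ← Option.map_some] at h
    exact Option.map_injective (HF.map_injective φ) h

theorem IsPath.map (φ : Perm A) (hs : ∀ b c, step' (b.map φ) (c.map φ) = (step b c).map (HF.map φ))
    (hc : ∀ b, choice' (b.map φ) = (choice b).map (HF.map φ)) {l : List (HF A)}
    (h : IsPath step choice l) : IsPath step' choice' (l.map (HF.map φ)) := by
  obtain ⟨h, b, l', rfl⟩ := h
  exact ⟨h.map φ hs hc, _, _, rfl⟩

theorem map_inv_equation (φ : Perm A) {f f' : HF A → Option (HF A)}
    (h : ∀ b, f' (b.map φ) = (f b).map (HF.map φ)) (b : HF A) :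
    f (b.map (φ⁻¹ : Perm A)) = (f' b).map (HF.map (φ⁻¹ : Perm A)) := by
  have := h (b.map (φ⁻¹ : Perm A))
  rw [HF.map_map_inv] at this
  rw [this, Option.map_map]
  cases f (b.map (φ⁻¹ : Perm A)) <;> simp

theorem map_inv_equation₂ (φ : Perm A) {f f' : HF A → HF A → Option (HF A)}
    (h : ∀ b c, f' (b.map φ) (c.map φ) = (f b c).map (HF.map φ)) (b c : HF A) :
    f (b.map (φ⁻¹ : Perm A)) (c.map (φ⁻¹ : Perm A)) = (f' b c).map (HF.map (φ⁻¹ : Perm A)) :=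
  map_inv_equation φ (f := f (b.map (φ⁻¹ : Perm A))) (f' := f' b)
    (fun c => by simpa using h (b.map (φ⁻¹ : Perm A)) c) c

theorem map_inv_map_list (φ : Perm A) (l : List (HF A)) :
    (l.map (HF.map φ)).map (HF.map (φ⁻¹ : Perm A)) = l := by
  simp [Function.comp_def]

variable [Fintype A]

theorem Witnesses.map (φ : Perm A) (hG : ∀ ψ ∈ G, φ * ψ * φ⁻¹ ∈ G') {M Q : HF A}
    (h : Witnesses G M Q) : Witnesses G' (M.map φ) (Q.map φ) := by
  constructor
  · intro m hm
    rw [HF.elems_map] at hm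
    obtain ⟨m', hm', rfl⟩ := Finset.mem_image.1 hm
    obtain ⟨ψ, hψ, rfl⟩ := h.1 m' hm'
    exact ⟨_, hG ψ hψ, HF.map_graph _ _⟩
  · intro b hb c hc
    rw [HF.elems_map] at hb hc
    obtain ⟨b', hb', rfl⟩ := Finset.mem_image.1 hb
    obtain ⟨c', hc', rfl⟩ := Finset.mem_image.1 hc
    obtain ⟨ψ, hψ, h1, rfl⟩ := h.2 b' hb' c' hc'
    refine ⟨_, hG ψ hψ, ?_, ?_⟩
    · rw [← HF.map_graph]
      exact (HF.mem_elems_map φ).2 h1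
    · rw [HF.map_mul, HF.map_mul, HF.map_inv_map]

theorem WitnessesPath.map (φ : Perm A) (hG : ∀ ψ ∈ G, φ * ψ * φ⁻¹ ∈ G')
    (hc : ∀ b, choice' (b.map φ) = (choice b).map (HF.map φ))
    (hw : ∀ b c, wit' (b.map φ) (c.map φ) = (wit b c).map (HF.map φ)) {l : List (HF A)}
    (h : WitnessesPath G choice wit l) : WitnessesPath G' choice' wit' (l.map (HF.map φ)) := by
  rintro bn l₀ h' b l' hb
  obtain ⟨bn, l₀, rfl, rfl, rfl⟩ := List.map_eq_cons_iff.1 h'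
  obtain ⟨q, hq, hbq⟩ : ∃ q, q <:+ l₀ ∧ b :: l' = q.map (HF.map φ) := by
    obtain ⟨t, ht⟩ := hb
    obtain ⟨t', q, rfl, rfl, hq⟩ := List.map_eq_append_iff.1 ht.symm
    exact ⟨q, ⟨t', rfl⟩, hq.symm⟩
  obtain ⟨b, l', rfl, rfl, rfl⟩ := List.map_eq_cons_iff.1 hbq.symm
  obtain ⟨M, Q, hM, hQ, h⟩ := h _ _ rfl b l' hq
  refine ⟨M.map φ, Q.map φ, by rw [hw, hM]; rfl, by rw [hc, hQ]; rfl, h.map φ ?_⟩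
  rintro ψ ⟨hψ, hfix⟩
  refine ⟨hG ψ hψ, fun x hx => ?_⟩
  rw [← List.map_cons] at hx
  obtain ⟨z, hz, rfl⟩ := List.mem_map.1 hx
  rw [HF.map_mul, HF.map_mul, HF.map_inv_map, hfix z hz]

theorem Fails.map (φ : Perm A) (hG : ∀ ψ, φ * ψ * φ⁻¹ ∈ G' ↔ ψ ∈ G)
    (hs : ∀ b c, step' (b.map φ) (c.map φ) = (step b c).map (HF.map φ))
    (hc : ∀ b, choice' (b.map φ) = (choice b).map (HF.map φ))
    (hw : ∀ b c, wit' (b.map φ) (c.map φ) = (wit b c).map (HF.map φ))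
    (h : Fails N G step choice wit) : Fails N G' step' choice' wit' := by
  rcases h with ⟨l, hl, h⟩ | ⟨b, l, hl, h1, h2⟩ | ⟨l, hl, h⟩
  · refine .inl ⟨_, hl.map φ hs hc, ?_⟩
    rcases h with h | ⟨b, hb, h⟩
    · exact .inl (by simpa using h)
    · exact .inr ⟨_, List.mem_map_of_mem hb, by rwa [HF.encard_TC_map]⟩
  · refine .inr (.inl ⟨_, _, hl.map φ hs hc, fun h => h1 ?_, ?_⟩)
    · rw [List.head?_map, ← Option.map_some] at h
      exact Option.map_injective (HF.map_injective φ) h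
    · rcases h2 with h2 | ⟨c, h2, h3⟩
      · exact .inl (by rw [hc, h2]; rfl)
      · exact .inr ⟨_, h2.map φ hc, by rw [hs, h3]; rfl⟩
  · refine .inr (.inr ⟨_, hl.map φ hs hc, fun h' => h ?_⟩)
    have := h'.map (G' := G) φ⁻¹ (fun ψ hψ => ?_) (map_inv_equation φ hc)
      (map_inv_equation₂ φ hw)
    · rwa [map_inv_map_list] at this
    · rw [← hG]
      simpa [mul_assoc] using hψ

theorem wscOp_map (φ : Perm A) (hG : ∀ ψ, φ * ψ * φ⁻¹ ∈ G' ↔ ψ ∈ G)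
    (hs : ∀ b c, step' (b.map φ) (c.map φ) = (step b c).map (HF.map φ))
    (hc : ∀ b, choice' (b.map φ) = (choice b).map (HF.map φ))
    (hw : ∀ b c, wit' (b.map φ) (c.map φ) = (wit b c).map (HF.map φ))
    (ho : ∀ b, out' (b.map φ) = out b) :
    wscOp N G' step' choice' wit' out' = wscOp N G step choice wit out := by
  have hF : Fails N G' step' choice' wit' ↔ Fails N G step choice wit := by
    refine ⟨Fails.map φ⁻¹ (fun ψ => ?_) (map_inv_equation₂ φ hs) (map_inv_equation φ hc)
      (map_inv_equation₂ φ hw), Fails.map φ hG hs hc hw⟩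
    rw [← hG]
    simp [mul_assoc]
  have hW : ∀ P : HF A → Prop, (∀ b ∈ wscSet step' choice', P b) ↔
      ∀ b ∈ wscSet step choice, P (b.map φ) := by
    intro P
    constructor
    · rintro h b ⟨l, hl⟩
      exact h _ ⟨_, hl.map φ hs hc⟩
    · rintro h b ⟨l, hl⟩
      have := h (b.map (φ⁻¹ : Perm A))
        ⟨_, hl.map φ⁻¹ (map_inv_equation₂ φ hs) (map_inv_equation φ hc)⟩
      rwa [HF.map_map_inv] at this
  have hE : (∃ b ∈ wscSet step' choice', out' b = none) ↔
      ∃ b ∈ wscSet step choice, out b = none := by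
    have := (hW fun b => out' b ≠ none).not
    simpa [ho] using this
  have hA := hW fun b => out' b = some true
  simp only [ho] at hA
  classical
  unfold wscOp
  exact if_congr (or_congr hF hE) rfl (congrArg some (decide_eq_decide.2 hA))

end

/-! ### Terms and formulas -/

section

variable {ℓ : ℕ} {ar : Fin ℓ → ℕ} {A : Type} {S : Struct ar A} {N : ℕ}

theorem update_map {φ : Perm A} {ρ ρ' : ℕ → HF A} {V W : Finset ℕ} {y : ℕ}
    (h : ∀ v ∈ W, ρ' v = (ρ v).map φ) (hV : V \ {y} ⊆ W) (b : HF A) :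
    ∀ v ∈ V, Function.update ρ' y (b.map φ) v = (Function.update ρ y b v).map φ := by
  intro v hv
  by_cases hvy : v = y
  · subst hvy; simp
  · simp only [Function.update_of_ne hvy]
    exact h v (hV (by simp [hv, hvy]))

theorem Struct.one_mem_aut : 1 ∈ S.aut := fun _ _ => Iff.rfl

theorem Struct.mul_mem_aut {φ ψ : Perm A} (hφ : φ ∈ S.aut) (hψ : ψ ∈ S.aut) : φ * ψ ∈ S.aut :=
  fun i t => (hφ i fun j => ψ (t j)).trans (hψ i t)

theorem Struct.inv_mem_aut {φ : Perm A} (hφ : φ ∈ S.aut) : φ⁻¹ ∈ S.aut := fun i t => by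
  rw [← hφ i]
  simp

variable [Fintype A]

mutual

theorem Term.eval_map {φ : Perm A} (hφ : φ ∈ S.aut) : ∀ (s : Term ar) {ρ ρ' : ℕ → HF A},
    (∀ v ∈ s.freeVars, ρ' v = (ρ v).map φ) → s.eval N S ρ' = (s.eval N S ρ).map (HF.map φ)
  | .var v, ρ, ρ', h => by simp [Term.eval, h v (by simp [Term.freeVars])]
  | .empty, ρ, ρ', h => by simp [Term.eval, HF.map_empty]
  | .atoms, ρ, ρ', h => by simp [Term.eval, HF.map_atoms]
  | .pair s t, ρ, ρ', h => by
    have hs := s.eval_map hφ fun v hv => h v (by simp [Term.freeVars, hv])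
    have ht := t.eval_map hφ fun v hv => h v (by simp [Term.freeVars, hv])
    unfold Term.eval
    rw [hs, ht]
    cases s.eval N S ρ <;> cases t.eval N S ρ <;> simp [HF.map_pair]
  | .union s, ρ, ρ', h => by
    have hs := s.eval_map hφ fun v hv => h v (by simp [Term.freeVars, hv])
    unfold Term.eval
    rw [hs]
    cases s.eval N S ρ <;> simp [HF.map_union]
  | .unique s, ρ, ρ', h => by
    have hs := s.eval_map hφ fun v hv => h v (by simp [Term.freeVars, hv])
    unfold Term.eval
    rw [hs]
    cases s.eval N S ρ <;> simp [HF.map_unique]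
  | .card s, ρ, ρ', h => by
    have hs := s.eval_map hφ fun v hv => h v (by simp [Term.freeVars, hv])
    unfold Term.eval
    rw [hs]
    cases s.eval N S ρ <;> simp [HF.map_card]
  | .compr s y t Φ, ρ, ρ', h => by
    have ht := t.eval_map hφ fun v hv => h v (by simp [Term.freeVars, hv])
    have hs := fun b => s.eval_map hφ (update_map h (V := s.freeVars) (y := y)
      (by simp only [Term.freeVars]; grind) b)
    have hΦ := fun b => Φ.eval_map hφ (update_map h (V := Φ.freeVars) (y := y)
      (by simp only [Term.freeVars]; grind) b)
    unfold Term.eval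
    rw [ht]
    cases t.eval N S ρ with
    | none => rfl
    | some m => exact comprOp_map φ hs hΦ
  | .iter s y, ρ, ρ', h => by
    have hs := fun b => s.eval_map hφ (update_map h (V := s.freeVars) (y := y)
      (by simp only [Term.freeVars]; grind) b)
    unfold Term.eval iterOp
    rw [← HF.map_empty φ]
    conv_rhs => rw [HF.map_empty φ]
    exact iterFrom_map φ hs N ∅

theorem Formula.eval_map {φ : Perm A} (hφ : φ ∈ S.aut) : ∀ (Φ : Formula ar) {ρ ρ' : ℕ → HF A},
    (∀ v ∈ Φ.freeVars, ρ' v = (ρ v).map φ) → Φ.eval N S ρ' = Φ.eval N S ρ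
  | .rel i t, ρ, ρ', h => by
    have ht := fun j => (t j).eval_map hφ (ρ := ρ) (ρ' := ρ') fun v hv => h v
      (by simp only [Formula.freeVars, Finset.mem_biUnion]; exact ⟨j, by simp, hv⟩)
    unfold Formula.eval
    simp only [ht]
    exact relOp_map φ (hφ i) _
  | .eq s t, ρ, ρ', h => by
    have hs := s.eval_map hφ fun v hv => h v (by simp [Formula.freeVars, hv])
    have ht := t.eval_map hφ fun v hv => h v (by simp [Formula.freeVars, hv])
    unfold Formula.eval
    rw [hs, ht]
    cases s.eval N S ρ <;> cases t.eval N S ρ <;> simp [(HF.map_injective φ).eq_iff]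
  | .not Φ, ρ, ρ', h => by
    have hs := Φ.eval_map hφ fun v hv => h v (by simp [Formula.freeVars, hv])
    unfold Formula.eval
    rw [hs]
  | .and Φ Ψ, ρ, ρ', h => by
    have hs := Φ.eval_map hφ fun v hv => h v (by simp [Formula.freeVars, hv])
    have ht := Ψ.eval_map hφ fun v hv => h v (by simp [Formula.freeVars, hv])
    unfold Formula.eval
    rw [hs, ht]
  | .or Φ Ψ, ρ, ρ', h => by
    have hs := Φ.eval_map hφ fun v hv => h v (by simp [Formula.freeVars, hv])
    have ht := Ψ.eval_map hφ fun v hv => h v (by simp [Formula.freeVars, hv])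
    unfold Formula.eval
    rw [hs, ht]
  | .wsc x y step choice wit out, ρ, ρ', h => by
    have hx := fun b => update_map h (V := choice.freeVars ∪ out.freeVars) (y := x)
      (by simp only [Formula.freeVars]; grind) b
    have hy := fun b c => update_map (update_map h (V := (step.freeVars ∪ wit.freeVars) \ {y})
      (y := x) (by simp only [Formula.freeVars]; grind) b) (V := step.freeVars ∪ wit.freeVars) (y := y)
      (by grind) c
    have hs := fun b c => step.eval_map hφ fun v hv => hy b c v (by simp [hv])
    have hw := fun b c => wit.eval_map hφ fun v hv => hy b c v (by simp [hv])
    have hc := fun b => choice.eval_map hφ fun v hv => hx b v (by simp [hv])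
    have ho := fun b => out.eval_map hφ fun v hv => hx b v (by simp [hv])
    unfold Formula.eval
    refine wscOp_map φ (fun ψ => and_congr ?_ ?_) hs hc hw ho
    · constructor
      · intro h
        have := S.mul_mem_aut (S.mul_mem_aut (S.inv_mem_aut hφ) h) hφ
        simpa [mul_assoc] using this
      · exact fun h => S.mul_mem_aut (S.mul_mem_aut hφ h) (S.inv_mem_aut hφ)
    · refine forall_congr' fun v => forall_congr' fun hv => ?_
      rw [h v hv, HF.map_mul, HF.map_mul, HF.map_inv_map, (HF.map_injective φ).eq_iff]

end

end

end CPTWSC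

namespace CPTWSC

open Equiv (Perm)

/-! ## Runs are unique up to automorphisms -/

section

variable {A : Type} {step wit : HF A → HF A → Option (HF A)} {choice : HF A → Option (HF A)}
  {out : HF A → Option Bool} {G : Set (Perm A)} {N : ℕ}

theorem IsRun.getLast {l : List (HF A)} (h : IsRun step choice l) : [∅] <:+ l := by
  induction h with
  | start => exact List.suffix_rfl
  | next _ _ _ _ ih => exact ih.trans (List.suffix_cons _ _)

theorem IsRun.ne_nil {l : List (HF A)} (h : IsRun step choice l) : l ≠ [] := by
  cases h <;> simp

/-- The last step of a run. -/
theorem IsRun.inv {b' b : HF A} {l : List (HF A)} (h : IsRun step choice (b' :: b :: l)) :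
    IsRun step choice (b :: l) ∧ l.head? ≠ some b ∧ ∃ c, Chosen choice b c ∧ step b c = some b' := by
  cases h with
  | next h1 h2 h3 h4 => exact ⟨h1, h2, _, h3, h4⟩

theorem IsRun.of_suffix {p q : List (HF A)} (hp : IsRun step choice p) (h : q <:+ p) (hq : q ≠ []) :
    IsRun step choice q := by
  induction hp with
  | start =>
    rcases List.suffix_cons_iff.1 h with rfl | h
    · exact .start
    · exact absurd (List.suffix_nil.1 h) hq
  | next h1 h2 h3 h4 ih =>
    rcases List.suffix_cons_iff.1 h with rfl | h
    · exact .next h1 h2 h3 h4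
    · exact ih h

/-- A proper suffix of a run has a next label. -/
theorem IsRun.next_of_suffix {b' b : HF A} {p l : List (HF A)} (hp : IsRun step choice (b' :: p))
    (h : (b :: l) <:+ p) :
    l.head? ≠ some b ∧ ∃ c b₁, Chosen choice b c ∧ step b c = some b₁ ∧
      (b₁ :: b :: l) <:+ (b' :: p) := by
  obtain ⟨t, rfl⟩ := h
  rcases List.eq_nil_or_concat (b' :: t) with h | ⟨t', b₁, h⟩
  · simp at h
  · have h' : b' :: (t ++ b :: l) = t' ++ (b₁ :: b :: l) := by
      rw [← List.cons_append, h]; simp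
    rw [h'] at hp ⊢
    have := (hp.of_suffix (List.suffix_append _ _) (by simp)).inv
    obtain ⟨-, h1, c, h2, h3⟩ := this
    exact ⟨h1, c, b₁, h2, h3, List.suffix_append _ _⟩

theorem suffix_of_not_fixed {bn : HF A} {p : List (HF A)}
    (hp : IsPath step choice (bn :: p)) {q l : List (HF A)} {b : HF A} {φ : Perm A}
    (hq : q <:+ (bn :: p)) (hl : b :: l = q.map (HF.map φ)) (hb : l.head? ≠ some b) : q <:+ p := by
  rcases List.suffix_cons_iff.1 hq with rfl | h
  · obtain ⟨-, b₀, l₀, h⟩ := hp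
    rw [h] at hl
    simp only [List.map_cons, List.cons.injEq] at hl
    exact absurd (by simp [hl]) hb
  · exact h

variable [Fintype A]

/-- The setting of a fixed-point operator: the operators are invariant under the group. -/
structure Invariant (G : Set (Perm A)) (step : HF A → HF A → Option (HF A))
    (choice : HF A → Option (HF A)) (wit : HF A → HF A → Option (HF A))
    (out : HF A → Option Bool) : Prop where
  one : 1 ∈ G
  mul : ∀ φ ∈ G, ∀ ψ ∈ G, φ * ψ ∈ G
  inv : ∀ φ ∈ G, φ⁻¹ ∈ G
  step : ∀ φ ∈ G, ∀ b c, step (b.map φ) (c.map φ) = (step b c).map (HF.map φ)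
  choice : ∀ φ ∈ G, ∀ b, choice (b.map φ) = (choice b).map (HF.map φ)
  wit : ∀ φ ∈ G, ∀ b c, wit (b.map φ) (c.map φ) = (wit b c).map (HF.map φ)
  out : ∀ φ ∈ G, ∀ b, out (b.map φ) = out b

variable {bn : HF A} {p : List (HF A)}

/-- Every continuation of an image of a part of a witnessed path is again such an image. -/
theorem exists_step_of_witnessed (I : Invariant G step choice wit out)
    (hp : IsPath step choice (bn :: p)) (hw : WitnessesPath G choice wit (bn :: p))
    {b c : HF A} {l q : List (HF A)} (hq : q <:+ p) {φ : Perm A}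
    (hφ : φ ∈ G) (hl : b :: l = q.map (HF.map φ)) (hc : Chosen choice b c) :
    ∃ ψ ∈ G, ∃ b₁, (b₁ :: q) <:+ (bn :: p) ∧ b :: l = q.map (HF.map ψ) ∧
      step b c = some (b₁.map ψ) := by
  obtain ⟨b₀, l₀, rfl, rfl, rfl⟩ := List.map_eq_cons_iff.1 hl.symm
  obtain ⟨-, c₀, b₁, hc₀, hs, hsuf⟩ := hp.1.next_of_suffix hq
  obtain ⟨M, Q, -, hQ, -, hM⟩ := hw _ _ rfl _ _ hq
  obtain ⟨Q', hQ', hc⟩ := hc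
  obtain rfl : Q.map φ = Q' := by
    rw [I.choice φ hφ, hQ] at hQ'
    exact Option.some.inj hQ'
  obtain ⟨Q', hQ', hc₀⟩ := hc₀
  obtain rfl : Q = Q' := Option.some.inj (hQ.symm.trans hQ')
  obtain ⟨ψ, hψ, hfix, hψc⟩ : ∃ ψ ∈ G, (∀ x ∈ b₀ :: l₀, HF.map ψ x = x) ∧
      (HF.map ψ c₀).map φ = c := by
    rcases hc with hc | ⟨hc, rfl⟩
    · rw [HF.elems_map] at hc
      obtain ⟨d, hd, rfl⟩ := Finset.mem_image.1 hc
      rcases hc₀ with hc₀ | ⟨hc₀, -⟩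
      · obtain ⟨ψ, ⟨hψ, hfix⟩, -, rfl⟩ := hM c₀ hc₀ d hd
        exact ⟨ψ, hψ, hfix, rfl⟩
      · simp [hc₀] at hd
    · rw [HF.elems_map, Finset.image_eq_empty] at hc
      rcases hc₀ with hc₀ | ⟨-, rfl⟩
      · simp [hc] at hc₀
      · exact ⟨1, I.one, fun x _ => HF.map_one x, by simp [HF.map_empty]⟩
  have hfix' : ∀ x ∈ b₀ :: l₀, HF.map (φ * ψ : Perm A) x = HF.map φ x := fun x hx => by
    rw [HF.map_mul, hfix x hx]
  refine ⟨φ * ψ, I.mul φ hφ ψ hψ, b₁, hsuf, ?_, ?_⟩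
  · rw [hl]
    exact List.map_congr_left fun x hx => (hfix' x hx).symm
  · rw [← hfix' b₀ (by simp), ← hψc, ← HF.map_mul, I.step _ (I.mul φ hφ ψ hψ), hs]
    rfl

/-- Every run is an image of a part of a witnessed path. -/
theorem IsRun.exists_map {l : List (HF A)} (hl : IsRun step choice l)
    (I : Invariant G step choice wit out)
    (hp : IsPath step choice (bn :: p)) (hw : WitnessesPath G choice wit (bn :: p)) :
    ∃ φ ∈ G, ∃ q, q <:+ (bn :: p) ∧ l = q.map (HF.map φ) := by
  induction hl with
  | start => exact ⟨1, I.one, _, hp.1.getLast, by simp [HF.map_empty]⟩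
  | next h1 h2 h3 h4 ih =>
    obtain ⟨φ, hφ, q, hq, hl⟩ := ih
    have hq' := suffix_of_not_fixed hp hq hl h2
    obtain ⟨ψ, hψ, b₁, h5, h6, h7⟩ := exists_step_of_witnessed I hp hw hq' hφ hl h3
    refine ⟨ψ, hψ, _, h5, ?_⟩
    rw [List.map_cons, ← h6, Option.some.inj (h4.symm.trans h7)]

/-- Every path is an image of a given witnessed path. -/
theorem IsPath.exists_map {l : List (HF A)} (hl : IsPath step choice l)
    (I : Invariant G step choice wit out)
    (hp : IsPath step choice (bn :: p)) (hw : WitnessesPath G choice wit (bn :: p)) :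
    ∃ φ ∈ G, l = (bn :: p).map (HF.map φ) := by
  obtain ⟨hl, b, l', rfl⟩ := hl
  obtain ⟨φ, hφ, q, hq, h⟩ := hl.exists_map I hp hw
  rcases List.suffix_cons_iff.1 hq with rfl | hq
  · exact ⟨φ, hφ, h⟩
  · obtain ⟨b₀, q, rfl, h1, h2⟩ := List.map_eq_cons_iff.1 h.symm
    obtain ⟨b₁, q, rfl, h3, h4⟩ := List.map_eq_cons_iff.1 h2
    have := (hp.1.next_of_suffix hq).1
    simp only [List.head?_cons, ne_eq, Option.some.injEq] at this
    exact absurd (HF.map_injective φ (h3.trans h1.symm)) this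

theorem not_fails (I : Invariant G step choice wit out)
    (hp : IsPath step choice (bn :: p)) (hw : WitnessesPath G choice wit (bn :: p))
    (hN : (bn :: p).length ≤ N) (hT : ∀ b ∈ bn :: p, b.TC.encard ≤ N) :
    ¬ Fails N G step choice wit := by
  rintro (⟨l, hl, h⟩ | ⟨b, l, hl, h1, h2⟩ | ⟨l, hl, h⟩)
  · obtain ⟨φ, hφ, q, hq, rfl⟩ := hl.exists_map I hp hw
    rcases h with h | ⟨b, hb, h⟩
    · have := hq.length_le
      simp only [List.length_map] at h
      omega
    · obtain ⟨d, hd, rfl⟩ := List.mem_map.1 hb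
      rw [HF.encard_TC_map] at h
      exact absurd (hT d (hq.subset hd)) (not_le.2 h)
  · obtain ⟨φ, hφ, q, hq, h⟩ := hl.exists_map I hp hw
    have hq' := suffix_of_not_fixed hp hq h h1
    rcases h2 with h2 | ⟨c, hc, h2⟩
    · obtain ⟨b₀, l₀, rfl, rfl, rfl⟩ := List.map_eq_cons_iff.1 h.symm
      obtain ⟨-, Q, -, hQ, -⟩ := hw _ _ rfl _ _ hq'
      rw [I.choice φ hφ, hQ] at h2
      simp at h2
    · obtain ⟨ψ, hψ, b₁, h5, h6, h7⟩ := exists_step_of_witnessed I hp hw hq' hφ h hc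
      simp [h2] at h7
  · obtain ⟨φ, hφ, rfl⟩ := hl.exists_map I hp hw
    exact h (hw.map φ (fun ψ hψ => I.mul _ (I.mul _ hφ _ hψ) _ (I.inv _ hφ)) (I.choice φ hφ)
      (I.wit φ hφ))

/-- A fixed-point operator can be evaluated along one path. -/
theorem wscOp_of_witnessed (I : Invariant G step choice wit out)
    (hp : IsPath step choice (bn :: p)) (hw : WitnessesPath G choice wit (bn :: p))
    (hN : (bn :: p).length ≤ N) (hT : ∀ b ∈ bn :: p, b.TC.encard ≤ N) :
    wscOp N G step choice wit out = out bn := by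
  have hF := not_fails I hp hw hN hT
  have hbn : bn ∈ wscSet step choice := ⟨p, hp⟩
  have hout : ∀ b ∈ wscSet step choice, out b = out bn := by
    rintro b ⟨l, hl⟩
    obtain ⟨φ, hφ, h⟩ := hl.exists_map I hp hw
    rw [List.map_cons, List.cons.injEq] at h
    rw [h.1, I.out φ hφ]
  unfold wscOp
  cases h : out bn with
  | none => rw [if_pos (.inr ⟨bn, hbn, h⟩)]
  | some t =>
    rw [if_neg]
    · cases t
      · simpa using ⟨bn, hbn, by simp [h]⟩
      · simpa using fun b hb => (hout b hb).trans h
    · rintro (h' | ⟨b, hb, hb'⟩)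
      · exact hF h'
      · rw [hout b hb, h] at hb'
        simp at hb'

end

theorem wscOp_of_fails {A : Type} [Fintype A] {step wit : HF A → HF A → Option (HF A)}
    {choice : HF A → Option (HF A)} {out : HF A → Option Bool} {G : Set (Perm A)} {N : ℕ}
    (h : Fails N G step choice wit) : wscOp N G step choice wit out = none :=
  if_pos (.inl h)

end CPTWSC

namespace CPTWSC

open Equiv (Perm)

/-! ## Correctness of the evaluation on codes -/

section

variable {A : Type} {n : ℕ} (e : Fin n ≃ A)

/-- A code, or the error marker, for a given value. -/
def Rep (o : Option Code) (x : Option (HF A)) : Prop :=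
  (o = none ∧ x = none) ∨ ∃ v, o = some v ∧ Good n v ∧ x = some (den e v)

variable {e}

theorem Rep.isSome {o : Option Code} {x : Option (HF A)} (h : Rep e o x) :
    o.isSome = x.isSome := by
  rcases h with ⟨rfl, rfl⟩ | ⟨v, rfl, -, rfl⟩ <;> rfl

theorem Rep.some {v : Code} (hv : Good n v) {x : HF A} (h : den e v = x) :
    Rep e (some v) (some x) := .inr ⟨v, rfl, hv, by rw [h]⟩

theorem Rep.map {o : Option Code} {x : Option (HF A)} (h : Rep e o x) {f : Code → Code}
    {f' : HF A → HF A} (hf : ∀ v, Good n v → Good n (f v) ∧ den e (f v) = f' (den e v)) :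
    Rep e (o.map f) (x.map f') := by
  rcases h with ⟨rfl, rfl⟩ | ⟨v, rfl, hv, rfl⟩
  · exact .inl ⟨rfl, rfl⟩
  · exact .some (hf v hv).1 (hf v hv).2

theorem Rep.bind {o : Option Code} {x : Option (HF A)} (h : Rep e o x) {f : Code → Option Code}
    {f' : HF A → Option (HF A)} (hf : ∀ v, Good n v → Rep e (f v) (f' (den e v))) :
    Rep e (o.bind f) (x.bind f') := by
  rcases h with ⟨rfl, rfl⟩ | ⟨v, rfl, hv, rfl⟩
  · exact .inl ⟨rfl, rfl⟩
  · exact hf v hv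

/-! ### Set operations -/

theorem good_pairC {v w : Code} (hv : Good n v) (hw : Good n w) : Good n (ofListC [v, w]) :=
  good_ofListC (by simp [hv, hw])

theorem den_pairC {v w : Code} (hv : Good n v) (hw : Good n w) :
    den e (ofListC [v, w]) = HF.pair (den e v) (den e w) := by
  rw [den_ofListC (by simp [hv, hw]), HF.pair]
  congr 1
  ext u
  simp

theorem good_kpairC {v w : Code} (hv : Good n v) (hw : Good n w) : Good n (kpairC v w) :=
  good_pairC (good_pairC hv hv) (good_pairC hv hw)

theorem den_kpairC {v w : Code} (hv : Good n v) (hw : Good n w) :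
    den e (kpairC v w) = HF.kpair (den e v) (den e w) := by
  rw [kpairC, den_pairC (good_pairC hv hv) (good_pairC hv hw), den_pairC hv hv, den_pairC hv hw,
    HF.kpair]

theorem good_atomsC : Good n (atomsC n) :=
  good_ofListC fun v hv => by
    obtain ⟨i, hi, rfl⟩ := List.mem_map.1 hv
    exact good_atomC (List.mem_range.1 hi)

theorem exists_atom_iff {P : HF A → Prop} :
    (∃ a, P (HF.atom a)) ↔ ∃ i, ∃ h : i < n, P (HF.atom (e ⟨i, h⟩)) := by
  constructor
  · rintro ⟨a, ha⟩
    exact ⟨e.symm a, (e.symm a).2, by simpa using ha⟩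
  · rintro ⟨i, h, hi⟩
    exact ⟨_, hi⟩

theorem den_atomsC [Fintype A] : den e (atomsC n) = HF.atoms := by
  rw [atomsC, den_ofListC, HF.atoms]
  · congr 1
    ext u
    simp only [List.mem_toFinset, List.mem_map, List.mem_range, Finset.mem_image, Finset.mem_univ,
      true_and]
    rw [exists_atom_iff (e := e) (P := fun x => x = u)]
    constructor
    · rintro ⟨_, ⟨i, hi, rfl⟩, rfl⟩
      exact ⟨i, hi, (den_atomC hi).symm⟩
    · rintro ⟨i, hi, rfl⟩
      exact ⟨_, ⟨i, hi, rfl⟩, den_atomC hi⟩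
  · intro v hv
    obtain ⟨i, hi, rfl⟩ := List.mem_map.1 hv
    exact good_atomC (List.mem_range.1 hi)

theorem unionC_spec {v : Code} (hv : Good n v) :
    Good n (unionC v) ∧ den e (unionC v) = HF.union (den e v) := by
  have h : ∀ w ∈ (elemsC v).flatMap elemsC, Good n w := by
    intro w hw
    obtain ⟨u, hu, hw⟩ := List.mem_flatMap.1 hw
    exact good_of_mem_elemsC (good_of_mem_elemsC hv.2 hu).2 hw
  refine ⟨good_ofListC h, ?_⟩
  rw [unionC, den_ofListC h, HF.union]
  congr 1
  ext x
  simp only [List.mem_toFinset, List.mem_map, List.mem_flatMap, Finset.mem_biUnion,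
    mem_elems_den hv.2]
  constructor
  · rintro ⟨w, ⟨u, hu, hw⟩, rfl⟩
    exact ⟨_, ⟨u, hu, rfl⟩, (mem_elems_den (good_of_mem_elemsC hv.2 hu).2).2 ⟨w, hw, rfl⟩⟩
  · rintro ⟨_, ⟨u, hu, rfl⟩, hx⟩
    obtain ⟨w, hw, rfl⟩ := (mem_elems_den (good_of_mem_elemsC hv.2 hu).2).1 hx
    exact ⟨w, ⟨u, hu, hw⟩, rfl⟩

theorem headD_elemsC_spec {v : Code} (hv : Good n v) : Good n ((elemsC v).headD emptyC) ∧
    (den e ((elemsC v).headD emptyC) ∈ (den e v).elems ∨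
      (den e v).elems = ∅ ∧ den e ((elemsC v).headD emptyC) = ∅) := by
  cases h : elemsC v with
  | nil => exact ⟨good_emptyC, .inr ⟨by rw [elems_den hv.2, h]; rfl, den_emptyC⟩⟩
  | cons w l =>
    have hw : w ∈ elemsC v := by simp [h]
    exact ⟨good_of_mem_elemsC hv.2 hw, .inl ((mem_elems_den hv.2).2 ⟨w, hw, rfl⟩)⟩

theorem uniqueC_spec {v : Code} (hv : Good n v) :
    Good n (uniqueC v) ∧ den e (uniqueC v) = HF.unique (den e v) := by
  unfold uniqueC
  rw [cardC_eq e hv]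
  by_cases h : (den e v).elems.card = 1
  · obtain ⟨h1, h2⟩ := headD_elemsC_spec (e := e) hv
    obtain ⟨x, hx⟩ := Finset.card_eq_one.1 h
    simp only [h, beq_self_eq_true, cond_true]
    refine ⟨h1, ?_⟩
    rw [HF.unique_eq hx]
    simpa [hx] using h2
  · have : ((den e v).elems.card == 1) = false := by simpa using h
    rw [this, HF.unique_eq_empty h]
    exact ⟨good_emptyC, den_emptyC⟩

theorem ofNatC_succ (k : ℕ) : ofNatC (k + 1) = (none, List.range (k + 1)) :: ofNatC k := by
  simp [ofNatC, List.range_succ]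

theorem ofNatC_spec (k : ℕ) : Good n (ofNatC k) ∧ den e (ofNatC k) = HF.ofNat k ∧
    ∀ u, u ∈ vals e (ofNatC k) ↔ u = HF.ofNat k ∨ u ∈ (HF.ofNat k).elems := by
  induction k with
  | zero =>
    refine ⟨good_emptyC, den_emptyC, fun u => ?_⟩
    have : vals e (ofNatC 0) = [∅] := congrArg (· :: []) HF.ofFinset_empty
    simp [this, HF.ofNat, HF.elems_empty]
  | succ k ih =>
    have hlen : (ofNatC k).length = k + 1 := by simp [ofNatC]
    have hel : entVal e (vals e (ofNatC k)) (none, List.range (k + 1)) = HF.ofNat (k + 1) := by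
      rw [entVal_set, HF.ofNat]
      congr 1
      ext u
      rw [Finset.mem_insert, ← ih.2.2, List.mem_toFinset, List.mem_filterMap,
        List.mem_iff_getElem?]
      refine exists_congr fun j => ⟨fun h => h.2, fun h => ⟨?_, h⟩⟩
      have := (List.getElem?_eq_some_iff.1 h).1
      rw [length_vals, hlen] at this
      exact List.mem_range.2 this
    rw [ofNatC_succ]
    refine ⟨⟨by simp, ⟨by simp, by simp [hlen]⟩, ih.1.2⟩, hel, fun u => ?_⟩
    rw [vals, List.mem_cons, hel, ih.2.2, HF.ofNat, HF.elems_ofFinset, Finset.mem_insert]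

theorem cardC_spec {v : Code} (hv : Good n v) :
    Good n (ofNatC (cardC v)) ∧ den e (ofNatC (cardC v)) = HF.card (den e v) := by
  rw [cardC_eq e hv]
  exact ⟨(ofNatC_spec (e := e) _).1, (ofNatC_spec _).2.1⟩

/-! ### Comprehension, iteration, relations -/

theorem comprC_spec {m : Code} (hm : Good n m) {s : Code → Option Code} {Φ : Code → Option Bool}
    {s' : HF A → Option (HF A)} {Φ' : HF A → Option Bool}
    (hs : ∀ v, Good n v → Rep e (s v) (s' (den e v))) (hΦ : ∀ v, Good n v → Φ v = Φ' (den e v)) :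
    Rep e (comprC m s Φ) (comprOp (den e m) s' Φ') := by
  have hg := fun v (hv : v ∈ elemsC m) => good_of_mem_elemsC hm.2 hv
  unfold comprC
  set l := (elemsC m).map fun b => (Φ b).elim none fun c => bif c then (s b).map Option.some
    else Option.some none with hl
  have hall : (l.all fun o => o.isSome) = true ↔
      ¬ ∃ b ∈ (den e m).elems, Φ' b = none ∨ (Φ' b = Option.some true ∧ s' b = none) := by
    simp only [hl, List.all_map, List.all_eq_true, not_exists, not_and, mem_elems_den hm.2,
      forall_exists_index, and_imp, forall_apply_eq_imp_iff₂]
    refine forall_congr' fun b => forall_congr' fun hb => ?_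
    rw [Function.comp, hΦ b (hg b hb)]
    have := (hs b (hg b hb)).isSome
    rcases Φ' (den e b) with _ | _ | _
    · simp
    · simp
    · simp only [Option.elim_some, cond_true, Option.isSome_map, this]
      cases s' (den e b) <;> simp
  by_cases h : (l.all fun o => o.isSome) = true
  · have hmem : ∀ v, v ∈ l.filterMap (fun o => o.getD none) ↔
        ∃ b ∈ elemsC m, Φ b = Option.some true ∧ s b = Option.some v := by
      intro v
      simp only [hl, List.filterMap_map, List.mem_filterMap, Function.comp]
      refine exists_congr fun b => and_congr_right fun _ => ?_
      rcases Φ b with _ | _ | _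
      · simp
      · simp
      · cases s b <;> simp
    have hgood : ∀ v ∈ l.filterMap (fun o => o.getD none), Good n v := by
      intro v hv
      obtain ⟨b, hb, -, hsb⟩ := (hmem v).1 hv
      rcases hs b (hg b hb) with ⟨h, -⟩ | ⟨w, h, hw, -⟩
      · simp [h] at hsb
      · rw [h] at hsb
        exact Option.some.inj hsb ▸ hw
    simp only [h, cond_true]
    rw [comprOp, if_neg (hall.1 h)]
    refine .some (good_ofListC hgood) ?_
    rw [den_ofListC hgood]
    congr 1
    ext u
    simp only [List.mem_toFinset, List.mem_map, Finset.mem_eraseNone, Finset.mem_image,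
      Finset.mem_filter, mem_elems_den hm.2, hmem]
    constructor
    · rintro ⟨v, ⟨b, hb, h1, h2⟩, rfl⟩
      refine ⟨_, ⟨⟨b, hb, rfl⟩, by rw [← hΦ b (hg b hb), h1]⟩, ?_⟩
      rcases hs b (hg b hb) with ⟨h, -⟩ | ⟨w, h, -, hw⟩
      · simp [h] at h2
      · rw [hw, Option.some.inj (h.symm.trans h2)]
    · rintro ⟨_, ⟨⟨b, hb, rfl⟩, h1⟩, h2⟩
      rcases hs b (hg b hb) with ⟨-, h⟩ | ⟨w, h, -, hw⟩
      · simp [h] at h2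
      · exact ⟨w, ⟨b, hb, by rw [hΦ b (hg b hb), h1], h⟩, Option.some.inj (hw.symm.trans h2)⟩
  · rw [comprOp, if_pos (not_not.1 (mt hall.2 h))]
    simp only [Bool.not_eq_true] at h
    simp only [h, cond_false]
    exact .inl ⟨rfl, rfl⟩

theorem TC_empty : (∅ : HF A).TC = ∅ := by
  refine Set.eq_empty_iff_forall_notMem.2 fun x hx => ?_
  obtain ⟨y, -, hy⟩ := Relation.TransGen.tail'_iff.1 hx
  simp [HF.elems_empty] at hy

theorem iterStep_spec {N : ℕ} {F : Code → Option Code} {F' : HF A → Option (HF A)}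
    (hF : ∀ v, Good n v → Rep e (F v) (F' (den e v))) (k : ℕ) {v : Code} (hv : Good n v)
    (hN : (den e v).TC.encard ≤ N) :
    Rep e (((iterStep n N F)^[k + 1] (none, v)).1.getD (some emptyC))
      (iterFrom N F' k (den e v)) := by
  have hdone : ∀ (i : ℕ) (o : Option Code) (w : Code),
      (iterStep n N F)^[i] (Option.some o, w) = (Option.some o, w) :=
    fun i o w => Function.iterate_fixed rfl i
  induction k generalizing v with
  | zero =>
    unfold iterFrom
    rw [if_neg (not_lt.2 hN), Function.iterate_one, iterStep, Option.elim_none]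
    rcases hF v hv with ⟨h, h'⟩ | ⟨a, h, ha, h'⟩
    · rw [h, h']
      exact .inl ⟨rfl, rfl⟩
    · rw [h, h']
      by_cases hav : den e a = den e v
      · simp only [hav, if_true, (eqC_iff e ha hv).2 hav, Option.elim_some, cond_true]
        exact .some hv rfl
      · have : eqC a v = false := by simpa using mt (eqC_iff e ha hv).1 hav
        simp only [hav, if_false, this, Option.elim_some, cond_false]
        cases small n N (norm a) <;> exact .some good_emptyC den_emptyC
  | succ k ih =>
    unfold iterFrom
    rw [if_neg (not_lt.2 hN), Function.iterate_succ_apply, iterStep, Option.elim_none]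
    rcases hF v hv with ⟨h, h'⟩ | ⟨a, h, ha, h'⟩
    · rw [h, h']
      simp only [Option.elim_none, hdone]
      exact .inl ⟨rfl, rfl⟩
    · rw [h, h']
      by_cases hav : den e a = den e v
      · simp only [hav, if_true, (eqC_iff e ha hv).2 hav, Option.elim_some, cond_true, hdone]
        exact .some hv rfl
      · have : eqC a v = false := by simpa using mt (eqC_iff e ha hv).1 hav
        simp only [hav, if_false, this, Option.elim_some, cond_false]
        by_cases hs : small n N (norm a) = true
        · rw [hs, cond_true, ← den_norm ha]
          refine ih (good_norm e ha) ?_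
          rw [den_norm ha]
          exact (small_norm_iff ha).1 hs
        · have hlt := not_le.1 (mt (small_norm_iff (e := e) ha).2 hs)
          rw [Bool.not_eq_true] at hs
          rw [hs, cond_false, hdone]
          unfold iterFrom
          rw [if_pos hlt]
          exact .some good_emptyC den_emptyC

theorem iterC_spec {N : ℕ} {F : Code → Option Code} {F' : HF A → Option (HF A)}
    (hF : ∀ v, Good n v → Rep e (F v) (F' (den e v))) : Rep e (iterC n N F) (iterOp N F') := by
  have := iterStep_spec hF (N := N) N good_emptyC (by rw [den_emptyC, TC_empty]; simp)
  rwa [den_emptyC] at this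

/-- The list of tuples `R` describes the relation `R'`. -/
def RepRel {r : ℕ} (e : Fin n ≃ A) (R : List (List ℕ)) (R' : Set (Fin r → A)) : Prop :=
  ∀ t : Fin r → Fin n, (fun j => e (t j)) ∈ R' ↔ (List.ofFn fun j => (t j : ℕ)) ∈ R

theorem headD_fst {v : Code} (hv : Good n v) {i : ℕ} :
    (v.headD (none, [])).1 = Option.some i ↔ ∃ h : i < n, den e v = HF.atom (e ⟨i, h⟩) := by
  obtain ⟨⟨_ | j, l⟩, v, rfl⟩ := List.exists_cons_of_ne_nil hv.1
  · simp only [List.headD_cons, reduceCtorEq, false_iff, not_exists]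
    exact fun h h' => HF.atom_ne_ofFinset _ _ h'.symm
  · have hj := (hv.2.1.1 j rfl).1
    have : den e ((Option.some j, l) :: v) = HF.atom (e ⟨j, hj⟩) :=
      entVal_atom (vs := vals e v) (l := l) hj
    simp only [List.headD_cons, Option.some.injEq, this]
    constructor
    · rintro rfl
      exact ⟨hj, rfl⟩
    · rintro ⟨h, h'⟩
      simpa using e.injective (HF.atom_injective h')

theorem relC_spec {r : ℕ} {R : List (List ℕ)} {R' : Set (Fin r → A)} (hR : RepRel e R R')
    {f : Fin r → Option Code} {g : Fin r → Option (HF A)} (h : ∀ j, Rep e (f j) (g j)) :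
    relC R (List.ofFn f) = relOp R' g := by
  classical
  unfold relC relOp
  by_cases hsome : ∃ j, g j = none
  · rw [if_pos hsome]
    obtain ⟨j, hj⟩ := hsome
    have : ((List.ofFn f).all fun o => o.isSome) = false := by
      rw [List.all_eq_false]
      exact ⟨f j, List.mem_ofFn.2 ⟨j, rfl⟩, by rw [(h j).isSome, hj]; simp⟩
    rw [this, cond_false]
  · rw [if_neg hsome]
    have : ∀ j, ∃ v, f j = Option.some v ∧ Good n v ∧ g j = Option.some (den e v) := fun j =>
      (h j).resolve_left fun h' => hsome ⟨j, h'.2⟩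
    choose v hf hv hg using this
    have : ((List.ofFn f).all fun o => o.isSome) = true := by
      simp [List.all_eq_true, List.mem_ofFn, hf]
    rw [this, cond_true]
    congr 1
    rw [Bool.eq_iff_iff, decide_eq_true_iff, Bool.and_eq_true, List.contains_iff_mem]
    have hfm : ∀ t : Fin r → ℕ, (∀ j, ((v j).headD (none, [])).1 = Option.some (t j)) →
        (List.ofFn f).filterMap (fun o => ((o.getD emptyC).headD (none, [])).1) =
          List.ofFn fun j => t j := by
      intro t ht
      have : (fun o => ((o.getD emptyC).headD (none, [])).1) ∘ f = fun j => Option.some (t j) := by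
        funext j
        rw [← ht j, Function.comp, hf, Option.getD_some]
      rw [List.ofFn_eq_map, List.filterMap_map, this, List.filterMap_eq_map', List.ofFn_eq_map]
    constructor
    · rintro ⟨h1, h2⟩
      have : ∀ j, ∃ i, ((v j).headD (none, [])).1 = Option.some i := by
        intro j
        have := List.all_eq_true.1 h1 (f j) (List.mem_ofFn.2 ⟨j, rfl⟩)
        rw [hf] at this
        exact Option.isSome_iff_exists.1 this
      choose t ht using this
      have ht' := fun j => (headD_fst (e := e) (hv j)).1 (ht j)
      choose hlt hden using ht'
      rw [hfm t ht] at h2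
      exact ⟨_, (hR fun j => ⟨t j, hlt j⟩).2 h2, fun j => by rw [hg, hden]⟩
    · rintro ⟨c, hc, h'⟩
      have ht : ∀ j, ((v j).headD (none, [])).1 = Option.some (e.symm (c j) : ℕ) := fun j =>
        (headD_fst (e := e) (hv j)).2 ⟨(e.symm (c j)).2, by
          have := h' j
          rw [hg] at this
          simpa using this⟩
      refine ⟨?_, ?_⟩
      · rw [List.all_eq_true]
        intro o ho
        obtain ⟨j, rfl⟩ := List.mem_ofFn.1 ho
        rw [hf, Option.getD_some, ht]
        rfl
      · rw [hfm _ ht]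
        exact (hR fun j => e.symm (c j)).1 (by simpa using hc)

end

end CPTWSC

namespace CPTWSC

open Equiv (Perm)

/-! ### Permutations -/

section

variable {A : Type} {n : ℕ} {e : Fin n ≃ A}

/-- The list `π` of values describes the permutation `φ`. -/
def RepPerm (e : Fin n ≃ A) (π : List ℕ) (φ : Perm A) : Prop :=
  ∀ i : Fin n, π.getD i 0 = e.symm (φ (e i))

theorem mapC_spec_wf {π : List ℕ} {φ : Perm A} (hπ : RepPerm e π φ) {v : Code} (hv : WF n v) :
    WF n (mapC π v) ∧ vals e (mapC π v) = (vals e v).map (HF.map φ) := by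
  induction v with
  | nil => exact ⟨trivial, rfl⟩
  | cons x v ih =>
    obtain ⟨h1, h2⟩ := ih hv.2
    obtain ⟨⟨hx, hx'⟩, -⟩ := hv
    have hlen : (mapC π v).length = v.length := by simp [mapC]
    have hc : mapC π (x :: v) = (x.1.map fun a => π.getD a 0, x.2) :: mapC π v := rfl
    rw [hc]
    refine ⟨⟨⟨fun a ha => ?_, fun j hj => by rw [hlen]; exact hx' j hj⟩, h1⟩, ?_⟩
    · obtain ⟨b, hb, rfl⟩ := Option.map_eq_some_iff.1 ha
      refine ⟨?_, (hx b hb).2⟩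
      have := hπ ⟨b, (hx b hb).1⟩
      simp only at this
      rw [this]
      exact (e.symm _).2
    · rw [vals, vals, List.map_cons, h2]
      congr 1
      obtain ⟨_ | b, l⟩ := x
      · rw [Option.map_none, entVal_set, entVal_set, HF.map_ofFinset]
        congr 1
        ext u
        simp
        grind
      · have hb := (hx b rfl).1
        rw [entVal_atom hb, HF.map_atom, Option.map_some]
        have := hπ ⟨b, hb⟩
        simp only at this
        rw [this, entVal_atom (e.symm _).2]
        simp

theorem mapC_spec {π : List ℕ} {φ : Perm A} (hπ : RepPerm e π φ) {v : Code} (hv : Good n v) :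
    Good n (mapC π v) ∧ den e (mapC π v) = (den e v).map φ := by
  obtain ⟨h1, h2⟩ := mapC_spec_wf hπ hv.2
  refine ⟨⟨by simpa [mapC] using hv.1, h1⟩, ?_⟩
  obtain ⟨x, v, rfl⟩ := List.exists_cons_of_ne_nil hv.1
  rw [den, h2]
  rfl

theorem graphC_good {π : List ℕ} (h : ∀ i < n, π.getD i 0 < n) :
    ∀ v ∈ (List.range n).map fun i => kpairC (atomC i) (atomC (π.getD i 0)), Good n v := by
  intro v hv
  obtain ⟨i, hi, rfl⟩ := List.mem_map.1 hv
  rw [List.mem_range] at hi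
  exact good_kpairC (good_atomC hi) (good_atomC (h i hi))

theorem den_graphC [Fintype A] {π : List ℕ} {φ : Perm A} (hπ : RepPerm e π φ) :
    den e (graphC n π) = HF.graph φ := by
  have hlt : ∀ i < n, π.getD i 0 < n := fun i hi => by
    rw [hπ ⟨i, hi⟩]; exact (e.symm _).2
  rw [graphC, den_ofListC (graphC_good hlt), HF.graph]
  congr 1
  ext u
  simp only [List.map_map, List.mem_toFinset, List.mem_map, List.mem_range, Finset.mem_image,
    Finset.mem_univ, true_and, Function.comp]
  have hden : ∀ i (hi : i < n), den e (kpairC (atomC i) (atomC (π.getD i 0))) =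
      HF.kpair (HF.atom (e ⟨i, hi⟩)) (HF.atom (φ (e ⟨i, hi⟩))) := by
    intro i hi
    rw [den_kpairC (good_atomC hi) (good_atomC (hlt i hi)), den_atomC hi, den_atomC (hlt i hi)]
    congr 2
    rw [← e.eq_symm_apply]
    exact Fin.ext (hπ ⟨i, hi⟩)
  constructor
  · rintro ⟨i, hi, rfl⟩
    exact ⟨_, (hden i hi).symm⟩
  · rintro ⟨a, rfl⟩
    refine ⟨e.symm a, (e.symm a).2, ?_⟩
    rw [hden _ (e.symm a).2]
    simp

theorem kpair_mem_graph [Fintype A] {φ : Perm A} {a b : A} :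
    HF.kpair (HF.atom a) (HF.atom b) ∈ (HF.graph φ).elems ↔ φ a = b := by
  rw [HF.graph, HF.elems_ofFinset, Finset.mem_image]
  constructor
  · rintro ⟨c, -, h⟩
    obtain ⟨h1, h2⟩ := HF.kpair_inj h
    rw [← HF.atom_injective h1, HF.atom_injective h2]
  · rintro rfl
    exact ⟨a, by simp, rfl⟩

theorem length_ungraph (m : Code) : (ungraph n m).length = n := by simp [ungraph]

theorem ungraph_lt (m : Code) {i : ℕ} (hi : i < n) : (ungraph n m).getD i 0 < n := by
  rw [ungraph, List.getD_eq_getElem _ _ (by simpa using hi)]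
  simp only [List.getElem_map, List.getElem_range]
  cases h : (List.range n).find? fun j =>
      (elemsC m).any fun q => eqC q (kpairC (atomC i) (atomC j)) with
  | none => exact Nat.zero_lt_of_lt hi
  | some j => exact List.mem_range.1 (List.mem_of_find?_eq_some h)

theorem repPerm_ungraph [Fintype A] {m : Code} (hm : Good n m) {φ : Perm A}
    (h : den e m = HF.graph φ) : RepPerm e (ungraph n m) φ := by
  rintro ⟨i, hi⟩
  have key : ∀ j (hj : j < n), ((elemsC m).any fun q => eqC q (kpairC (atomC i) (atomC j))) = true ↔
      φ (e ⟨i, hi⟩) = e ⟨j, hj⟩ := by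
    intro j hj
    rw [← kpair_mem_graph, ← h, mem_elems_den hm.2, List.any_eq_true]
    refine exists_congr fun q => and_congr_right fun hq => ?_
    rw [eqC_iff e (good_of_mem_elemsC hm.2 hq) (good_kpairC (good_atomC hi) (good_atomC hj)),
      den_kpairC (good_atomC hi) (good_atomC hj), den_atomC hi, den_atomC hj]
  have hlt := (e.symm (φ (e ⟨i, hi⟩))).2
  rw [ungraph, List.getD_eq_getElem _ _ (by simpa using hi)]
  simp only [List.getElem_map, List.getElem_range]
  cases h : (List.range n).find? fun j =>
      (elemsC m).any fun q => eqC q (kpairC (atomC i) (atomC j)) with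
  | none =>
    refine absurd ((key _ hlt).2 (by simp)) ?_
    exact List.find?_eq_none.1 h _ (List.mem_range.2 hlt)
  | some j =>
    have := (key j (List.mem_range.1 (List.mem_of_find?_eq_some h))).1
      (List.find?_some (p := fun j => (elemsC m).any fun q => eqC q (kpairC (atomC i) (atomC j))) h)
    rw [this]
    simp

theorem exists_repPerm {π : List ℕ} (hlen : π.length = n) (hlt : ∀ i < n, π.getD i 0 < n)
    (hsurj : ∀ j < n, j ∈ π) : ∃ φ, RepPerm e π φ := by
  let f : Fin n → Fin n := fun i => ⟨π.getD i 0, hlt i i.2⟩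
  have hf : Function.Surjective f := by
    rintro ⟨j, hj⟩
    obtain ⟨i, hi, h⟩ := List.getElem_of_mem (hsurj j hj)
    exact ⟨⟨i, hlen ▸ hi⟩, Fin.ext (by simp [f, h, hi])⟩
  refine ⟨(e.symm.trans (Equiv.ofBijective f (Finite.surjective_iff_bijective.1 hf))).trans e,
    fun i => ?_⟩
  simp [f]

theorem RepPerm.mem {π : List ℕ} {φ : Perm A} (h : RepPerm e π φ) (hlen : π.length = n) {j : ℕ}
    (hj : j < n) : j ∈ π := by
  have hi := (e.symm (φ.symm (e ⟨j, hj⟩))).2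
  have := h (e.symm (φ.symm (e ⟨j, hj⟩)))
  rw [List.getD_eq_getElem _ _ (by omega)] at this
  simp only [Equiv.apply_symm_apply, Equiv.symm_apply_apply] at this
  rw [← this]
  exact List.getElem_mem _

variable [Fintype A]

theorem mem_iff_of_mapsTo {r : ℕ} {R : Set (Fin r → A)} {φ : Perm A}
    (h : ∀ t ∈ R, (fun j => φ (t j)) ∈ R) (t : Fin r → A) : (fun j => φ (t j)) ∈ R ↔ t ∈ R := by
  have key : ∀ (k : ℕ) (t : Fin r → A), t ∈ R → (fun j => (φ ^ k) (t j)) ∈ R := by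
    intro k
    induction k with
    | zero => exact fun t ht => ht
    | succ k ih =>
      intro t ht
      have := ih _ (h t ht)
      simpa [pow_succ] using this
  refine ⟨fun ht => ?_, h t⟩
  have := key (orderOf φ - 1) _ ht
  have h1 : φ ^ (orderOf φ - 1) * φ = 1 := by
    rw [← pow_succ, Nat.sub_add_cancel (orderOf_pos φ), pow_orderOf_eq_one]
  have h2 : ∀ a, (φ ^ (orderOf φ - 1)) (φ a) = a := fun a => by
    rw [← Equiv.Perm.mul_apply, h1, Equiv.Perm.one_apply]
  simpa [h2] using this

variable {ℓ : ℕ} {ar : Fin ℓ → ℕ} {S : Struct ar A} {rels : List (List (List ℕ))}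

theorem autC_iff (hR : ∀ i : Fin ℓ, RepRel e (rels.getD i []) (S i)) {π : List ℕ} {φ : Perm A}
    (hπ : RepPerm e π φ) (hlen : π.length = n) :
    autC (List.ofFn ar) n rels π = true ↔ φ ∈ S.aut := by
  have h1 : ((List.range n).all fun j => π.contains j) = true := by
    simp only [List.all_eq_true, List.contains_iff_mem]
    exact fun j hj => hπ.mem hlen (List.mem_range.1 hj)
  have hmap : ∀ {r : ℕ} (t : Fin r → Fin n),
      (List.ofFn fun j => (t j : ℕ)).map (fun a => π.getD a 0) =
        List.ofFn fun j => (e.symm (φ (e (t j))) : ℕ) := by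
    intro r t
    rw [List.map_ofFn]
    congr 1
    funext j
    exact hπ (t j)
  have hrel : ∀ (i : Fin ℓ) (t : Fin (ar i) → Fin n),
      (fun j => φ (e (t j))) ∈ S i ↔
        (List.ofFn fun j => (t j : ℕ)).map (fun a => π.getD a 0) ∈ rels.getD i [] := by
    intro i t
    rw [hmap, ← hR i fun j => e.symm (φ (e (t j)))]
    simp
  simp only [autC, h1, Bool.true_and, List.all_eq_true, List.mem_range, List.length_ofFn,
    Bool.or_eq_true, Bool.not_eq_true', List.contains_iff_mem]
  constructor
  · intro h i t
    refine mem_iff_of_mapsTo (fun t ht => ?_) t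
    have ht' := (hR i fun j => e.symm (t j)).1 (by simpa using ht)
    rcases h i i.2 _ ht' with h | h
    · simp only [List.length_ofFn, List.getD_eq_getElem?_getD, List.getElem?_ofFn, i.2, dite_true,
        Fin.eta, Option.getD_some, beq_self_eq_true, Bool.true_and, List.all_eq_false,
        List.mem_ofFn, decide_eq_true_eq] at h
      obtain ⟨_, ⟨j, rfl⟩, h⟩ := h
      exact absurd (e.symm (t j)).2 h
    · simpa using (hrel i fun j => e.symm (t j)).2 h
  · intro h i hi t ht
    by_cases hv : (t.length == (List.ofFn ar).getD i 0 && t.all fun a => decide (a < n)) = true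
    · right
      simp only [Bool.and_eq_true, beq_iff_eq, List.all_eq_true, decide_eq_true_eq] at hv
      obtain ⟨hlen, hlt⟩ := hv
      have hlen : t.length = ar ⟨i, hi⟩ := by simpa [hi] using hlen
      let t' : Fin (ar ⟨i, hi⟩) → Fin n := fun j =>
        ⟨t[j]'(by omega), hlt _ (List.getElem_mem _)⟩
      have ht' : t = List.ofFn fun j => (t' j : ℕ) := by
        refine List.ext_getElem (by simpa using hlen) fun k h1 h2 => ?_
        simp [t']
      rw [ht'] at ht ⊢
      exact (hrel ⟨i, hi⟩ t').1 ((h ⟨i, hi⟩ _).2 ((hR ⟨i, hi⟩ t').2 ht))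
    · exact .inl (by simpa using hv)

/-! ### Fixed-point operators -/

variable (S) in
/-- The automorphisms that fix given sets. -/
def fixing (e : Fin n ≃ A) (fix : List Code) : Set (Perm A) :=
  {φ | φ ∈ S.aut ∧ ∀ v ∈ fix, (den e v).map φ = den e v}

theorem isWitness_iff (hR : ∀ i : Fin ℓ, RepRel e (rels.getD i []) (S i)) {fix : List Code}
    (hfix : ∀ v ∈ fix, Good n v) {m : Code} (hm : Good n m) :
    (eqC m (graphC n (ungraph n m)) && (autC (List.ofFn ar) n rels (ungraph n m) &&
      fix.all fun v => eqC (mapC (ungraph n m) v) v)) = true ↔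
      ∃ φ ∈ fixing S e fix, den e m = HF.graph φ := by
  have hgood : Good n (graphC n (ungraph n m)) :=
    good_ofListC (graphC_good fun i hi => ungraph_lt m hi)
  simp only [Bool.and_eq_true, List.all_eq_true]
  have key : ∀ φ, RepPerm e (ungraph n m) φ → ((autC (List.ofFn ar) n rels (ungraph n m) = true ∧
      ∀ v ∈ fix, eqC (mapC (ungraph n m) v) v = true) ↔ φ ∈ fixing S e fix) := by
    intro φ hφ
    refine and_congr (autC_iff hR hφ (length_ungraph m)) ?_
    refine forall_congr' fun v => forall_congr' fun hv => ?_
    obtain ⟨h1, h2⟩ := mapC_spec hφ (hfix v hv)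
    rw [eqC_iff e h1 (hfix v hv), h2]
  constructor
  · rintro ⟨h1, h2⟩
    have hs := h2.1
    simp only [autC, Bool.and_eq_true, List.all_eq_true, List.mem_range,
      List.contains_iff_mem] at hs
    obtain ⟨φ, hφ⟩ := exists_repPerm (e := e) (length_ungraph m) (fun i hi => ungraph_lt m hi) hs.1
    exact ⟨φ, (key φ hφ).1 h2, by rw [(eqC_iff e hm hgood).1 h1, den_graphC hφ]⟩
  · rintro ⟨φ, hφ, h⟩
    have hπ := repPerm_ungraph hm h
    exact ⟨(eqC_iff e hm hgood).2 (by rw [h, den_graphC hπ]), (key φ hπ).2 hφ⟩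

theorem witnessesC_iff (hR : ∀ i : Fin ℓ, RepRel e (rels.getD i []) (S i)) {fix : List Code}
    (hfix : ∀ v ∈ fix, Good n v) {M Q : Code} (hM : Good n M) (hQ : Good n Q) :
    witnessesC (List.ofFn ar) n rels fix M Q = true ↔
      Witnesses (fixing S e fix) (den e M) (den e Q) := by
  have hM' := fun m (hm : m ∈ elemsC M) => good_of_mem_elemsC hM.2 hm
  have hQ' := fun m (hm : m ∈ elemsC Q) => good_of_mem_elemsC hQ.2 hm
  rw [witnessesC, Bool.and_eq_true, Witnesses]
  have h1 : ((elemsC M).all fun m => eqC m (graphC n (ungraph n m)) &&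
      (autC (List.ofFn ar) n rels (ungraph n m) &&
        fix.all fun v => eqC (mapC (ungraph n m) v) v)) = true ↔
      ∀ m ∈ (den e M).elems, ∃ φ ∈ fixing S e fix, m = HF.graph φ := by
    rw [List.all_eq_true]
    constructor
    · intro h m hm
      obtain ⟨w, hw, rfl⟩ := (mem_elems_den hM.2).1 hm
      exact (isWitness_iff hR hfix (hM' w hw)).1 (h w hw)
    · exact fun h m hm => (isWitness_iff hR hfix (hM' m hm)).2
        (h _ ((mem_elems_den hM.2).2 ⟨m, hm, rfl⟩))
  rw [h1]
  refine and_congr_right fun hall => ?_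
  have h2 : ∀ b ∈ elemsC Q, ∀ c ∈ elemsC Q,
      (((elemsC M).any fun m => eqC (mapC (ungraph n m) b) c) = true ↔
        ∃ φ ∈ fixing S e fix, HF.graph φ ∈ (den e M).elems ∧ (den e b).map φ = den e c) := by
    intro b hb c hc
    rw [List.any_eq_true]
    constructor
    · rintro ⟨m, hm, h⟩
      have hmem : den e m ∈ (den e M).elems := (mem_elems_den hM.2).2 ⟨m, hm, rfl⟩
      obtain ⟨φ, hφ, hg⟩ := hall _ hmem
      obtain ⟨h3, h4⟩ := mapC_spec (repPerm_ungraph (hM' m hm) hg) (hQ' b hb)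
      exact ⟨φ, hφ, hg ▸ hmem, by rw [← h4, (eqC_iff e h3 (hQ' c hc)).1 h]⟩
    · rintro ⟨φ, hφ, hmem, h⟩
      obtain ⟨m, hm, hg⟩ := (mem_elems_den hM.2).1 hmem
      obtain ⟨h3, h4⟩ := mapC_spec (repPerm_ungraph (hM' m hm) hg) (hQ' b hb)
      exact ⟨m, hm, (eqC_iff e h3 (hQ' c hc)).2 (h4.trans h)⟩
  simp only [List.all_eq_true]
  constructor
  · intro h b hb c hc
    obtain ⟨u, hu, rfl⟩ := (mem_elems_den hQ.2).1 hb
    obtain ⟨w, hw, rfl⟩ := (mem_elems_den hQ.2).1 hc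
    exact (h2 u hu w hw).1 (h u hu w hw)
  · exact fun h b hb c hc => (h2 b hb c hc).2 (h _ ((mem_elems_den hQ.2).2 ⟨b, hb, rfl⟩) _
      ((mem_elems_den hQ.2).2 ⟨c, hc, rfl⟩))

variable {N : ℕ} {step wit : Code → Code → Option Code} {choice : Code → Option Code}
  {step' wit' : HF A → HF A → Option (HF A)} {choice' : HF A → Option (HF A)} {G : Set (Perm A)}

/-- What holds after `i` steps of a run. -/
def RunSpec (e : Fin n ≃ A) (N : ℕ) (step' : HF A → HF A → Option (HF A))
    (choice' : HF A → Option (HF A)) (i : ℕ) (d : Bool) (l : List Code) : Prop :=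
  (∀ v ∈ l, Good n v ∧ (den e v).TC.encard ≤ N) ∧ IsRun step' choice' (l.map (den e)) ∧
    (d = false → l.length = i + 1 ∧ ∀ b t, l = b :: t → (t.map (den e)).head? ≠ some (den e b)) ∧
    (d = true → ∃ b t, l.map (den e) = b :: b :: t)

theorem runStep_spec (hs : ∀ b c, Good n b → Good n c → Rep e (step b c) (step' (den e b) (den e c)))
    (hc : ∀ b, Good n b → Rep e (choice b) (choice' (den e b))) (i : ℕ) :
    ((runStep n N step choice)^[i] (some (false, [emptyC])) = none ∧
      Fails N G step' choice' wit') ∨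
    ∃ d l, (runStep n N step choice)^[i] (some (false, [emptyC])) = some (d, l) ∧
      RunSpec e N step' choice' i d l := by
  induction i with
  | zero =>
    refine .inr ⟨false, _, rfl, ?_, ?_, ?_, by simp⟩
    · simp [good_emptyC, den_emptyC, TC_empty]
    · rw [List.map_singleton, den_emptyC]; exact .start
    · refine fun _ => ⟨rfl, ?_⟩
      rintro b t h
      obtain ⟨rfl, rfl⟩ := List.cons.inj h
      simp
  | succ i ih =>
    rw [Function.iterate_succ_apply']
    rcases ih with ⟨h, hF⟩ | ⟨d, l, h, h1, h2, h3, h4⟩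
    · exact .inl ⟨by rw [h]; rfl, hF⟩
    rw [h]
    cases d with
    | true => exact .inr ⟨true, l, rfl, h1, h2, by simp, h4⟩
    | false =>
      obtain ⟨hlen, hne⟩ := h3 rfl
      obtain ⟨b, t, rfl⟩ := List.exists_cons_of_length_pos (by omega : 0 < l.length)
      have hb := (h1 b (by simp)).1
      have hne := hne b t rfl
      rw [List.map_cons] at h2
      simp only [runStep, Option.bind_some, cond_false, List.headD_cons]
      rcases hc b hb with ⟨h5, h6⟩ | ⟨m, h5, hm, h6⟩
      · exact .inl ⟨by rw [h5]; rfl, .inr (.inl ⟨_, _, h2, hne, .inl h6⟩)⟩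
      obtain ⟨hcg, hcm⟩ := headD_elemsC_spec (e := e) hm
      have hch : Chosen choice' (den e b) (den e ((elemsC m).headD emptyC)) := ⟨_, h6, hcm⟩
      rw [h5, Option.bind_some]
      rcases hs b _ hb hcg with ⟨h7, h8⟩ | ⟨b', h7, hb', h8⟩
      · exact .inl ⟨by rw [h7]; rfl, .inr (.inl ⟨_, _, h2, hne, .inr ⟨_, hch, h8⟩⟩)⟩
      have hrun := h2.next hne hch h8
      rw [h7, Option.bind_some]
      by_cases hsm : small n N (norm b') = true
      · right
        rw [hsm, cond_true]
        refine ⟨_, _, rfl, ?_, ?_, ?_, ?_⟩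
        · rintro v (_ | ⟨_, hv⟩)
          · exact ⟨good_norm e hb', by rw [den_norm hb']; exact (small_norm_iff hb').1 hsm⟩
          · exact h1 v hv
        · rw [List.map_cons, List.map_cons, den_norm hb']
          exact hrun
        · intro heq
          refine ⟨by simpa using hlen, ?_⟩
          rintro x y hxy
          obtain ⟨rfl, rfl⟩ := List.cons.inj hxy
          rw [List.map_cons, List.head?_cons, den_norm hb', ne_eq, Option.some.injEq]
          intro h
          rw [(eqC_iff e hb' hb).2 h.symm] at heq
          simp at heq
        · intro heq
          refine ⟨den e b, t.map (den e), ?_⟩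
          rw [List.map_cons, List.map_cons, den_norm hb', (eqC_iff e hb' hb).1 heq]
      · refine .inl ⟨by rw [Bool.not_eq_true] at hsm; rw [hsm]; rfl, .inl ⟨_, hrun, .inr
          ⟨den e b', by simp, not_le.1 (mt (small_norm_iff hb').2 hsm)⟩⟩⟩

theorem pathC_spec (hs : ∀ b c, Good n b → Good n c → Rep e (step b c) (step' (den e b) (den e c)))
    (hc : ∀ b, Good n b → Rep e (choice b) (choice' (den e b))) :
    (pathC n N step choice = none ∧ Fails N G step' choice' wit') ∨
    ∃ l, pathC n N step choice = some l ∧ (∀ v ∈ l, Good n v ∧ (den e v).TC.encard ≤ N) ∧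
      IsPath step' choice' (l.map (den e)) ∧ l.length ≤ N := by
  unfold pathC
  rcases runStep_spec (N := N) (G := G) (wit' := wit') hs hc N with ⟨h, hF⟩ | ⟨d, l, h, h1, h2, h3, h4⟩
  · exact .inl ⟨by rw [h]; rfl, hF⟩
  rw [h, Option.bind_some]
  by_cases hlen : l.length ≤ N
  · cases d with
    | false => have := (h3 rfl).1; omega
    | true => exact .inr ⟨l, by simp [hlen], h1, ⟨h2, h4 rfl⟩, hlen⟩
  · exact .inl ⟨by simp [hlen], .inl ⟨_, h2, .inl (by simpa using hlen)⟩⟩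

theorem witnessesPathC_iff (hR : ∀ i : Fin ℓ, RepRel e (rels.getD i []) (S i)) {fix : List Code}
    (hfix : ∀ v ∈ fix, Good n v)
    (hc : ∀ b, Good n b → Rep e (choice b) (choice' (den e b)))
    (hw : ∀ b c, Good n b → Good n c → Rep e (wit b c) (wit' (den e b) (den e c)))
    {bn : Code} {l : List Code} (hl : ∀ v ∈ bn :: l, Good n v) :
    witnessesPathC (List.ofFn ar) n rels fix choice wit (bn :: l) = true ↔
      WitnessesPath (fixing S e fix) choice' wit' ((bn :: l).map (den e)) := by
  have key : ∀ b t, (b :: t) <:+ l →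
      (((wit bn b).elim false fun M => (choice b).elim false fun Q =>
        witnessesC (List.ofFn ar) n rels (fix ++ b :: t) M Q) = true ↔
      ∃ M Q, wit' (den e bn) (den e b) = some M ∧ choice' (den e b) = some Q ∧
        Witnesses {φ | φ ∈ fixing S e fix ∧ ∀ x ∈ den e b :: t.map (den e), HF.map φ x = x} M Q) := by
    intro b t hbt
    have hbn := hl bn (by simp)
    have hg : ∀ v ∈ b :: t, Good n v := fun v hv => hl v (List.mem_cons_of_mem _ (hbt.subset hv))
    have hset : {φ | φ ∈ fixing S e fix ∧ ∀ x ∈ den e b :: t.map (den e), HF.map φ x = x} =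
        fixing S e (fix ++ b :: t) := by
      ext φ
      rw [← List.map_cons]
      simp only [fixing, Set.mem_ofPred_eq, List.mem_append, or_imp, forall_and, and_assoc,
        List.forall_mem_map]
    rw [hset]
    rcases hw bn b hbn (hg b (by simp)) with ⟨h1, h2⟩ | ⟨M, h1, hM, h2⟩
    · simp [h1, h2]
    rcases hc b (hg b (by simp)) with ⟨h3, h4⟩ | ⟨Q, h3, hQ, h4⟩
    · simp [h1, h3, h4]
    rw [h1, h2, h3, h4, Option.elim_some, Option.elim_some, witnessesC_iff hR _ hM hQ]
    · simp
    · intro v hv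
      rcases List.mem_append.1 hv with hv | hv
      · exact hfix v hv
      · exact hg v hv
  have hdrop : ∀ k < l.length, ∃ b t, l.drop k = b :: t := fun k hk =>
    List.exists_cons_of_ne_nil (by simpa [List.drop_eq_nil_iff] using hk)
  simp only [witnessesPathC, List.tail_cons, List.headD_cons, List.all_eq_true, List.mem_range]
  constructor
  · rintro h bn' l₀ heq b' t' hsuf
    obtain ⟨rfl, rfl⟩ := List.cons.inj heq
    obtain ⟨k, hk⟩ : ∃ k, b' :: t' = (l.map (den e)).drop k :=
      ⟨_, List.suffix_iff_eq_drop.1 hsuf⟩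
    have hkl : k < l.length := by
      by_contra hkl
      rw [List.drop_eq_nil_of_le (by simpa using hkl)] at hk
      simp at hk
    obtain ⟨b, t, hbt⟩ := hdrop k hkl
    rw [← List.map_drop, hbt, List.map_cons] at hk
    obtain ⟨rfl, rfl⟩ := List.cons.inj hk
    refine (key b t (hbt ▸ List.drop_suffix k l)).1 ?_
    have := h k hkl
    rwa [hbt] at this
  · intro h k hk
    obtain ⟨b, t, hbt⟩ := hdrop k hk
    rw [hbt]
    refine (key b t (hbt ▸ List.drop_suffix k l)).2 (h _ _ rfl _ _ ?_)
    rw [← List.map_cons, ← hbt]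
    exact (List.drop_suffix k l).map _

theorem wscC_spec (hR : ∀ i : Fin ℓ, RepRel e (rels.getD i []) (S i)) {fix : List Code}
    (hfix : ∀ v ∈ fix, Good n v) {out : Code → Option Bool} {out' : HF A → Option Bool}
    (I : Invariant (fixing S e fix) step' choice' wit' out')
    (hs : ∀ b c, Good n b → Good n c → Rep e (step b c) (step' (den e b) (den e c)))
    (hc : ∀ b, Good n b → Rep e (choice b) (choice' (den e b)))
    (hw : ∀ b c, Good n b → Good n c → Rep e (wit b c) (wit' (den e b) (den e c)))
    (ho : ∀ b, Good n b → out b = out' (den e b)) :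
    wscC (List.ofFn ar) n N rels fix step choice wit out =
      wscOp N (fixing S e fix) step' choice' wit' out' := by
  unfold wscC
  rcases pathC_spec (N := N) (G := fixing S e fix) (wit' := wit') hs hc with
    ⟨h, hF⟩ | ⟨l, h, hl, hp, hlen⟩
  · rw [h, wscOp_of_fails hF]; rfl
  rw [h, Option.bind_some]
  obtain ⟨bn, p, rfl⟩ := List.exists_cons_of_ne_nil (l := l) (by
    rintro rfl
    exact hp.1.ne_nil rfl)
  have hiff := witnessesPathC_iff hR hfix hc hw fun v hv => (hl v hv).1
  by_cases hw' : witnessesPathC (List.ofFn ar) n rels fix choice wit (bn :: p) = true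
  · rw [hw', cond_true, List.headD_cons, ho bn (hl bn (by simp)).1]
    refine (wscOp_of_witnessed I (by simpa using hp) (by simpa using hiff.1 hw')
      (by simpa using hlen) ?_).symm
    rw [← List.map_cons]
    intro b hb
    obtain ⟨v, hv, rfl⟩ := List.mem_map.1 hb
    exact (hl v hv).2
  · rw [wscOp_of_fails (.inr (.inr ⟨_, hp, fun h => hw' (hiff.2 h)⟩))]
    rw [Bool.not_eq_true] at hw'
    rw [hw', cond_false]

end

end CPTWSC

namespace CPTWSC

open Equiv (Perm)

/-! ### Terms and formulas -/

section

variable {ℓ : ℕ} {ar : Fin ℓ → ℕ} {A : Type} [Fintype A] {n : ℕ} {e : Fin n ≃ A} {S : Struct ar A}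
  {rels : List (List (List ℕ))} {N : ℕ}

/-- The list `ρ` describes the assignment `ρ'`. -/
def RepAsg {A : Type} {n : ℕ} (e : Fin n ≃ A) (ρ : Asg) (ρ' : ℕ → HF A) : Prop :=
  ∀ v, Good n (lookup ρ v) ∧ den e (lookup ρ v) = ρ' v

theorem lookup_cons (ρ : Asg) (y v : ℕ) (b : Code) :
    lookup ((y, b) :: ρ) v = if v = y then b else lookup ρ v := by
  by_cases h : v = y
  · simp [lookup, h]
  · have : (y == v) = false := by simpa using Ne.symm h
    simp [lookup, this, h]

theorem RepAsg.update {A : Type} {e : Fin n ≃ A} {ρ : Asg} {ρ' : ℕ → HF A} (h : RepAsg e ρ ρ')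
    (y : ℕ) {b : Code} (hb : Good n b) :
    RepAsg e ((y, b) :: ρ) (Function.update ρ' y (den e b)) := by
  intro v
  rw [lookup_cons]
  by_cases hv : v = y
  · subst hv; simpa using hb
  · simpa [hv] using h v

theorem invariant_wsc (x y : ℕ) (step choice wit : Term ar) (out : Formula ar) (ρ : ℕ → HF A) :
    Invariant {φ | φ ∈ S.aut ∧
        ∀ v ∈ (Formula.wsc x y step choice wit out).freeVars, HF.map φ (ρ v) = ρ v}
      (fun b c => step.eval N S (Function.update (Function.update ρ x b) y c))
      (fun b => choice.eval N S (Function.update ρ x b))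
      (fun b c => wit.eval N S (Function.update (Function.update ρ x b) y c))
      (fun b => out.eval N S (Function.update ρ x b)) := by
  have hx : ∀ φ : Perm A,
      (∀ v ∈ (Formula.wsc x y step choice wit out).freeVars, HF.map φ (ρ v) = ρ v) → ∀ b,
      ∀ v ∈ choice.freeVars ∪ out.freeVars,
        Function.update ρ x (HF.map φ b) v = HF.map φ (Function.update ρ x b v) :=
    fun φ h b => update_map (fun v hv => (h v hv).symm)
      (by simp only [Formula.freeVars]; grind) b
  have hy : ∀ φ : Perm A,
      (∀ v ∈ (Formula.wsc x y step choice wit out).freeVars, HF.map φ (ρ v) = ρ v) → ∀ b c,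
      ∀ v ∈ step.freeVars ∪ wit.freeVars,
        Function.update (Function.update ρ x (HF.map φ b)) y (HF.map φ c) v =
          HF.map φ (Function.update (Function.update ρ x b) y c v) :=
    fun φ h b c => update_map (update_map (V := (step.freeVars ∪ wit.freeVars) \ {y})
      (fun v hv => (h v hv).symm) (by simp only [Formula.freeVars]; grind) b) (by grind) c
  refine ⟨⟨S.one_mem_aut, fun v _ => HF.map_one _⟩, ?_, ?_, ?_, ?_, ?_, ?_⟩
  · rintro φ ⟨h1, h2⟩ ψ ⟨h3, h4⟩
    exact ⟨S.mul_mem_aut h1 h3, fun v hv => by rw [HF.map_mul, h4 v hv, h2 v hv]⟩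
  · rintro φ ⟨h1, h2⟩
    refine ⟨S.inv_mem_aut h1, fun v hv => ?_⟩
    conv_lhs => rw [← h2 v hv, HF.map_inv_map]
  · rintro φ ⟨h1, h2⟩ b c
    exact step.eval_map h1 fun v hv => hy φ h2 b c v (by simp [hv])
  · rintro φ ⟨h1, h2⟩ b
    exact choice.eval_map h1 fun v hv => hx φ h2 b v (by simp [hv])
  · rintro φ ⟨h1, h2⟩ b c
    exact wit.eval_map h1 fun v hv => hy φ h2 b c v (by simp [hv])
  · rintro φ ⟨h1, h2⟩ b
    exact out.eval_map h1 fun v hv => hx φ h2 b v (by simp [hv])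

mutual

theorem Term.code_spec (hR : ∀ i : Fin ℓ, RepRel e (rels.getD i []) (S i)) :
    ∀ (s : Term ar) {ρ : Asg} {ρ' : ℕ → HF A}, RepAsg e ρ ρ' →
      Rep e (s.code (n, N, rels) ρ) (s.eval N S ρ')
  | .var v, ρ, ρ', h => by
    simp only [Term.code, Term.eval]
    exact .some (h v).1 (h v).2
  | .empty, ρ, ρ', h => by
    simp only [Term.code, Term.eval]
    exact .some good_emptyC den_emptyC
  | .atoms, ρ, ρ', h => by
    simp only [Term.code, Term.eval]
    exact .some good_atomsC den_atomsC
  | .pair s t, ρ, ρ', h => by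
    simp only [Term.code, Term.eval]
    exact (s.code_spec hR h).bind fun a ha => (t.code_spec hR h).map fun b hb =>
      ⟨good_pairC ha hb, den_pairC ha hb⟩
  | .union s, ρ, ρ', h => by
    simp only [Term.code, Term.eval]
    exact (s.code_spec hR h).map fun a ha => unionC_spec ha
  | .unique s, ρ, ρ', h => by
    simp only [Term.code, Term.eval]
    exact (s.code_spec hR h).map fun a ha => uniqueC_spec ha
  | .card s, ρ, ρ', h => by
    simp only [Term.code, Term.eval]
    exact (s.code_spec hR h).map fun a ha => cardC_spec ha
  | .compr s y t Φ, ρ, ρ', h => by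
    simp only [Term.code, Term.eval]
    exact (t.code_spec hR h).bind fun m hm => comprC_spec hm
      (fun v hv => s.code_spec hR (h.update y hv)) fun v hv => Φ.code_spec hR (h.update y hv)
  | .iter s y, ρ, ρ', h => by
    simp only [Term.code, Term.eval]
    exact iterC_spec fun v hv => s.code_spec hR (h.update y hv)

theorem Formula.code_spec (hR : ∀ i : Fin ℓ, RepRel e (rels.getD i []) (S i)) :
    ∀ (Φ : Formula ar) {ρ : Asg} {ρ' : ℕ → HF A}, RepAsg e ρ ρ' →
      Φ.code (n, N, rels) ρ = Φ.eval N S ρ'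
  | .rel i t, ρ, ρ', h => by
    simp only [Formula.code, Formula.eval]
    exact relC_spec (hR i) fun j => (t j).code_spec hR h
  | .eq s t, ρ, ρ', h => by
    simp only [Formula.code, Formula.eval]
    rcases s.code_spec hR h with ⟨h1, h2⟩ | ⟨v, h1, hv, h2⟩
    · rw [h1, h2]; rfl
    rcases t.code_spec hR h with ⟨h3, h4⟩ | ⟨w, h3, hw, h4⟩
    · rw [h1, h2, h3, h4]; rfl
    rw [h1, h2, h3, h4]
    simp only [Option.bind_some, Option.map_some, Option.some.injEq]
    rw [Bool.eq_iff_iff, eqC_iff e hv hw, decide_eq_true_iff]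
  | .not Φ, ρ, ρ', h => by
    simp only [Formula.code, Formula.eval, Φ.code_spec hR h]
  | .and Φ Ψ, ρ, ρ', h => by
    simp only [Formula.code, Formula.eval, Φ.code_spec hR h, Ψ.code_spec hR h]
  | .or Φ Ψ, ρ, ρ', h => by
    simp only [Formula.code, Formula.eval, Φ.code_spec hR h, Ψ.code_spec hR h]
  | .wsc x y step choice wit out, ρ, ρ', h => by
    have hfix : ∀ v ∈ (Formula.wsc x y step choice wit out).freeVars.toList.map
        (fun v => lookup ρ v), Good n v := by
      intro v hv
      obtain ⟨u, -, rfl⟩ := List.mem_map.1 hv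
      exact (h u).1
    have hG : {φ | φ ∈ S.aut ∧
        ∀ v ∈ (Formula.wsc x y step choice wit out).freeVars, HF.map φ (ρ' v) = ρ' v} =
        fixing S e ((Formula.wsc x y step choice wit out).freeVars.toList.map
          fun v => lookup ρ v) := by
      ext φ
      simp only [fixing, Set.mem_ofPred_eq, List.forall_mem_map, Finset.mem_toList, (h _).2]
    have I := invariant_wsc (N := N) (S := S) x y step choice wit out ρ'
    rw [Formula.code, Formula.eval, hG]
    rw [hG] at I
    exact wscC_spec hR hfix I (fun b c hb hc => step.code_spec hR ((h.update x hb).update y hc))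
      (fun b hb => choice.code_spec hR (h.update x hb))
      (fun b c hb hc => wit.code_spec hR ((h.update x hb).update y hc))
      fun b hb => out.code_spec hR (h.update x hb)

end

end

/-! ## Inputs and outputs -/

/-- The positions of a list of sets as a code: the atoms come last. -/
def heapC (n : ℕ) (sets : List (List ℕ)) : Code :=
  ((List.range sets.length).map fun i => ((none, (sets.getD i []).filterMap fun j =>
    bif decide (j < n + i) then some (n + i - 1 - j) else none) : Ent)).reverse ++
  (List.range n).reverse.map fun a => (some a, [])

/-- The assignment of the parameters to the variables `0, 1, ...`. -/
def paramsC (h : Code) (params : List ℕ) : Asg :=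
  (List.range params.length).map fun v => (v, h.drop (h.length - 1 - params.getD v 0))

/-- The position of the value of a code in the list of sets `setsOf n v`. -/
def posC (n : ℕ) (v : Code) : ℕ :=
  (v.headD (none, [])).1.elim (n + (v.length - 1)) fun a => a

/-- The positions of the elements. -/
def rowC (n : ℕ) (v : Code) : List ℕ :=
  (v.headD (none, [])).2.map fun j => posC n (v.tail.drop j)

/-- A list of sets that contains all values of a code. -/
def setsOf (n : ℕ) (v : Code) : List (List ℕ) :=
  ((List.range v.length).map fun i => rowC n (v.drop i)).reverse

section

variable {A : Type} {n : ℕ} {e : Fin n ≃ A}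

theorem hfValues_append (sets : List (List ℕ)) (r : List ℕ) :
    hfValues e (sets ++ [r]) = hfValues e sets ++
      [HF.ofFinset (r.filterMap fun j => (hfValues e sets)[j]?).toFinset] := by
  rw [hfValues, List.foldl_append]
  rfl

theorem heapC_append (sets : List (List ℕ)) (r : List ℕ) :
    heapC n (sets ++ [r]) = (none, r.filterMap fun j =>
      bif decide (j < n + sets.length) then some (n + sets.length - 1 - j) else none) ::
        heapC n sets := by
  have : ∀ i ∈ List.range sets.length, (sets ++ [r]).getD i [] = sets.getD i [] := fun i hi => by
    rw [List.getD_append _ _ _ _ (List.mem_range.1 hi)]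
  simp only [heapC, List.length_append, List.length_singleton, List.range_succ, List.map_append,
    List.map_singleton, List.reverse_append, List.reverse_singleton, List.cons_append,
    List.nil_append]
  congr 2
  · simp
  · congr 1
    exact List.map_congr_left fun i hi => by simp only [this i hi]

theorem length_heapC (sets : List (List ℕ)) : (heapC n sets).length = sets.length + n := by
  simp [heapC]

theorem vals_atoms {k : ℕ} (hk : k ≤ n) :
    WF n ((List.range k).reverse.map fun a => ((some a, []) : Ent)) ∧
      (vals e ((List.range k).reverse.map fun a => ((some a, []) : Ent))).reverse =
        (List.range k).map (atomOf e) := by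
  induction k with
  | zero => exact ⟨trivial, rfl⟩
  | succ k ih =>
    obtain ⟨h1, h2⟩ := ih (by omega)
    rw [List.range_succ, List.reverse_append, List.reverse_singleton, List.singleton_append,
      List.map_cons]
    refine ⟨⟨⟨?_, by simp⟩, h1⟩, ?_⟩
    · intro a ha
      obtain rfl := Option.some.inj ha
      exact ⟨hk, rfl⟩
    · rw [vals, List.reverse_cons, h2, List.map_append]
      rfl

theorem heapC_spec (sets : List (List ℕ)) :
    WF n (heapC n sets) ∧ (vals e (heapC n sets)).reverse = hfValues e sets := by
  induction sets using List.reverseRecOn with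
  | nil =>
    have h := vals_atoms (e := e) le_rfl
    refine ⟨by simpa [heapC] using h.1, ?_⟩
    simp only [heapC, List.length_nil, List.range_zero, List.map_nil, List.reverse_nil,
      List.nil_append, hfValues, List.foldl_nil]
    rw [h.2]
    refine List.ext_getElem (by simp) fun i h1 h2 => ?_
    have hi : i < n := by simpa using h1
    simp [atomOf, hi]
  | append_singleton sets r ih =>
    obtain ⟨h1, h2⟩ := ih
    rw [heapC_append, hfValues_append, ← h2]
    refine ⟨⟨⟨by simp, fun j hj => ?_⟩, h1⟩, ?_⟩
    · obtain ⟨i, -, hi⟩ := List.mem_filterMap.1 hj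
      rw [length_heapC]
      by_cases hlt : i < n + sets.length
      · simp only [hlt, decide_true, cond_true, Option.some.injEq] at hi
        omega
      · simp [hlt] at hi
    · rw [vals, List.reverse_cons, entVal_set]
      congr 4
      rw [List.filterMap_filterMap]
      refine List.filterMap_congr fun j _ => ?_
      by_cases hlt : j < n + sets.length
      · simp only [hlt, decide_true, cond_true, Option.bind_some]
        rw [List.getElem?_reverse (by rw [length_vals, length_heapC]; omega), length_vals,
          length_heapC]
        congr 2
        omega
      · simp only [hlt, decide_false, cond_false, Option.bind_none]
        rw [List.getElem?_eq_none]
        rw [List.length_reverse, length_vals, length_heapC]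
        omega

theorem find?_map_range (m : ℕ) (f : ℕ → Code) (v : ℕ) :
    ((List.range m).map fun i => (i, f i)).find? (fun q => q.1 == v) =
      if v < m then some (v, f v) else none := by
  induction m with
  | zero => simp
  | succ m ih =>
    rw [List.range_succ, List.map_append, List.find?_append, ih]
    by_cases h : v < m
    · simp [h, h.trans (Nat.lt_succ_self m)]
    · by_cases h' : v = m
      · simp [h']
      · have : (m == v) = false := by simpa using Ne.symm h'
        have h'' : ¬ v < m + 1 := by omega
        simp [h, h'', this]

theorem paramsC_spec {k : ℕ} {a : Fin k → HF A} {sets : List (List ℕ)} {params : List ℕ}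
    (h : (params.map fun r => (hfValues e sets)[r]?) = List.ofFn fun i => some (a i)) :
    RepAsg e (paramsC (heapC n sets) params) (assign a) := by
  have hlen : params.length = k := by simpa using congrArg List.length h
  obtain ⟨h1, h2⟩ := heapC_spec (e := e) sets
  intro v
  rw [lookup, paramsC, find?_map_range, hlen, assign]
  by_cases hv : v < k
  · have hp : (hfValues e sets)[params.getD v 0]? = some (a ⟨v, hv⟩) := by
      have := congrArg (fun l => l[v]?) h
      rw [List.getD_eq_getElem _ _ (by omega)]
      simpa [hv, hlen, List.getElem?_eq_getElem (show v < params.length by omega)] using this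
    have hlt := (List.getElem?_eq_some_iff.1 hp).1
    rw [← h2] at hp hlt
    rw [List.length_reverse] at hlt
    rw [List.getElem?_reverse hlt] at hp
    rw [length_vals] at hp hlt
    simp only [hv, if_true, Option.elim_some, dite_true]
    refine ⟨⟨fun h => ?_, h1.drop _⟩, by rw [den_drop, hp]; rfl⟩
    rw [List.drop_eq_nil_iff] at h
    omega
  · simp only [hv, if_false, Option.elim_none, dite_false]
    exact ⟨good_emptyC, den_emptyC⟩

theorem setsOf_cons (x : Ent) (v : Code) : setsOf n (x :: v) = setsOf n v ++ [rowC n (x :: v)] := by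
  simp [setsOf, List.range_succ_eq_map, Function.comp_def]

theorem setsOf_spec {v : Code} (hv : WF n v) : (hfValues e (setsOf n v)).length = n + v.length ∧
    (hfValues e (setsOf n v)).take n = List.ofFn (fun i => HF.atom (e i)) ∧
    ∀ i < v.length, (hfValues e (setsOf n v))[posC n (v.drop i)]? = some (den e (v.drop i)) := by
  induction v with
  | nil =>
    refine ⟨by simp [setsOf, hfValues], ?_, by simp⟩
    simp only [setsOf, List.length_nil, List.range_zero, List.map_nil, List.reverse_nil, hfValues,
      List.foldl_nil]
    exact List.take_of_length_le (by simp)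
  | cons x v ih =>
    obtain ⟨h1, h2, h3⟩ := ih hv.2
    rw [setsOf_cons, hfValues_append]
    refine ⟨by simp [h1]; omega, by rw [List.take_append_of_le_length (by omega), h2],
      fun i hi => ?_⟩
    cases i with
    | succ i =>
      have := h3 i (by simpa using hi)
      rw [List.drop_succ_cons, List.getElem?_append_left (List.getElem?_eq_some_iff.1 this).1, this]
    | zero =>
      obtain ⟨_ | a, l⟩ := x
      · have hpos : posC n ((none, l) :: v) = (hfValues e (setsOf n v)).length := by
          simp [posC, h1]
        rw [List.drop_zero, hpos, List.getElem?_concat_length]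
        simp only [den, vals, List.headD_cons, entVal_set, rowC, List.tail_cons,
          List.filterMap_map, Function.comp_def]
        congr 3
        refine List.filterMap_congr fun j hj => ?_
        have hj' : j < v.length := hv.1.2 j hj
        rw [h3 j hj', den_drop, List.getElem?_eq_getElem (by rwa [length_vals])]
        rfl
      · have ha := (hv.1.1 a rfl).1
        have hd : den e ((some a, l) :: v) = HF.atom (e ⟨a, ha⟩) :=
          entVal_atom (vs := vals e v) (l := l) ha
        have hpos : posC n ((some a, l) :: v) = a := rfl
        rw [List.drop_zero, hpos, hd, List.getElem?_append_left (by omega)]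
        have := congrArg (fun l => l[a]?) h2
        simpa [List.getElem?_take, ha] using this

theorem setsOf_represents {v : Code} (hv : Good n v) :
    (hfValues e (setsOf n v))[posC n v]? = some (den e v) := by
  have := (setsOf_spec (e := e) hv.2).2.2 0 (List.length_pos_iff.2 hv.1)
  simpa using this

end

/-! ### Running times -/

section

variable {ε : Type} [Enc ε]

theorem PT.pow {f : ε → ℕ} (hf : PT f) (k : ℕ) : PT fun e => f e ^ k := by
  induction k with
  | zero => simpa using .const _
  | succ k ih => simp only [pow_succ]; fun_prop

@[fun_prop]
theorem PT.polynomial (p : Polynomial ℕ) {f : ε → ℕ} (hf : PT f) : PT fun e => p.eval (f e) := by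
  induction p using Polynomial.induction_on' with
  | add p q hp hq => simp only [Polynomial.eval_add]; fun_prop
  | monomial k a =>
    have := hf.pow k
    simp only [Polynomial.eval_monomial]
    fun_prop

@[fun_prop]
theorem PT.heapC {n : ε → ℕ} {sets : ε → List (List ℕ)} (hn : PT n) (hs : PT sets) :
    PT fun e => heapC (n e) (sets e) := by
  unfold CPTWSC.heapC
  fun_prop

@[fun_prop]
theorem PT.paramsC {h : ε → Code} {params : ε → List ℕ} (hh : PT h) (hp : PT params) :
    PT fun e => paramsC (h e) (params e) := by
  unfold CPTWSC.paramsC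
  fun_prop

@[fun_prop]
theorem PT.posC {n : ε → ℕ} {v : ε → Code} (hn : PT n) (hv : PT v) :
    PT fun e => posC (n e) (v e) := by
  have : PT fun e => ((v e).headD (none, [])).1.elim (n e + ((v e).length - 1)) fun a => a := by
    fun_prop
  exact this

@[fun_prop]
theorem PT.setsOf {n : ε → ℕ} {v : ε → Code} (hn : PT n) (hv : PT v) :
    PT fun e => setsOf (n e) (v e) := by
  unfold CPTWSC.setsOf rowC
  fun_prop

theorem decodeSym_eq (s : Sym) (d : List (List (List ℕ))) : decodeSym s d =
    bif s.toNat == 0 then d.head?.elim [] fun b => (b.head?.elim [] fun r =>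
      (r.head?.elim [] fun m => (m + 1) :: r.tail) :: b.tail) :: d.tail
    else bif s.toNat == 1 then d.head?.elim [] fun b => (b.head?.elim [] fun r =>
      (0 :: r) :: b.tail) :: d.tail
    else bif s.toNat == 2 then d.head?.elim [] fun b => ([] :: b) :: d.tail
    else [] :: d := by
  cases s <;> rcases d with _ | ⟨_ | ⟨_ | _, _⟩, _⟩ <;> rfl

theorem esize_decodeSym_le (s : Sym) (d : List (List (List ℕ))) :
    esize (decodeSym s d) ≤ esize d + 2 := by
  cases s <;> rcases d with _ | ⟨_ | ⟨_ | _, _⟩, _⟩ <;> simp [decodeSym] <;> omega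

@[fun_prop]
theorem PT.decodeData {w : ε → List Sym} (hw : PT w) : PT fun e => decodeData (w e).reverse := by
  have hnat : PT Sym.toNat := .of_enc (f := fun x => x) .id fun _ => rfl
  have h : PT fun p : (ε × List (List (List ℕ))) × Sym => decodeSym p.2 p.1.2 := by
    simp only [decodeSym_eq]
    have : PT fun p : (ε × List (List (List ℕ))) × Sym => p.2.toNat := hnat.comp (by fun_prop)
    fun_prop
  have : PT fun e => (w e).foldl (fun d s => decodeSym s d) [] :=
    .foldl_of_le (f := fun (_ : ε) d s => decodeSym s d) h hw (.const _) 2 fun e d s =>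
      (esize_decodeSym_le s d).trans (by omega)
  exact this.of_eq fun e => by rw [CPTWSC.decodeData, List.foldr_reverse]

@[fun_prop]
theorem PT.encodeNum {f : ε → ℕ} (hf : PT f) : PT fun e => encodeNum (f e) := by
  have : PT fun e => (List.range (f e)).map (fun _ => Sym.tick) ++ [Sym.num] := by fun_prop
  exact this.of_eq fun e => by simp [CPTWSC.encodeNum]

@[fun_prop]
theorem PT.encodeData {f : ε → List (List (List ℕ))} (hf : PT f) :
    PT fun e => encodeData (f e) := by
  unfold CPTWSC.encodeData encodeBlock encodeRow
  fun_prop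

end

/-- The values that an algorithm for a term or formula works with. -/
noncomputable def ctxOf (p : Polynomial ℕ) (d : List (List (List ℕ))) : Ctx × Asg :=
  let n := ((d.headD []).headD []).headD 0
  ((n, p.eval n, d.drop 2), paramsC (heapC n ((d.drop 1).headD [])) (((d.headD []).drop 1).headD []))

theorem PT.ctxOf (p : Polynomial ℕ) : PT (ctxOf p) := by
  unfold CPTWSC.ctxOf
  fun_prop

/-- The data in an input. -/
def InputCode.data (c : InputCode) : List (List (List ℕ)) := [[c.size], c.params] :: c.sets :: c.rels

section

variable {ℓ k : ℕ} {ar : Fin ℓ → ℕ} {A : Type} [Fintype A] {S : Struct ar A} {a : Fin k → HF A}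
  {c : InputCode} {e : Fin c.size ≃ A}

theorem ctxOf_data (p : Polynomial ℕ) (c : InputCode) : ctxOf p c.data =
    ((c.size, p.eval c.size, c.rels), paramsC (heapC c.size c.sets) c.params) := rfl

theorem Term.code_data (s : Term ar) (p : Polynomial ℕ) (h : c.Represents e S a) :
    Rep e (s.code (ctxOf p c.data).1 (ctxOf p c.data).2)
      (s.eval (p.eval (Fintype.card A)) S (assign a)) := by
  rw [ctxOf_data, ← Fintype.card_congr e, Fintype.card_fin]
  exact s.code_spec h.1 (paramsC_spec h.2)

theorem Formula.code_data (Φ : Formula ar) (p : Polynomial ℕ) (h : c.Represents e S a) :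
    Φ.code (ctxOf p c.data).1 (ctxOf p c.data).2 =
      Φ.eval (p.eval (Fintype.card A)) S (assign a) := by
  rw [ctxOf_data, ← Fintype.card_congr e, Fintype.card_fin]
  exact Φ.code_spec h.1 (paramsC_spec h.2)

end

theorem decodeData_encode (c : InputCode) :
    decodeData (inputEncoding.encode c).reverse.reverse = c.data := by
  rw [List.reverse_reverse]
  exact decode_encodeData _

theorem pt_ctxOf_decodeData (p : Polynomial ℕ) :
    PT fun w : List Sym => ctxOf p (decodeData w.reverse) :=
  (PT.ctxOf p).comp (.decodeData .id)

theorem pt_setEncoding : PT fun o : SetCode => (setEncoding.encode o).reverse := by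
  have : PT fun o : SetCode =>
    (o.elim (encodeData []) fun q => encodeData [q.1, [[q.2]]]).reverse := by fun_prop
  exact this.of_eq fun o => by cases o <;> rfl

theorem pt_truthEncoding : PT fun o : Option Bool => (truthEncoding.encode o).reverse := by
  have : PT fun o : Option Bool => o.elim [] fun b => [b] := by fun_prop
  exact this.of_eq fun o => by cases o <;> rfl

variable {ℓ : ℕ} {ar : Fin ℓ → ℕ}

/-- The result of the algorithm for a term. -/
noncomputable def Term.algorithm (s : Term ar) (q : Ctx × Asg) : SetCode :=
  (s.code q.1 q.2).map fun v => (setsOf q.1.1 v, posC q.1.1 v)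

theorem Term.algorithm_pt (s : Term ar) : PT s.algorithm := by
  have := s.pt
  unfold Term.algorithm
  fun_prop

theorem Term.algorithm_represents {k : ℕ} {A : Type} [Fintype A] {S : Struct ar A}
    {a : Fin k → HF A} {c : InputCode} {e : Fin c.size ≃ A} (s : Term ar) (p : Polynomial ℕ)
    (h : c.Represents e S a) : (s.algorithm (ctxOf p c.data)).Represents e
      (s.eval (p.eval (Fintype.card A)) S (assign a)) := by
  unfold SetCode.Represents Term.algorithm
  rcases s.code_data p h with ⟨h1, h2⟩ | ⟨v, h1, hv, h2⟩
  · simp only [h1, h2, Option.map_none]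
  · simp only [h1, h2, Option.map_some]
    exact congrArg some (setsOf_represents hv)

theorem Term.tm2 (s : Term ar) (p : Polynomial ℕ) :
    Nonempty (TM2ComputableInPolyTime inputEncoding.encode setEncoding.encode
      fun c => s.algorithm (ctxOf p c.data)) :=
  PT.tm2 sym_dec (pt_setEncoding.comp (s.algorithm_pt.comp (pt_ctxOf_decodeData p))) fun c => by
    rw [decodeData_encode]

theorem Formula.tm2 (Φ : Formula ar) (p : Polynomial ℕ) :
    Nonempty (TM2ComputableInPolyTime inputEncoding.encode truthEncoding.encode
      fun c => Φ.code (ctxOf p c.data).1 (ctxOf p c.data).2) :=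
  PT.tm2 bool_dec (pt_truthEncoding.comp (Φ.pt.comp (pt_ctxOf_decodeData p))) fun c => by
    rw [decodeData_encode]

end CPTWSC

theorem mainTheorem11 {ℓ : ℕ} (ar : Fin ℓ → ℕ) (p : Polynomial ℕ) (k : ℕ) :
    (∀ s : CPTWSC.Term ar, s.freeVars ⊆ Finset.range k →
      ∃ f : CPTWSC.InputCode → CPTWSC.SetCode,
        Nonempty (Turing.TM2ComputableInPolyTime
          CPTWSC.inputEncoding.encode CPTWSC.setEncoding.encode f) ∧
        ∀ (A : Type) [Fintype A] (S : CPTWSC.Struct ar A) (a : Fin k → CPTWSC.HF A)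
          (c : CPTWSC.InputCode) (e : Fin c.size ≃ A), c.Represents e S a →
          (f c).Represents e (s.denotation p S a)) ∧
    (∀ Φ : CPTWSC.Formula ar, Φ.freeVars ⊆ Finset.range k →
      ∃ f : CPTWSC.InputCode → Option Bool,
        Nonempty (Turing.TM2ComputableInPolyTime
          CPTWSC.inputEncoding.encode CPTWSC.truthEncoding.encode f) ∧
        ∀ (A : Type) [Fintype A] (S : CPTWSC.Struct ar A) (a : Fin k → CPTWSC.HF A)
          (c : CPTWSC.InputCode) (e : Fin c.size ≃ A), c.Represents e S a →
          f c = Φ.denotation p S a) :=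
  ⟨fun s _ => ⟨_, s.tm2 p, fun _ _ _ _ _ _ h => s.algorithm_represents p h⟩,
    fun Φ _ => ⟨_, Φ.tm2 p, fun _ _ _ _ _ _ h => Φ.code_data p h⟩⟩
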